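/- Conventions. All manifolds are smooth, Hausdorff, finite-dimensional and without boundary. Let $M$ be a manifold and $\mathbb TM=TM\oplus T^*M$ with the metric $g_{\rm can}(X+\xi,Y+\eta)=\frac12(\xi(Y)+\eta(X))$. A *generalized complex structure* is a smooth field $\mathcal J$ of endomorphisms of $\mathbb TM$ with $\mathcal J^2=-\mathrm{Id}$ (no integrability is assumed); it is *skew-symmetric* if it is skew-symmetric with respect to $g_{\rm can}$. Its *holomorphic bundle* $L\subset\mathbb T^{\mathbb C}M$ is its $i$-eigenbundle, and $\mathcal J$ is *Courant integrable* if $\Gamma(L)$ is closed under the (complex bilinear extension of the) Courant bracket $$[X+\xi,Y+\eta]=[X,Y]+L_X\eta-L_Y\xi+\tfrac12\,d\big(\xi(Y)-\eta(X)\big).$$ Let $D$ be a (smooth) linear connection on $M$, with torsion $T^D_XY=D_XY-D_YX-[X,Y]$ and curvature $R^D_{X,Y}=-D_XD_Y+D_YD_X+D_{[X,Y]}$; $D,T^D,R^D$ are extended complex linearly. The connection induced by $D$ on $\pi:T^*M\to M$ gives, for $\gamma\in T^*_xM$, a splitting of $T_\gamma(T^*M)$ into its horizontal and vertical subspaces,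 hence an identification $T_\gamma(T^*M)\cong T_xM\oplus T^*_xM$; let $J^{\mathcal J,D}$ be the almost complex structure on the manifold $T^*M$ which corresponds to $\pi^*\mathcal J$ under this identification. An almost complex structure is *integrable* if its $i$-eigenbundle in the complexified tangent bundle is involutive (i.e. its sections are closed under the Lie bracket). **1.** Let $\mathcal J$ be a skew-symmetric generalized complex structure on $M$ with holomorphic bundle $$L=L(E,\alpha)=\{X+\xi:\ X\in E,\ \xi|_E=i_X\alpha\},$$ where $E\subset T^{\mathbb C}M$ is a smooth complex vector subbundle and $\alpha$ is a section of $E^*\otimes E^*$. Let $D$ be a linear connection on $M$ and suppose that $E$ is involutive, $D_{\Gamma(E)}\Gamma(E)\subset\Gamma(E)$, $R^D_{X,Y}Z=0$ for all $X,Y,Z\in\Gamma(E)$, and $$(D_Z\alpha)(X,Y)+\alpha(T^D_ZX,Y)+\alpha(X,T^D_ZY)=0\qquad\text{for all }X,Y,Z\in\Gamma(E).$$ Then $J^{\mathcal J,D}$ is integrable if and only if $\mathcal J$ is Courant integrable. **2.** Let $G$ be a Lie group and $D^c$ the left-invariant connection on $G$ with $D^c_XY=[X,Y]$ for all left-invariant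 vector fields $X,Y$. Then a left-invariant skew-symmetric generalized complex structure $\mathcal J$ on $G$ is Courant integrable if and only if $J^{\mathcal J,D^c}$ is integrable. -/

import Mathlib

open Bundle VectorField
open scoped Manifold ContDiff

noncomputable section

/-! ### Complexification of real vector spaces -/

/-- The complexification `V ⊗ ℂ = V ⊕ iV` of a real vector space `V`; `⟨a, b⟩` stands for
`a + i b`. -/
@[ext]
structure Complexification (V : Type*) where
  /-- real part -/
  re : V
  /-- imaginary part -/
  im : V

namespace Complexification

variable {V W : Type*}

/-- A complexified vector as the pair of its real and imaginary parts. -/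
def equivProd (V : Type*) : Complexification V ≃ V × V where
  toFun z := (z.re, z.im)
  invFun p := ⟨p.1, p.2⟩
  left_inv _ := rfl
  right_inv _ := rfl

instance [AddCommGroup V] : AddCommGroup (Complexification V) := (equivProd V).addCommGroup

@[simp] theorem re_zero [AddCommGroup V] : (0 : Complexification V).re = 0 := rfl
@[simp] theorem im_zero [AddCommGroup V] : (0 : Complexification V).im = 0 := rfl
@[simp] theorem re_add [AddCommGroup V] (z w : Complexification V) :
    (z + w).re = z.re + w.re := rfl
@[simp] theorem im_add [AddCommGroup V] (z w : Complexification V) :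
    (z + w).im = z.im + w.im := rfl

variable [AddCommGroup V] [Module ℝ V] [AddCommGroup W] [Module ℝ W]

instance : SMul ℂ (Complexification V) where
  smul c z := ⟨c.re • z.re - c.im • z.im, c.re • z.im + c.im • z.re⟩

@[simp] theorem re_smul (c : ℂ) (z : Complexification V) :
    (c • z).re = c.re • z.re - c.im • z.im := rfl
@[simp] theorem im_smul (c : ℂ) (z : Complexification V) :
    (c • z).im = c.re • z.im + c.im • z.re := rfl

instance : Module ℂ (Complexification V) where
  one_smul z := by ext <;> simp
  mul_smul a b z := by ext <;> simp <;> module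
  smul_zero a := by ext <;> simp
  smul_add a z w := by ext <;> simp <;> module
  add_smul a b z := by ext <;> simp <;> module
  zero_smul z := by ext <;> simp

/-- The complex linear extension of a real linear map. -/
def map (A : V →ₗ[ℝ] W) : Complexification V →ₗ[ℂ] Complexification W where
  toFun z := ⟨A z.re, A z.im⟩
  map_add' z w := by ext <;> simp
  map_smul' c z := by ext <;> simp

/-- The `i`-eigenspace, in the complexification, of a real endomorphism. -/
def iEigenspace (A : V →ₗ[ℝ] V) : Submodule ℂ (Complexification V) :=
  Module.End.eigenspace (map A) Complex.I

end Complexification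

open Complexification

/-! ### Complex sections of real vector bundles -/

section Sections

variable {V : Type*} [NormedAddCommGroup V] [NormedSpace ℝ V]
  {H : Type*} [TopologicalSpace H] (I : ModelWithCorners ℝ V H)
  {M : Type*} [TopologicalSpace M] [ChartedSpace H M]
  (F : Type*) [NormedAddCommGroup F] [NormedSpace ℝ F]
  {B : M → Type*} [TopologicalSpace (TotalSpace F B)]
  [∀ x, AddCommGroup (B x)] [∀ x, Module ℝ (B x)] [∀ x, TopologicalSpace (B x)]
  [FiberBundle F B]

/-- `Z` is, over `U`, a smooth section of the complexification of the real vector bundle `B`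
which takes its values in the complex subspaces `S x`. -/
structure IsSectionOn (S : ∀ x, Submodule ℂ (Complexification (B x))) (U : Set M)
    (Z : ∀ x, Complexification (B x)) : Prop where
  smooth_re : ContMDiffOn I (I.prod 𝓘(ℝ, F)) ∞ (fun x ↦ TotalSpace.mk' F x (Z x).re) U
  smooth_im : ContMDiffOn I (I.prod 𝓘(ℝ, F)) ∞ (fun x ↦ TotalSpace.mk' F x (Z x).im) U
  mem : ∀ x ∈ U, Z x ∈ S x

/-- The family `S` of complex subspaces is a smooth complex vector subbundle of the
complexification of `B`: near every point it has a smooth local frame. -/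
def IsComplexSubbundle (S : ∀ x, Submodule ℂ (Complexification (B x))) : Prop :=
  ∀ x₀ : M, ∃ U : Set M, IsOpen U ∧ x₀ ∈ U ∧ ∃ (k : ℕ) (Z : Fin k → ∀ x, Complexification (B x)),
    (∀ j, IsSectionOn I F S U (Z j)) ∧
    ∀ x ∈ U, LinearIndependent ℂ (fun j ↦ Z j x) ∧
      Submodule.span ℂ (Set.range fun j ↦ Z j x) = S x

/-- The complex bilinear extension of an operation which is real bilinear on sections. -/
def cxExtend {B₁ B₂ B₃ : M → Type*} [∀ x, AddCommGroup (B₃ x)]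
    (op : (∀ x, B₁ x) → (∀ x, B₂ x) → ∀ x, B₃ x)
    (Z : ∀ x, Complexification (B₁ x)) (W : ∀ x, Complexification (B₂ x)) (x : M) :
    Complexification (B₃ x) :=
  ⟨op (fun y ↦ (Z y).re) (fun y ↦ (W y).re) x - op (fun y ↦ (Z y).im) (fun y ↦ (W y).im) x,
    op (fun y ↦ (Z y).re) (fun y ↦ (W y).im) x + op (fun y ↦ (Z y).im) (fun y ↦ (W y).re) x⟩

/-- The sections of `S` (over arbitrary open sets) are closed under the complex bilinear
extension of the operation `op`. -/
def SectionsClosedUnder (S : ∀ x, Submodule ℂ (Complexification (B x)))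
    (op : (∀ x, B x) → (∀ x, B x) → ∀ x, B x) : Prop :=
  ∀ U : Set M, IsOpen U → ∀ Z W : ∀ x, Complexification (B x),
    IsSectionOn I F S U Z → IsSectionOn I F S U W → ∀ x ∈ U, cxExtend op Z W x ∈ S x

end Sections

section Tangent

variable {V : Type*} [NormedAddCommGroup V] [NormedSpace ℝ V]
  {H : Type*} [TopologicalSpace H] (I : ModelWithCorners ℝ V H)
  {M : Type*} [TopologicalSpace M] [ChartedSpace H M]

/-- The complexified tangent space. -/
abbrev CxTangent (x : M) : Type _ := Complexification (TangentSpace I x)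

/-- The derivative `Z(f)` of a complex function along a complex tangent vector. -/
def cxDeriv {x : M} (Z : CxTangent I x) (f : M → ℂ) : ℂ :=
  mvfderiv I f x Z.re + Complex.I * mvfderiv I f x Z.im

variable [IsManifold I 1 M]

/-- A family `S` of subspaces of the complexified tangent spaces is involutive:
`[Γ(S), Γ(S)] ⊆ Γ(S)`. -/
def IsInvolutive (S : ∀ x : M, Submodule ℂ (CxTangent I x)) : Prop :=
  SectionsClosedUnder I V S (mlieBracket I)

/-- A field `K` of endomorphisms of the tangent bundle (an almost complex structure) is integrable:
its holomorphic bundle `T¹⁰`, that is its `i`-eigenbundle, is involutive. -/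
def IsIntegrableAlmostComplex (K : ∀ x : M, TangentSpace I x →ₗ[ℝ] TangentSpace I x) : Prop :=
  IsInvolutive I (fun x ↦ iEigenspace (K x))

end Tangent

/-! ### The generalized tangent bundle -/

section GeneralizedTangent

variable {V : Type*} [NormedAddCommGroup V] [NormedSpace ℝ V]
  {H : Type*} [TopologicalSpace H] (I : ModelWithCorners ℝ V H)
  {M : Type*} [TopologicalSpace M] [ChartedSpace H M]

/-- The cotangent space `T*ₓM`. -/
abbrev CotangentSpace (x : M) : Type _ := TangentSpace I x →L[ℝ] ℝ

/-- The generalized tangent space `TₓM ⊕ T*ₓM`. -/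
abbrev GTangentSpace (x : M) : Type _ := TangentSpace I x × CotangentSpace I x

/-- The canonical metric of neutral signature on `TₓM ⊕ T*ₓM`. -/
def gCan {x : M} (u v : GTangentSpace I x) : ℝ := (1 / 2) * (u.2 v.1 + v.2 u.1)

variable (M) in
/-- A generalized complex structure on `M`: a smooth field of endomorphisms of `TM ⊕ T*M` with
square `-Id`. -/
structure GeneralizedComplexStructure [IsManifold I 1 M] where
  /-- the endomorphism of `TₓM ⊕ T*ₓM` -/
  toFun : ∀ x : M, GTangentSpace I x →L[ℝ] GTangentSpace I x
  smooth : ContMDiff I (I.prod 𝓘(ℝ, (V × (V →L[ℝ] ℝ)) →L[ℝ] (V × (V →L[ℝ] ℝ)))) ∞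
    (fun x ↦ TotalSpace.mk' ((V × (V →L[ℝ] ℝ)) →L[ℝ] (V × (V →L[ℝ] ℝ)))
      (E := fun x : M ↦ GTangentSpace I x →L[ℝ] GTangentSpace I x) x (toFun x))
  sq : ∀ (x : M) (u : GTangentSpace I x), toFun x (toFun x u) = -u

variable {I}

/-- The generalized complex structure is skew-symmetric with respect to the canonical metric. -/
def GeneralizedComplexStructure.IsSkewSymmetric [IsManifold I 1 M]
    (J : GeneralizedComplexStructure I M) : Prop :=
  ∀ (x : M) (u v : GTangentSpace I x), gCan I (J.toFun x u) v = -gCan I u (J.toFun x v)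

/-- The holomorphic bundle of a generalized complex structure: its `i`-eigenbundle in the
complexified generalized tangent bundle. -/
def GeneralizedComplexStructure.holomorphicBundle [IsManifold I 1 M]
    (J : GeneralizedComplexStructure I M) (x : M) :
    Submodule ℂ (Complexification (GTangentSpace I x)) :=
  iEigenspace (J.toFun x : GTangentSpace I x →ₗ[ℝ] GTangentSpace I x)

/-- The projection of a complex generalized tangent vector `X + ξ` to `X`. -/
def cxVector {x : M} (u : Complexification (GTangentSpace I x)) : CxTangent I x :=
  ⟨u.re.1, u.im.1⟩

/-- The value `ξ(Y)` of the form part of a complex generalized tangent vector `X + ξ` on a complex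
tangent vector `Y`. -/
def cxFormApply {x : M} (u : Complexification (GTangentSpace I x)) (Y : CxTangent I x) : ℂ :=
  ⟨u.re.2 Y.re - u.im.2 Y.im, u.re.2 Y.im + u.im.2 Y.re⟩

/-- The set `L(E, α) = {X + ξ : X ∈ E, ξ|_E = α(X, ·)}` at one point. -/
def holomorphicSpace {x : M} (E : Submodule ℂ (CxTangent I x)) (α : E →ₗ[ℂ] E →ₗ[ℂ] ℂ) :
    Set (Complexification (GTangentSpace I x)) :=
  {u | ∃ hX : cxVector u ∈ E, ∀ Y : E, cxFormApply u (Y : CxTangent I x) = α ⟨cxVector u, hX⟩ Y}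

open Classical in
/-- The value `α(X, Y)` for vectors `X, Y` of `E` (and `0` if one of them is not in `E`). -/
def evalOn {x : M} (E : Submodule ℂ (CxTangent I x)) (α : E →ₗ[ℂ] E →ₗ[ℂ] ℂ)
    (X Y : CxTangent I x) : ℂ :=
  if h : X ∈ E ∧ Y ∈ E then α ⟨X, h.1⟩ ⟨Y, h.2⟩ else 0

end GeneralizedTangent

/-! ### Lie derivatives of one-forms, dual connections -/

section Calculus

variable {V : Type*} [NormedAddCommGroup V] [NormedSpace ℝ V]
  {H : Type*} [TopologicalSpace H] {I : ModelWithCorners ℝ V H}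
  {M : Type*} [TopologicalSpace M] [ChartedSpace H M] [IsManifold I 2 M]

/-- Vector fields and one-forms which are differentiable at a point pair to a differentiable
function. -/
theorem mdifferentiableAt_pairing {x : M} {η : ∀ x : M, CotangentSpace I x}
    {Z : ∀ x : M, TangentSpace I x}
    (hη : MDifferentiableAt I (I.prod 𝓘(ℝ, V →L[ℝ] ℝ))
      (fun y ↦ TotalSpace.mk' (V →L[ℝ] ℝ) (E := CotangentSpace I) y (η y)) x)
    (hZ : MDifferentiableAt I (I.prod 𝓘(ℝ, V)) (fun y ↦ TotalSpace.mk' V y (Z y)) x) :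
    MDifferentiableAt I 𝓘(ℝ, ℝ) (fun y ↦ η y (Z y)) x := by
  have h := MDifferentiableAt.clm_bundle_apply (F₁ := V) (F₂ := ℝ)
    (E₁ := (TangentSpace I : M → Type _)) (E₂ := fun _ : M ↦ ℝ) hη hZ
  exact ((mdifferentiableAt_totalSpace I _).1 h).2

/-- For differentiable `X, η` the expression `X(η(Z)) - η([X, Z])` is tensorial in `Z`. -/
theorem tensorialAt_lieDerivOneForm [CompleteSpace V] {x : M} (X : ∀ x : M, TangentSpace I x)
    {η : ∀ x : M, CotangentSpace I x}
    (hη : MDifferentiableAt I (I.prod 𝓘(ℝ, V →L[ℝ] ℝ))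
      (fun y ↦ TotalSpace.mk' (V →L[ℝ] ℝ) (E := CotangentSpace I) y (η y)) x) :
    TensorialAt I V (fun Z : ∀ x : M, TangentSpace I x ↦
      mvfderiv I (fun y ↦ η y (Z y)) x (X x) - η x (mlieBracket I X Z x)) x where
  smul {f Z} hf hZ := by
    have h : (fun y ↦ η y ((f • Z) y)) = f * fun y ↦ η y (Z y) := by
      ext y; simp
    rw [h, mvfderiv_mul hf (mdifferentiableAt_pairing hη hZ), mlieBracket_smul_right hf hZ]
    simp only [add_apply, smul_apply, smul_eq_mul,
      map_add, map_smul]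
    ring
  add {Z W} hZ hW := by
    have h : (fun y ↦ η y ((Z + W) y)) = (fun y ↦ η y (Z y)) + fun y ↦ η y (W y) := by
      ext y; simp
    rw [h, mvfderiv_add (mdifferentiableAt_pairing hη hZ) (mdifferentiableAt_pairing hη hW),
      mlieBracket_add_right hZ hW]
    simp only [add_apply, map_add]
    ring

/-- For a linear connection `D`, the expression `v(ξ(Z)) - ξ(D_v Z)` is tensorial in `Z`. -/
theorem tensorialAt_dualConnection (D : CovariantDerivative I V (TangentSpace I : M → Type _))
    {x : M} {ξ : ∀ x : M, CotangentSpace I x}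
    (hξ : MDifferentiableAt I (I.prod 𝓘(ℝ, V →L[ℝ] ℝ))
      (fun y ↦ TotalSpace.mk' (V →L[ℝ] ℝ) (E := CotangentSpace I) y (ξ y)) x)
    (v : TangentSpace I x) :
    TensorialAt I V (fun Z : ∀ x : M, TangentSpace I x ↦
      mvfderiv I (fun y ↦ ξ y (Z y)) x v - ξ x (D Z x v)) x where
  smul {f Z} hf hZ := by
    have h : (fun y ↦ ξ y ((f • Z) y)) = f * fun y ↦ ξ y (Z y) := by
      ext y; simp
    rw [h, mvfderiv_mul hf (mdifferentiableAt_pairing hξ hZ),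
      D.isCovariantDerivativeOnUniv.leibniz hZ hf]
    simp only [add_apply, smul_apply, smul_eq_mul,
      map_add, map_smul, ContinuousLinearMap.smulRight_apply]
    ring
  add {Z W} hZ hW := by
    have h : (fun y ↦ ξ y ((Z + W) y)) = (fun y ↦ ξ y (Z y)) + fun y ↦ ξ y (W y) := by
      ext y; simp
    rw [h, mvfderiv_add (mdifferentiableAt_pairing hξ hZ) (mdifferentiableAt_pairing hξ hW),
      D.isCovariantDerivativeOnUniv.add hZ hW]
    simp only [add_apply, map_add]
    ring

variable [FiniteDimensional ℝ V]

open Classical in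
/-- The Lie derivative `L_X η` of a one-form at a point where `η` is differentiable:
`(L_X η)(Z) = X(η(Z)) - η([X, Z])` for vector fields `Z`. -/
def lieDerivOneForm (X : ∀ x : M, TangentSpace I x) (η : ∀ x : M, CotangentSpace I x) (x : M) :
    CotangentSpace I x :=
  if hη : MDifferentiableAt I (I.prod 𝓘(ℝ, V →L[ℝ] ℝ))
      (fun y ↦ TotalSpace.mk' (V →L[ℝ] ℝ) (E := CotangentSpace I) y (η y)) x then
    TensorialAt.mkHom _ x (tensorialAt_lieDerivOneForm X hη)
  else 0

/-- The Courant bracket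
`[X + ξ, Y + η] = [X, Y] + L_X η - L_Y ξ + (1/2) d(ξ(Y) - η(X))`
of real sections of the generalized tangent bundle. -/
def courantBracket (u v : ∀ x : M, GTangentSpace I x) (x : M) : GTangentSpace I x :=
  (mlieBracket I (fun y ↦ (u y).1) (fun y ↦ (v y).1) x,
    lieDerivOneForm (fun y ↦ (u y).1) (fun y ↦ (v y).2) x
      - lieDerivOneForm (fun y ↦ (v y).1) (fun y ↦ (u y).2) x
      + (1 / 2 : ℝ) • mvfderiv I (fun y ↦ (u y).2 (v y).1 - (v y).2 (u y).1) x)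

/-- A generalized complex structure is Courant integrable: the (complex) sections of its holomorphic
bundle are closed under the complex bilinear extension of the Courant bracket. -/
def GeneralizedComplexStructure.IsCourantIntegrable (J : GeneralizedComplexStructure I M) : Prop :=
  SectionsClosedUnder I (V × (V →L[ℝ] ℝ)) J.holomorphicBundle courantBracket

open Classical in
/-- The connection induced by `D` on one-forms, at a point where `ξ` is differentiable:
`(D_v ξ)(Z) = v(ξ(Z)) - ξ(D_v Z)` for vector fields `Z`. -/
def dualConnection (D : CovariantDerivative I V (TangentSpace I : M → Type _))
    (ξ : ∀ x : M, CotangentSpace I x) (x : M) : TangentSpace I x →ₗ[ℝ] CotangentSpace I x :=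
  if hξ : MDifferentiableAt I (I.prod 𝓘(ℝ, V →L[ℝ] ℝ))
      (fun y ↦ TotalSpace.mk' (V →L[ℝ] ℝ) (E := CotangentSpace I) y (ξ y)) x then
    { toFun := fun v ↦ TensorialAt.mkHom _ x (tensorialAt_dualConnection D hξ v)
      map_add' := fun v w ↦ by
        ext z
        simp only [add_apply, TensorialAt.mkHom_apply_eq_extend, map_add]
        ring
      map_smul' := fun c v ↦ by
        ext z
        simp only [smul_apply, TensorialAt.mkHom_apply_eq_extend, map_smul, smul_eq_mul,
          RingHom.id_apply]
        ring }
  else 0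

variable (D : CovariantDerivative I V (TangentSpace I : M → Type _))

/-- The complex linear extension of the linear connection `D`: `(D_X Y)(x)` for complex vector
fields `X, Y`. -/
def cxConnection (X Y : ∀ x : M, CxTangent I x) (x : M) : CxTangent I x :=
  cxExtend (fun X Y x ↦ D Y x (X x)) X Y x

/-- The complex linear extension of the Lie bracket of vector fields. -/
def cxLieBracket (X Y : ∀ x : M, CxTangent I x) (x : M) : CxTangent I x :=
  cxExtend (mlieBracket I) X Y x

/-- The complex linear extension of the torsion `T^D_X Y = D_X Y - D_Y X - [X, Y]`. -/
def cxTorsion (X Y : ∀ x : M, CxTangent I x) (x : M) : CxTangent I x :=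
  cxExtend (fun X Y x ↦ D.torsion x (X x) (Y x)) X Y x

/-- The complex linear extension of the curvature
`R^D_{X,Y} Z = -D_X D_Y Z + D_Y D_X Z + D_{[X,Y]} Z`. -/
def cxCurvature (X Y Z : ∀ x : M, CxTangent I x) (x : M) : CxTangent I x :=
  -cxConnection D X (cxConnection D Y Z) x + cxConnection D Y (cxConnection D X Z) x
    + cxConnection D (cxLieBracket X Y) Z x

/-- `D_{Γ(E)} Γ(E) ⊆ Γ(E)`. -/
def PreservesSections (E : ∀ x : M, Submodule ℂ (CxTangent I x)) : Prop :=
  SectionsClosedUnder I V E (fun X Y x ↦ D Y x (X x))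

/-- `R^D_{E,E} E = 0`. -/
def CurvatureVanishesOn (E : ∀ x : M, Submodule ℂ (CxTangent I x)) : Prop :=
  ∀ U : Set M, IsOpen U → ∀ X Y Z : ∀ x : M, CxTangent I x,
    IsSectionOn I V E U X → IsSectionOn I V E U Y → IsSectionOn I V E U Z →
    ∀ x ∈ U, cxCurvature D X Y Z x = 0

/-- The relation `(D_Z α)(X, Y) + α(T^D_Z X, Y) + α(X, T^D_Z Y) = 0` for all sections `X, Y, Z` of
`E`, where `(D_Z α)(X, Y) = Z(α(X, Y)) - α(D_Z X, Y) - α(X, D_Z Y)`. It is meant for involutive `E`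
with `D_{Γ(E)} Γ(E) ⊆ Γ(E)`, when `α` is only evaluated on vectors of `E`. -/
def TorsionRelation (E : ∀ x : M, Submodule ℂ (CxTangent I x))
    (α : ∀ x : M, E x →ₗ[ℂ] E x →ₗ[ℂ] ℂ) : Prop :=
  ∀ U : Set M, IsOpen U → ∀ X Y Z : ∀ x : M, CxTangent I x,
    IsSectionOn I V E U X → IsSectionOn I V E U Y → IsSectionOn I V E U Z →
    ∀ x ∈ U,
      (cxDeriv I (Z x) (fun y ↦ evalOn (E y) (α y) (X y) (Y y))
          - evalOn (E x) (α x) (cxConnection D Z X x) (Y x)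
          - evalOn (E x) (α x) (X x) (cxConnection D Z Y x))
        + evalOn (E x) (α x) (cxTorsion D Z X x) (Y x)
        + evalOn (E x) (α x) (X x) (cxTorsion D Z Y x) = 0

end Calculus

/-! ### The almost complex structure on the cotangent bundle -/

section CotangentBundle

variable {V : Type*} [NormedAddCommGroup V] [NormedSpace ℝ V]
  {H : Type*} [TopologicalSpace H] (I : ModelWithCorners ℝ V H)
  (M : Type*) [TopologicalSpace M] [ChartedSpace H M] [IsManifold I 2 M]

/-- The cotangent manifold `T*M`. -/
abbrev CotangentBundle : Type _ := TotalSpace (V →L[ℝ] ℝ) (CotangentSpace I : M → Type _)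

variable {I M}

/-- The trivialized fibre inclusion `V* ≅ T*ₓM → T*M`. -/
def fiberInclusion (x : M) (f : V →L[ℝ] ℝ) : CotangentBundle I M :=
  TotalSpace.mk' (V →L[ℝ] ℝ) x
    ((trivializationAt (V →L[ℝ] ℝ) (CotangentSpace I : M → Type _) x).symm x f)

theorem trivialization_fiberInclusion (x : M) (f : V →L[ℝ] ℝ) :
    (trivializationAt (V →L[ℝ] ℝ) (CotangentSpace I : M → Type _) x
      (fiberInclusion (I := I) x f)).2 = f := by
  have h := (trivializationAt (V →L[ℝ] ℝ) (CotangentSpace I : M → Type _) x).apply_mk_symm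
    (FiberBundle.mem_baseSet_trivializationAt' x) f
  exact congrArg Prod.snd h

theorem mdifferentiableAt_fiberInclusion (x : M) (f : V →L[ℝ] ℝ) :
    MDifferentiableAt 𝓘(ℝ, V →L[ℝ] ℝ) (I.prod 𝓘(ℝ, V →L[ℝ] ℝ)) (fiberInclusion (I := I) x) f := by
  rw [mdifferentiableAt_totalSpace]
  refine ⟨mdifferentiableAt_const, ?_⟩
  have h : (fun g ↦ (trivializationAt (V →L[ℝ] ℝ) (CotangentSpace I : M → Type _)
      (fiberInclusion (I := I) x f).proj (fiberInclusion (I := I) x g)).2) = id := by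
    funext g
    exact trivialization_fiberInclusion x g
  rw [h]
  exact mdifferentiableAt_id

/-- The velocity of `t ↦ γ + tξ` at `t = 0` is an injective linear function of `ξ`, and is killed
by the differential of the projection. -/
theorem hasMFDerivAt_verticalCurve (γ : CotangentBundle I M) :
    ∃ L : CotangentSpace I γ.proj →ₗ[ℝ] V × (V →L[ℝ] ℝ),
      (∀ ξ, mfderiv 𝓘(ℝ, ℝ) (I.prod 𝓘(ℝ, V →L[ℝ] ℝ))
        (fun t : ℝ ↦ (TotalSpace.mk' (V →L[ℝ] ℝ) γ.proj (γ.2 + t • ξ) : CotangentBundle I M)) 0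
        (1 : ℝ) = L ξ) ∧
      Function.Injective L ∧
      ∀ ξ, mfderiv (I.prod 𝓘(ℝ, V →L[ℝ] ℝ)) I
        (TotalSpace.proj : CotangentBundle I M → M) γ (L ξ) = 0 := by
  set e := trivializationAt (V →L[ℝ] ℝ) (CotangentSpace I : M → Type _) γ.proj with he
  have hx : γ.proj ∈ e.baseSet := FiberBundle.mem_baseSet_trivializationAt' γ.proj
  obtain ⟨f₀, hf₀⟩ : ∃ f₀, f₀ = e.continuousLinearMapAt ℝ γ.proj γ.2 := ⟨_, rfl⟩
  have hinc : ∀ ξ : CotangentSpace I γ.proj, fiberInclusion γ.proj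
      (e.continuousLinearMapAt ℝ γ.proj ξ) = TotalSpace.mk' (V →L[ℝ] ℝ) γ.proj ξ := by
    intro ξ
    simp only [fiberInclusion, ← he]
    congr 1
    rw [← e.symmL_apply (R := ℝ) hx]
    exact e.symmL_continuousLinearMapAt hx _
  have hγ : fiberInclusion γ.proj f₀ = γ := by
    rw [hf₀, hinc]
  obtain ⟨A, hA⟩ : ∃ A : (V →L[ℝ] ℝ) →L[ℝ] V × (V →L[ℝ] ℝ),
      HasMFDerivAt 𝓘(ℝ, V →L[ℝ] ℝ) (I.prod 𝓘(ℝ, V →L[ℝ] ℝ)) (fiberInclusion (I := I) γ.proj) f₀ A :=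
    ⟨_, (mdifferentiableAt_fiberInclusion (I := I) γ.proj f₀).hasMFDerivAt⟩
  obtain ⟨P, hP⟩ : ∃ P : V × (V →L[ℝ] ℝ) →L[ℝ] V,
      HasMFDerivAt (I.prod 𝓘(ℝ, V →L[ℝ] ℝ)) I
        (TotalSpace.proj : CotangentBundle I M → M) γ P :=
    ⟨_, (mdifferentiableAt_proj (IB := I) (CotangentSpace I : M → Type _)).hasMFDerivAt⟩
  have hPA : P.comp A = 0 := by
    have h1 : HasMFDerivAt (I.prod 𝓘(ℝ, V →L[ℝ] ℝ)) I
        (TotalSpace.proj : CotangentBundle I M → M) (fiberInclusion γ.proj f₀) P := by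
      rw [hγ]; exact hP
    have h2 := h1.comp f₀ hA
    have h3 : HasMFDerivAt 𝓘(ℝ, V →L[ℝ] ℝ) I
      ((TotalSpace.proj : CotangentBundle I M → M) ∘ fiberInclusion (I := I) γ.proj) f₀ 0 :=
      hasMFDerivAt_const γ.proj f₀
    exact hasMFDerivAt_unique h2 h3
  have hAinj : Function.Injective A := by
    have ht : MDifferentiableAt (I.prod 𝓘(ℝ, V →L[ℝ] ℝ)) 𝓘(ℝ, V →L[ℝ] ℝ)
        (fun p : CotangentBundle I M ↦ (e p).2) γ :=
      ((mdifferentiableAt_totalSpace (IB := I)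
        (fun p : CotangentBundle I M ↦ p)).1 mdifferentiableAt_id).2
    obtain ⟨T, hT⟩ : ∃ T : V × (V →L[ℝ] ℝ) →L[ℝ] (V →L[ℝ] ℝ),
      HasMFDerivAt (I.prod 𝓘(ℝ, V →L[ℝ] ℝ)) 𝓘(ℝ, V →L[ℝ] ℝ)
        (fun p : CotangentBundle I M ↦ (e p).2) γ T := ⟨_, ht.hasMFDerivAt⟩
    have h1 : HasMFDerivAt (I.prod 𝓘(ℝ, V →L[ℝ] ℝ)) 𝓘(ℝ, V →L[ℝ] ℝ)
        (fun p : CotangentBundle I M ↦ (e p).2) (fiberInclusion γ.proj f₀) T := by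
      rw [hγ]; exact hT
    have h2 := h1.comp f₀ hA
    have h3 : HasMFDerivAt 𝓘(ℝ, V →L[ℝ] ℝ) 𝓘(ℝ, V →L[ℝ] ℝ)
      ((fun p : CotangentBundle I M ↦ (e p).2) ∘ fiberInclusion (I := I) γ.proj) f₀
        (ContinuousLinearMap.id ℝ (V →L[ℝ] ℝ)) := by
      have : ((fun p : CotangentBundle I M ↦ (e p).2) ∘ fiberInclusion (I := I) γ.proj) = id := by
        funext f
        exact trivialization_fiberInclusion γ.proj f
      rw [this]
      exact hasMFDerivAt_id f₀
    have h4 : T.comp A = ContinuousLinearMap.id ℝ (V →L[ℝ] ℝ) := hasMFDerivAt_unique h2 h3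
    intro f g hfg
    have h5 := congrArg T hfg
    have h6 := fun f ↦ DFunLike.congr_fun h4 f
    simpa using (h6 f).symm.trans (h5.trans (h6 g))
  refine ⟨(A : (V →L[ℝ] ℝ) →ₗ[ℝ] V × (V →L[ℝ] ℝ)) ∘ₗ
    (e.continuousLinearMapAt ℝ γ.proj : CotangentSpace I γ.proj →ₗ[ℝ] (V →L[ℝ] ℝ)), ?_, ?_, ?_⟩
  · intro ξ
    obtain ⟨f₁, hf₁⟩ : ∃ f₁, f₁ = e.continuousLinearMapAt ℝ γ.proj ξ := ⟨_, rfl⟩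
    have h1 : HasMFDerivAt 𝓘(ℝ, ℝ) 𝓘(ℝ, V →L[ℝ] ℝ) (fun t : ℝ ↦ f₀ + t • f₁) 0
        (ContinuousLinearMap.toSpanSingleton ℝ f₁) := by
      have := ((hasDerivAt_id (0 : ℝ)).smul_const f₁).const_add f₀
      have h2 := this.hasFDerivAt.hasMFDerivAt
      simpa using! h2
    have h2 : HasMFDerivAt 𝓘(ℝ, V →L[ℝ] ℝ) (I.prod 𝓘(ℝ, V →L[ℝ] ℝ))
        (fiberInclusion (I := I) γ.proj) (f₀ + (0 : ℝ) • f₁) A := by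
      rw [zero_smul, add_zero]; exact hA
    have h3 := h2.comp (0 : ℝ) h1
    have h4 : (fiberInclusion (I := I) γ.proj ∘ fun t : ℝ ↦ f₀ + t • f₁) =
        fun t : ℝ ↦ (TotalSpace.mk' (V →L[ℝ] ℝ) γ.proj (γ.2 + t • ξ) : CotangentBundle I M) := by
      funext t
      rw [← hinc, map_add, map_smul, ← hf₀, ← hf₁]
      rfl
    rw [h4] at h3
    have h5 := DFunLike.congr_fun h3.mfderiv (1 : ℝ)
    refine h5.trans ?_
    have h6 : ContinuousLinearMap.toSpanSingleton ℝ f₁ (1 : ℝ) = f₁ := by simp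
    change A (ContinuousLinearMap.toSpanSingleton ℝ f₁ (1 : ℝ)) =
      A (e.continuousLinearMapAt ℝ γ.proj ξ)
    rw [h6, hf₁]
  · refine hAinj.comp ?_
    intro ξ η h
    have h1 := congrArg (e.symmL ℝ γ.proj) h
    exact (e.symmL_continuousLinearMapAt hx ξ).symm.trans
      (h1.trans (e.symmL_continuousLinearMapAt hx η))
  · intro ξ
    rw [hP.mfderiv]
    exact DFunLike.congr_fun hPA (e.continuousLinearMapAt ℝ γ.proj ξ)

/-- The vertical lift of a covector `ξ` at `γ ∈ T*M`: the velocity of `t ↦ γ + tξ`. -/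
def verticalLift (γ : CotangentBundle I M) :
    CotangentSpace I γ.proj →ₗ[ℝ] TangentSpace (I.prod 𝓘(ℝ, V →L[ℝ] ℝ)) γ where
  toFun ξ := mfderiv 𝓘(ℝ, ℝ) (I.prod 𝓘(ℝ, V →L[ℝ] ℝ))
    (fun t : ℝ ↦ (TotalSpace.mk' (V →L[ℝ] ℝ) γ.proj (γ.2 + t • ξ) : CotangentBundle I M)) 0
    (1 : ℝ)
  map_add' ξ η := by
    obtain ⟨L, hL, -⟩ := hasMFDerivAt_verticalCurve γ
    have h := (hL (ξ + η)).trans (L.map_add ξ η)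
    rw [← hL ξ, ← hL η] at h
    exact h
  map_smul' c ξ := by
    obtain ⟨L, hL, -⟩ := hasMFDerivAt_verticalCurve γ
    have h := (hL (c • ξ)).trans (L.map_smul c ξ)
    rw [← hL ξ] at h
    exact h

theorem verticalLift_injective (γ : CotangentBundle I M) :
    Function.Injective (verticalLift γ) := by
  obtain ⟨L, hL, hi, -⟩ := hasMFDerivAt_verticalCurve γ
  intro ξ η h
  exact hi ((hL ξ).symm.trans (h.trans (hL η)))

theorem mfderiv_proj_verticalLift (γ : CotangentBundle I M) (ξ : CotangentSpace I γ.proj) :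
    mfderiv (I.prod 𝓘(ℝ, V →L[ℝ] ℝ)) I (TotalSpace.proj : CotangentBundle I M → M) γ
      (verticalLift γ ξ) = 0 := by
  obtain ⟨L, hL, -, hp⟩ := hasMFDerivAt_verticalCurve γ
  exact (congrArg _ (hL ξ)).trans (hp ξ)

variable [FiniteDimensional ℝ V]

/-- The differential at `x` of the one-form `s : M → T*M` with `s(x) = γ` which has constant
coefficients in the chart at `x`. -/
def extendDifferential (γ : CotangentBundle I M) :
    TangentSpace I γ.proj →ₗ[ℝ] TangentSpace (I.prod 𝓘(ℝ, V →L[ℝ] ℝ)) γ :=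
  (mfderiv I (I.prod 𝓘(ℝ, V →L[ℝ] ℝ))
    (fun y ↦ (TotalSpace.mk' (V →L[ℝ] ℝ) y (FiberBundle.extend (V →L[ℝ] ℝ) γ.2 y) :
      CotangentBundle I M)) γ.proj).toLinearMap

/-- The `D`-horizontal lift of a tangent vector `v` at `γ ∈ T*ₓM`: it is `ds(v)`, minus the vertical
lift of `D_v s`, for a one-form `s` defined near `x` with `s(x) = γ`. The result does not depend on
`s`; here `s` is the one-form with constant coefficients in the chart at `x`. -/
def horizontalLift (D : CovariantDerivative I V (TangentSpace I : M → Type _))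
    (γ : CotangentBundle I M) :
    TangentSpace I γ.proj →ₗ[ℝ] TangentSpace (I.prod 𝓘(ℝ, V →L[ℝ] ℝ)) γ :=
  extendDifferential γ
    - verticalLift γ ∘ₗ dualConnection D (fun y ↦ FiberBundle.extend (V →L[ℝ] ℝ) γ.2 y) γ.proj

theorem mfderiv_proj_horizontalLift (D : CovariantDerivative I V (TangentSpace I : M → Type _))
    (γ : CotangentBundle I M) (v : TangentSpace I γ.proj) :
    mfderiv (I.prod 𝓘(ℝ, V →L[ℝ] ℝ)) I (TotalSpace.proj : CotangentBundle I M → M) γ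
      (horizontalLift D γ v) = v := by
  obtain ⟨P, hP⟩ : ∃ P : V × (V →L[ℝ] ℝ) →L[ℝ] V,
      HasMFDerivAt (I.prod 𝓘(ℝ, V →L[ℝ] ℝ)) I
        (TotalSpace.proj : CotangentBundle I M → M) γ P :=
    ⟨_, (mdifferentiableAt_proj (CotangentSpace I : M → Type _)).hasMFDerivAt⟩
  obtain ⟨s, hs⟩ : ∃ s : M → CotangentBundle I M, s = fun y ↦
    TotalSpace.mk' (V →L[ℝ] ℝ) y (FiberBundle.extend (V →L[ℝ] ℝ) γ.2 y) := ⟨_, rfl⟩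
  have hsγ : s γ.proj = γ := by
    rw [hs]
    simp only [FiberBundle.extend_apply_self]
  obtain ⟨S, hS⟩ : ∃ S : V →L[ℝ] V × (V →L[ℝ] ℝ),
      HasMFDerivAt I (I.prod 𝓘(ℝ, V →L[ℝ] ℝ)) s γ.proj S := by
    refine ⟨_, MDifferentiableAt.hasMFDerivAt ?_⟩
    rw [hs]
    exact FiberBundle.mdifferentiableAt_extend I (V →L[ℝ] ℝ) γ.2
  have h1 : HasMFDerivAt (I.prod 𝓘(ℝ, V →L[ℝ] ℝ)) I
      (TotalSpace.proj : CotangentBundle I M → M) (s γ.proj) P := by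
    rw [hsγ]; exact hP
  have h2 := h1.comp γ.proj hS
  have h3 : ((TotalSpace.proj : CotangentBundle I M → M) ∘ s) = id := by
    rw [hs]; rfl
  rw [h3] at h2
  have h4 : P.comp S = ContinuousLinearMap.id ℝ V := hasMFDerivAt_unique h2 (hasMFDerivAt_id γ.proj)
  have h5 : ∀ w, mfderiv (I.prod 𝓘(ℝ, V →L[ℝ] ℝ)) I (TotalSpace.proj : CotangentBundle I M → M) γ
      (verticalLift γ w) = 0 := mfderiv_proj_verticalLift γ
  have h6 : extendDifferential γ v = S v := by
    have := hS.mfderiv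
    rw [hs] at this
    rw [← this]
    rfl
  rw [horizontalLift, LinearMap.sub_apply, LinearMap.comp_apply]
  refine (ContinuousLinearMap.map_sub _ _ _).trans ?_
  rw [h5, sub_zero, hP.mfderiv, h6]
  exact DFunLike.congr_fun h4 v

/-- The identification `TₓM ⊕ T*ₓM ≅ H ⊕ T^vert = T_γ(T*M)`, for `γ ∈ T*ₓM`, given by the connection
`D`: `X + ξ` corresponds to the sum of the horizontal lift of `X` and the vertical lift of `ξ`. -/
def horizontalVerticalEquiv (D : CovariantDerivative I V (TangentSpace I : M → Type _))
    (γ : CotangentBundle I M) :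
    GTangentSpace I γ.proj ≃ₗ[ℝ] TangentSpace (I.prod 𝓘(ℝ, V →L[ℝ] ℝ)) γ :=
  haveI : FiniteDimensional ℝ (GTangentSpace I γ.proj) :=
    inferInstanceAs (FiniteDimensional ℝ (V × (V →L[ℝ] ℝ)))
  haveI : FiniteDimensional ℝ (TangentSpace (I.prod 𝓘(ℝ, V →L[ℝ] ℝ)) γ) :=
    inferInstanceAs (FiniteDimensional ℝ (V × (V →L[ℝ] ℝ)))
  LinearEquiv.ofInjectiveOfFinrankEq ((horizontalLift D γ).coprod (verticalLift γ))
    (by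
      rw [← LinearMap.ker_eq_bot, LinearMap.ker_eq_bot']
      rintro ⟨v, ξ⟩ h
      rw [LinearMap.coprod_apply] at h
      have h1 := congrArg (mfderiv (I.prod 𝓘(ℝ, V →L[ℝ] ℝ)) I
        (TotalSpace.proj : CotangentBundle I M → M) γ) h
      have h2 := (ContinuousLinearMap.map_add _ _ _).symm.trans
        (h1.trans (ContinuousLinearMap.map_zero _))
      rw [mfderiv_proj_horizontalLift, mfderiv_proj_verticalLift, add_zero] at h2
      change v = 0 at h2
      subst h2
      rw [LinearMap.map_zero, zero_add] at h
      exact Prod.ext rfl (verticalLift_injective γ (h.trans (LinearMap.map_zero _).symm)))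
    rfl

/-- The almost complex structure `J^{𝒥,D}` on the cotangent manifold `T*M` defined by a generalized
complex structure `𝒥` and a linear connection `D`: it is the pull-back of `𝒥` under the
identification of `T_γ(T*M)` with `TₓM ⊕ T*ₓM` given by `D`. -/
def cotangentAlmostComplex (J : GeneralizedComplexStructure I M)
    (D : CovariantDerivative I V (TangentSpace I : M → Type _)) (γ : CotangentBundle I M) :
    TangentSpace (I.prod 𝓘(ℝ, V →L[ℝ] ℝ)) γ →ₗ[ℝ] TangentSpace (I.prod 𝓘(ℝ, V →L[ℝ] ℝ)) γ :=
  (horizontalVerticalEquiv D γ).toLinearMap ∘ₗ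
    (J.toFun γ.proj : GTangentSpace I γ.proj →ₗ[ℝ] GTangentSpace I γ.proj) ∘ₗ
    (horizontalVerticalEquiv D γ).symm.toLinearMap

/-- `J^{𝒥,D}` is indeed an almost complex structure. -/
theorem cotangentAlmostComplex_sq (J : GeneralizedComplexStructure I M)
    (D : CovariantDerivative I V (TangentSpace I : M → Type _)) (γ : CotangentBundle I M)
    (w : TangentSpace (I.prod 𝓘(ℝ, V →L[ℝ] ℝ)) γ) :
    cotangentAlmostComplex J D γ (cotangentAlmostComplex J D γ w) = -w := by
  simp only [cotangentAlmostComplex, LinearMap.comp_apply, LinearEquiv.coe_coe,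
    LinearEquiv.symm_apply_apply, ContinuousLinearMap.coe_coe]
  rw [J.sq]
  refine (LinearMap.map_neg (horizontalVerticalEquiv D γ).toLinearMap _).trans ?_
  exact congrArg Neg.neg ((horizontalVerticalEquiv D γ).apply_symm_apply w)

end CotangentBundle

/-! ### Lie groups -/

section LieGroup

variable {V : Type*} [NormedAddCommGroup V] [NormedSpace ℝ V]
  {H : Type*} [TopologicalSpace H] {I : ModelWithCorners ℝ V H}
  {G : Type*} [TopologicalSpace G] [ChartedSpace H G] [Group G]

/-- The generalized complex structure `J` on the Lie group `G` is left-invariant: it commutes with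
the maps `X + η ∘ dL_g ↦ dL_g X + η` from `T_hG ⊕ T*_hG` to `T_{gh}G ⊕ T*_{gh}G` induced by the left
translations `L_g`. -/
def GeneralizedComplexStructure.IsLeftInvariant [IsManifold I 1 G]
    (J : GeneralizedComplexStructure I G) : Prop :=
  ∀ (g h : G) (X : TangentSpace I h) (η : CotangentSpace I (g * h)),
    let A : TangentSpace I h →L[ℝ] TangentSpace I (g * h) := mfderiv I I (fun k ↦ g * k) h
    (J.toFun (g * h) (A X, η)).1 = A (J.toFun h (X, η.comp A)).1 ∧
      (J.toFun (g * h) (A X, η)).2.comp A = (J.toFun h (X, η.comp A)).2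

variable [LieGroup I ∞ G]

instance : LieGroup I (minSmoothness ℝ 3) G := by
  rw [minSmoothness_of_isRCLikeNormedField]
  infer_instance

/-- The element of the Lie algebra whose left-invariant vector field has the value `v` at `g`. -/
def leftTrivialize (g : G) : TangentSpace I g →L[ℝ] GroupLieAlgebra I G :=
  mfderiv I I (fun k ↦ g⁻¹ * k) g

theorem hasMFDerivAt_leftMul (g h : G) : ∃ A : V →L[ℝ] V,
    HasMFDerivAt I I (fun k ↦ g * k) h A :=
  ⟨_, ((contMDiff_mul_left (n := ∞)).contMDiffAt.mdifferentiableAt (by simp)).hasMFDerivAt⟩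

theorem leftTrivialize_mulInvariantVectorField (g : G) (v : GroupLieAlgebra I G) :
    leftTrivialize g (mulInvariantVectorField v g) = v := by
  obtain ⟨A, hA⟩ := hasMFDerivAt_leftMul (I := I) g 1
  obtain ⟨B, hB⟩ := hasMFDerivAt_leftMul (I := I) g⁻¹ g
  have hB' : HasMFDerivAt I I (fun k ↦ g⁻¹ * k) (g * 1) B := by rw [mul_one]; exact hB
  have h := hB'.comp 1 hA
  have hid : ((fun k ↦ g⁻¹ * k) ∘ fun k ↦ g * k) = id := by funext k; simp
  rw [hid] at h
  have h2 : B.comp A = ContinuousLinearMap.id ℝ V := hasMFDerivAt_unique h (hasMFDerivAt_id 1)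
  have h3 : mulInvariantVectorField v g = A v := by rw [← hA.mfderiv]; rfl
  have h4 : ∀ w : TangentSpace I g, leftTrivialize g w = B w := fun w ↦ by rw [← hB.mfderiv]; rfl
  exact (congrArg (leftTrivialize g) h3).trans ((h4 (A v)).trans (DFunLike.congr_fun h2 v))

theorem mulInvariantVectorField_leftTrivialize (g : G) (v : TangentSpace I g) :
    mulInvariantVectorField (leftTrivialize g v) g = v := by
  obtain ⟨A, hA⟩ := hasMFDerivAt_leftMul (I := I) g 1
  obtain ⟨B, hB⟩ := hasMFDerivAt_leftMul (I := I) g⁻¹ g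
  have hA' : HasMFDerivAt I I (fun k ↦ g * k) (g⁻¹ * g) A := by rw [inv_mul_cancel]; exact hA
  have h := hA'.comp g hB
  have hid : ((fun k ↦ g * k) ∘ fun k ↦ g⁻¹ * k) = id := by funext k; simp
  rw [hid] at h
  have h2 : A.comp B = ContinuousLinearMap.id ℝ V := hasMFDerivAt_unique h (hasMFDerivAt_id g)
  have h3 : ∀ w : GroupLieAlgebra I G, mulInvariantVectorField w g = A w := fun w ↦ by
    rw [← hA.mfderiv]; rfl
  have h4 : leftTrivialize g v = B v := by rw [← hB.mfderiv]; rfl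
  rw [h3, h4]
  exact DFunLike.congr_fun h2 v

variable [FiniteDimensional ℝ V]

/-- The connection `D^c` of a Lie group: `(D^c)_v Y = [X, Y](g)`, where `X` is the left-invariant
vector field with `X(g) = v`. In particular `(D^c)_X Y = [X, Y]` for left-invariant `X, Y`, see
`lieBracketConnection_apply`, and this property characterizes `D^c`. -/
def lieBracketConnection : CovariantDerivative I V (TangentSpace I : G → Type _) where
  toFun Y g :=
    haveI : FiniteDimensional ℝ (TangentSpace I g) := inferInstanceAs (FiniteDimensional ℝ V)
    haveI : T2Space (TangentSpace I g) := inferInstanceAs (T2Space V)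
    LinearMap.toContinuousLinearMap
      { toFun := fun v ↦ mlieBracket I (mulInvariantVectorField (leftTrivialize g v)) Y g
        map_add' := fun v w ↦ by
          rw [map_add, mulInvariantVectorField_add, mlieBracket_add_left]
          · exact mdifferentiableAt_mulInvariantVectorField _
          · exact mdifferentiableAt_mulInvariantVectorField _
        map_smul' := fun c v ↦ by
          rw [map_smul, mulInvariantVectorField_smul, mlieBracket_const_smul_left, RingHom.id_apply]
          exact mdifferentiableAt_mulInvariantVectorField _ }
  isCovariantDerivativeOnUniv :=
    { add := fun {Y Y' g} hY hY' _ ↦ by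
        ext v
        exact mlieBracket_add_right hY hY'
      leibniz := fun {Y f g} hY hf _ ↦ by
        ext v
        refine (mlieBracket_smul_right hf hY).trans ?_
        rw [mulInvariantVectorField_leftTrivialize, add_comm]
        rfl }

theorem lieBracketConnection_apply (v w : GroupLieAlgebra I G) (g : G) :
    lieBracketConnection (I := I) (G := G) (mulInvariantVectorField w) g
      (mulInvariantVectorField v g) =
      mlieBracket I (mulInvariantVectorField v) (mulInvariantVectorField w) g := by
  have h : lieBracketConnection (I := I) (G := G) (mulInvariantVectorField w) g
      (mulInvariantVectorField v g) = mlieBracket I (mulInvariantVectorField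
        (leftTrivialize g (mulInvariantVectorField v g))) (mulInvariantVectorField w) g := rfl
  rw [h, leftTrivialize_mulInvariantVectorField]

end LieGroup

end

open Complexification
open scoped Topology

noncomputable section

section

variable {V : Type*} [NormedAddCommGroup V] [NormedSpace ℝ V]
  {H : Type*} [TopologicalSpace H] {I : ModelWithCorners ℝ V H}
  {M : Type*} [TopologicalSpace M] [ChartedSpace H M] [IsManifold I ∞ M]

/-! The connection `D` turns a section `u = X + ξ` of `TM ⊕ T*M` into a vector field on `T*M`, the
sum of the horizontal lift of `X` and the vertical lift of `ξ`. As a derivation this lift maps a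
function `f` of the base to `X f`, and it maps the fibre-linear function `γ ↦ γ(Z)` of a vector
field `Z` to the fibre-linear function of `D_X Z` plus the base function `ξ(Z)`
(`mvfderiv_fiberLinear_liftField`). These functions separate tangent vectors of `T*M`, so
commutators give the bracket of the lifts of `X + ξ` and `Y + η`: at `γ` it corresponds to `[X, Y] +
D_X η - D_Y ξ - γ(R^D_{X,Y} ·)` (`liftBracket_fst`, `liftBracket_snd_apply`).

The structure `J^{𝒥,D}` maps the lift of `u` to the lift of `𝒥 u`, and its Nijenhuis tensor is
tensorial. Hence it is integrable if and only if, for every `γ`, the Nijenhuis expression of `𝒥`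
formed with the bracket of lifts at `γ` vanishes (`isIntegrableAlmostComplex_iff`). By
`nijenhuis_eq_zero_iff_cxExtendAt` this means that the bracket of any two sections of `L` lies in
`L`. Courant integrability is the same condition for the Courant bracket, so both parts amount to a
comparison of two brackets.

For the first part, let `X + ξ` and `Y + η` be sections of `L(E, α)`. The two brackets have the same
vector part `[X, Y]`, and membership in `L(E, α)` otherwise depends only on the restriction of the
form part to `E`. Skew-symmetry of `𝒥` makes `L` isotropic and `α` skew, so `½ d(ξ(Y) - η(X)) =
d(ξ(Y))`. On a section `S` of `E` the difference of the form parts is then `S(ξ(Y)) + η(D_X S - [X,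
S]) - ξ(D_Y S - [Y, S]) + γ(R^D_{X,Y} S)`. The curvature term vanishes by hypothesis and the rest is
the left side of the relation between `α` and the torsion
(`cxFormApply_courantBracket_eq_liftBracket`).

For the second part no restriction to `E` is needed. On left-invariant sections all pairings are
constant, `D^c_X` is the bracket with `X`, and the curvature of `D^c` vanishes by the Jacobi
identity, so the two brackets coincide (`courantBracket_leftInvariantSection`). Left-invariant
sections pass through every vector and are preserved by `𝒥`. It remains to know that both Nijenhuis
expressions depend only on values at a point; for the Courant bracket this uses the skew-symmetry of
`𝒥` (`tensorialAt_nijenhuis_courantBracket_right`). -/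

theorem isManifold_infty_add_one : IsManifold I (∞ + 1) M := ‹IsManifold I ∞ M›

theorem isManifold_minSmoothness_three : IsManifold I (minSmoothness ℝ 3) M := by
  rw [minSmoothness_of_isRCLikeNormedField]
  infer_instance

end

attribute [local instance] isManifold_infty_add_one isManifold_minSmoothness_three

/-! ### Vector fields as derivations of smooth functions. -/

section Derivations

variable {V : Type*} [NormedAddCommGroup V] [NormedSpace ℝ V]
  {H : Type*} [TopologicalSpace H] {I : ModelWithCorners ℝ V H}
  {M : Type*} [TopologicalSpace M] [ChartedSpace H M]

theorem Filter.EventuallyEq.mvfderiv_eq {E : Type*} [NormedAddCommGroup E] [NormedSpace ℝ E]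
    {f g : M → E} {x : M} (h : f =ᶠ[𝓝 x] g) : mvfderiv I f x = mvfderiv I g x := by
  ext v
  exact DFunLike.congr_fun (h.mfderiv_eq (I := I) (I' := 𝓘(ℝ, E))) v

/-- The derivative of a smooth function along a smooth vector field is smooth. -/
theorem contMDiffOn_mvfderiv_apply [IsManifold I ∞ M] {F : Type*} [NormedAddCommGroup F]
    [NormedSpace ℝ F] {U : Set M} (hU : IsOpen U)
    {f : M → F} {X : ∀ x : M, TangentSpace I x}
    (hf : CMDiff[U] ∞ f) (hX : CMDiff[U] ∞ (T% X)) :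
    CMDiff[U] ∞ (fun x ↦ mvfderiv I f x (X x)) := by
  -- The tangent map of `f` composed with `X` is smooth; the tangent bundle of `F` is trivial, and
  -- its fibre component is the derivative sought.
  have h1 := hf.contMDiffOn_tangentMapWithin (m := ∞) le_rfl hU.uniqueMDiffOn
  have h2 := h1.comp hX (fun x hx ↦ by simpa using hx)
  intro x hx
  have h3 := ((contMDiffWithinAt_totalSpace.1 (h2 x hx)).2)
  have h4 : ∀ y ∈ U, mvfderiv I f y (X y) = ((trivializationAt F (TangentSpace 𝓘(ℝ, F))
      (((tangentMapWithin I 𝓘(ℝ, F) f U ∘ T% X) x).proj))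
        ((tangentMapWithin I 𝓘(ℝ, F) f U ∘ T% X) y)).2 := by
    intro y hy
    simp only [tangentMapWithin, mfderivWithin_of_isOpen hU hy, mvfderiv, Function.comp_apply]
    simp
    rfl
  exact h3.congr h4 (h4 x hx)

theorem contMDiffOn_mlieBracket [IsManifold I ∞ M] [CompleteSpace V] {U : Set M} (hU : IsOpen U)
    {X Y : ∀ x : M, TangentSpace I x} (hX : CMDiff[U] ∞ (T% X)) (hY : CMDiff[U] ∞ (T% Y)) :
    CMDiff[U] ∞ (T% (mlieBracket I X Y)) := fun x hx ↦ by
  have : IsManifold I (((⊤ : ℕ∞) : ℕ∞ω) + 1) M := isManifold_infty_add_one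
  exact (ContMDiffAt.mlieBracket_vectorField (m := ⊤) (n := ⊤) (hX.contMDiffAt (hU.mem_nhds hx))
    (hY.contMDiffAt (hU.mem_nhds hx))
      (by rw [minSmoothness_of_isRCLikeNormedField]; exact le_rfl)).contMDiffWithinAt

theorem mdifferentiableAt_of_contMDiffOn {V' : Type*} [NormedAddCommGroup V'] [NormedSpace ℝ V']
    {H' : Type*} [TopologicalSpace H'] {I' : ModelWithCorners ℝ V' H'}
    {M' : Type*} [TopologicalSpace M'] [ChartedSpace H' M'] {f : M → M'} {U : Set M}
    (hU : IsOpen U) (hf : ContMDiffOn I I' ∞ f U) {x : M} (hx : x ∈ U) :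
    MDifferentiableAt I I' f x :=
  (hf.contMDiffAt (hU.mem_nhds hx)).mdifferentiableAt (by simp)

/-- Every vector of a smooth vector bundle is the value of a section which is smooth nearby. -/
theorem exists_smooth_section_through (F : Type*) [NormedAddCommGroup F] [NormedSpace ℝ F]
    {B : M → Type*} [TopologicalSpace (TotalSpace F B)]
    [∀ x, AddCommGroup (B x)] [∀ x, Module ℝ (B x)] [∀ x, TopologicalSpace (B x)]
    [FiberBundle F B] [VectorBundle ℝ F B] [ContMDiffVectorBundle ∞ F B I]
    {U : Set M} (hU : IsOpen U) {x : M} (hx : x ∈ U) (c : B x) :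
    ∃ (W : Set M) (C : ∀ y, B y), IsOpen W ∧ x ∈ W ∧ W ⊆ U ∧ CMDiff[W] ∞ (T% C) ∧ C x = c := by
  obtain ⟨s, hs, hC⟩ := FiberBundle.exists_contMDiffOn_extend (k := ∞) I F c
  obtain ⟨W, hWs, hW, hxW⟩ := mem_nhds_iff.1 (Filter.inter_mem hs (hU.mem_nhds hx))
  exact ⟨W, FiberBundle.extend F c, hW, hxW, hWs.trans Set.inter_subset_right,
    hC.mono (hWs.trans Set.inter_subset_left), by simp⟩

/-- The Lie bracket of vector fields is the commutator of the corresponding derivations. -/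
theorem mvfderiv_mlieBracket [IsManifold I ∞ M] [CompleteSpace V] {x : M}
    {X Y : ∀ x : M, TangentSpace I x} {f : M → ℝ} {U : Set M} (hU : IsOpen U) (hx : x ∈ U)
    (hX : CMDiff[U] ∞ (T% X)) (hY : CMDiff[U] ∞ (T% Y)) (hf : CMDiff[U] ∞ f) :
    mvfderiv I f x (mlieBracket I X Y x) =
      mvfderiv I (fun y ↦ mvfderiv I f y (Y y)) x (X x) -
        mvfderiv I (fun y ↦ mvfderiv I f y (X y)) x (Y x) := by
  -- The formula is read off from the Jacobi identity for `X`, `Y` and `f • C`, as the coefficient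
  -- of `C x`. This needs `C x ≠ 0`, hence the separate case of dimension zero.
  rcases subsingleton_or_nontrivial V with hV | hV
  · have h0 : ∀ v : TangentSpace I x, v = 0 := fun v ↦ Subsingleton.elim (α := V) v 0
    rw [h0 (mlieBracket I X Y x), h0 (X x), h0 (Y x)]
    simp
  obtain ⟨c, hc⟩ : ∃ c : TangentSpace I x, c ≠ 0 := exists_ne (0 : V)
  obtain ⟨W, C, hW, hxW, hWU, hC, hCx⟩ := exists_smooth_section_through (I := I) V
    (B := (TangentSpace I : M → Type _)) hU hx c
  replace hX := hX.mono hWU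
  replace hY := hY.mono hWU
  replace hf := hf.mono hWU
  have key : ∀ {A : ∀ x : M, TangentSpace I x}, CMDiff[W] ∞ (T% A) → ∀ y ∈ W,
      mlieBracket I A (f • C) y = mvfderiv I f y (A y) • C y + f y • mlieBracket I A C y := by
    intro A hA y hy
    exact mlieBracket_smul_right (mdifferentiableAt_of_contMDiffOn hW hf hy)
      (mdifferentiableAt_of_contMDiffOn hW hC hy)
  have key2 : ∀ {A B : ∀ x : M, TangentSpace I x}, CMDiff[W] ∞ (T% A) → CMDiff[W] ∞ (T% B) →
      mlieBracket I B (mlieBracket I A (f • C)) x =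
        (mvfderiv I (fun y ↦ mvfderiv I f y (A y)) x (B x) • C x
          + mvfderiv I f x (A x) • mlieBracket I B C x)
        + (mvfderiv I f x (B x) • mlieBracket I A C x
          + f x • mlieBracket I B (mlieBracket I A C) x) := by
    intro A B hA hB
    have h1 : mlieBracket I A (f • C) =ᶠ[𝓝 x]
        (fun y ↦ mvfderiv I f y (A y)) • C + f • mlieBracket I A C := by
      filter_upwards [hW.mem_nhds hxW] with y hy using key hA y hy
    have hAf := contMDiffOn_mvfderiv_apply hW hf hA
    have hAC := contMDiffOn_mlieBracket hW hA hC
    refine (Filter.EventuallyEq.mlieBracket_vectorField_eq .rfl h1).trans ?_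
    rw [mlieBracket_add_right
      (mdifferentiableAt_of_contMDiffOn hW (hAf.smul_section hC) hxW)
      (mdifferentiableAt_of_contMDiffOn hW (hf.smul_section hAC) hxW),
      mlieBracket_smul_right (mdifferentiableAt_of_contMDiffOn hW hAf hxW)
        (mdifferentiableAt_of_contMDiffOn hW hC hxW),
      mlieBracket_smul_right (mdifferentiableAt_of_contMDiffOn hW hf hxW)
        (mdifferentiableAt_of_contMDiffOn hW hAC hxW)]
  have h2 : ∀ {A : ∀ x : M, TangentSpace I x}, CMDiff[W] ∞ (T% A) →
      CMDiffAt (minSmoothness ℝ 2) (T% A) x := by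
    intro A hA
    rw [minSmoothness_of_isRCLikeNormedField]
    exact (hA.contMDiffAt (hW.mem_nhds hxW)).of_le ENat.LEInfty.out
  -- Subtracting `f x` times the identity for `C` from the identity for `f • C` leaves a multiple of
  -- `C x`; its coefficient is the defect of the claimed formula.
  have J1 := leibniz_identity_mlieBracket_apply (h2 hX) (h2 hY) (h2 (hf.smul_section hC))
  have J2 := leibniz_identity_mlieBracket_apply (h2 hX) (h2 hY) (h2 hC)
  change mlieBracket I X (mlieBracket I Y (f • C)) x = mlieBracket I (mlieBracket I X Y) (f • C) x
    + mlieBracket I Y (mlieBracket I X (f • C)) x at J1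
  rw [key2 hY hX, key2 hX hY, key (contMDiffOn_mlieBracket hW hX hY) x hxW, J2, hCx] at J1
  have h3 : (mvfderiv I f x (mlieBracket I X Y x) -
      (mvfderiv I (fun y ↦ mvfderiv I f y (Y y)) x (X x) -
        mvfderiv I (fun y ↦ mvfderiv I f y (X y)) x (Y x))) • c = 0 := by
    have := sub_eq_zero.2 J1.symm
    refine Eq.trans ?_ this
    module
  exact sub_eq_zero.1 ((smul_eq_zero.1 h3).resolve_right hc)

end Derivations

/-! ### Closedness of `i`-eigenbundles and Nijenhuis expressions. -/

section Nijenhuis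

/-- The eigenvalue equation for `a + ib` splits into `K a = -b` and `K b = a`, and the second
follows from the first because `K² = -1`. Sections of the eigenbundle are thus parametrized by their
real parts. -/
theorem Complexification.mem_iEigenspace_iff {V : Type*} [AddCommGroup V] [Module ℝ V]
    {K : V →ₗ[ℝ] V} (hK : ∀ v, K (K v) = -v) (z : Complexification V) :
    z ∈ iEigenspace K ↔ z.im = -K z.re := by
  rw [iEigenspace, Module.End.mem_eigenspace_iff, Complexification.ext_iff]
  simp only [map, LinearMap.coe_mk, AddHom.coe_mk, re_smul, im_smul, Complex.I_re, Complex.I_im,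
    zero_smul, one_smul, zero_sub, zero_add]
  constructor
  · rintro ⟨h, -⟩
    rw [h, neg_neg]
  · intro h
    rw [h, neg_neg, map_neg, hK, neg_neg]
    exact ⟨rfl, rfl⟩

variable {V : Type*} [NormedAddCommGroup V] [NormedSpace ℝ V]
  {H : Type*} [TopologicalSpace H] {I : ModelWithCorners ℝ V H}
  {M : Type*} [TopologicalSpace M] [ChartedSpace H M]
  {F : Type*} [NormedAddCommGroup F] [NormedSpace ℝ F]
  {B : M → Type*} [TopologicalSpace (TotalSpace F B)]
  [∀ x, AddCommGroup (B x)] [∀ x, Module ℝ (B x)] [∀ x, TopologicalSpace (B x)]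
  [FiberBundle F B]

/-- The Nijenhuis expression of a field `K` of endomorphisms with respect to an operation `op` on
sections. -/
def nijenhuis (K : ∀ x, B x →ₗ[ℝ] B x) {x : M} (op : (∀ x, B x) → (∀ x, B x) → B x)
    (u v : ∀ x, B x) : B x :=
  op (fun y ↦ K y (u y)) (fun y ↦ K y (v y)) - K x (op (fun y ↦ K y (u y)) v)
    - K x (op u (fun y ↦ K y (v y))) - op u v

variable (I F) in
/-- An operation on sections with values in the fibre at `x` which on smooth sections only depends
on germs at `x`, and is odd in each argument. -/
structure IsLocalOddOp {x : M} (op : (∀ x, B x) → (∀ x, B x) → B x) : Prop where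
  congr : ∀ {U : Set M} {u u' v v' : ∀ x, B x}, IsOpen U → x ∈ U →
    CMDiff[U] ∞ (T% u) → CMDiff[U] ∞ (T% v) → (∀ y ∈ U, u y = u' y) → (∀ y ∈ U, v y = v' y) →
    op u v = op u' v'
  neg_left : ∀ {U : Set M} {u v : ∀ x, B x}, IsOpen U → x ∈ U →
    CMDiff[U] ∞ (T% u) → CMDiff[U] ∞ (T% v) → op (-u) v = -op u v
  neg_right : ∀ {U : Set M} {u v : ∀ x, B x}, IsOpen U → x ∈ U →
    CMDiff[U] ∞ (T% u) → CMDiff[U] ∞ (T% v) → op u (-v) = -op u v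

/-- The complex bilinear extension of an operation with values in one fibre. -/
def cxExtendAt {x : M} (op : (∀ x, B x) → (∀ x, B x) → B x) (Z W : ∀ x, Complexification (B x)) :
    Complexification (B x) :=
  ⟨op (fun y ↦ (Z y).re) (fun y ↦ (W y).re) - op (fun y ↦ (Z y).im) (fun y ↦ (W y).im),
    op (fun y ↦ (Z y).re) (fun y ↦ (W y).im) + op (fun y ↦ (Z y).im) (fun y ↦ (W y).re)⟩

/-- Write the sections as `a - iKa` and `b - iKb`. Oddness gives the real part `op(a, b) - op(Ka,
Kb)` and the imaginary part `-op(a, Kb) - op(Ka, b)`. Applying `K` to the eigenvalue condition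
between them gives the vanishing of the Nijenhuis expression. Locality of `op` enters because the
imaginary parts have this form only on `U`; bilinearity is not needed. -/
theorem nijenhuis_eq_zero_iff_cxExtendAt [VectorBundle ℝ F B] {K : ∀ x, B x →ₗ[ℝ] B x}
    (hK : ∀ x v, K x (K x v) = -v)
    {x : M} {op : (∀ x, B x) → (∀ x, B x) → B x} (hop : IsLocalOddOp I F op)
    {U : Set M} (hU : IsOpen U) (hx : x ∈ U) {Z W : ∀ x, Complexification (B x)}
    (hZ : IsSectionOn I F (fun x ↦ iEigenspace (K x)) U Z)
    (hW : IsSectionOn I F (fun x ↦ iEigenspace (K x)) U W) :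
    cxExtendAt op Z W ∈ iEigenspace (K x) ↔
      nijenhuis K op (fun y ↦ (Z y).re) (fun y ↦ (W y).re) = 0 := by
  have hZi : ∀ y ∈ U, (Z y).im = (-fun y ↦ K y (Z y).re) y := fun y hy ↦
    (mem_iEigenspace_iff (hK y) _).1 (hZ.mem y hy)
  have hWi : ∀ y ∈ U, (W y).im = (-fun y ↦ K y (W y).re) y := fun y hy ↦
    (mem_iEigenspace_iff (hK y) _).1 (hW.mem y hy)
  have hZs : CMDiff[U] ∞ (T% (fun y ↦ K y (Z y).re)) := by
    refine (hZ.smooth_im.neg_section).congr fun y hy ↦ ?_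
    simp [hZi y hy]
  have hWs : CMDiff[U] ∞ (T% (fun y ↦ K y (W y).re)) := by
    refine (hW.smooth_im.neg_section).congr fun y hy ↦ ?_
    simp [hWi y hy]
  rw [mem_iEigenspace_iff (hK x)]
  simp only [cxExtendAt]
  rw [hop.congr hU hx hZ.smooth_im hW.smooth_im hZi hWi,
    hop.congr hU hx hZ.smooth_re hW.smooth_im (fun _ _ ↦ rfl) hWi,
    hop.congr hU hx hZ.smooth_im hW.smooth_re hZi (fun _ _ ↦ rfl),
    hop.neg_left hU hx hZs hWs.neg_section, hop.neg_right hU hx hZs hWs,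
    hop.neg_right hU hx hZ.smooth_re hWs, hop.neg_left hU hx hZs hW.smooth_re, nijenhuis]
  set a := op (fun y ↦ (Z y).re) (fun y ↦ (W y).re)
  set b := op (fun y ↦ K y (Z y).re) (fun y ↦ K y (W y).re)
  set c := op (fun y ↦ (Z y).re) (fun y ↦ K y (W y).re)
  set d := op (fun y ↦ K y (Z y).re) (fun y ↦ (W y).re)
  rw [neg_neg, map_sub]
  constructor
  · intro h
    have h1 := congrArg (K x) h
    simp only [map_add, map_neg, map_sub, hK] at h1
    have h2 : b - K x d - K x c - a = (-K x c + -K x d) - -(-a - -b) := by abel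
    rw [h2, h1, sub_self]
  · intro h
    have h1 := congrArg (K x) h
    simp only [map_sub, hK, map_zero] at h1
    have h2 : -c + -d - -(K x a - K x b) = -(K x b - -d - -c - K x a) := by abel
    rw [← sub_eq_zero, h2, h1, neg_zero]

theorem isSectionOn_iEigenspace_of_smooth [VectorBundle ℝ F B] {K : ∀ x, B x →ₗ[ℝ] B x}
    (hK : ∀ x v, K x (K x v) = -v) {U : Set M} {u : ∀ x, B x} (hu : CMDiff[U] ∞ (T% u))
    (hKu : CMDiff[U] ∞ (T% (fun y ↦ K y (u y)))) :
    IsSectionOn I F (fun x ↦ iEigenspace (K x)) U (fun y ↦ ⟨u y, -K y (u y)⟩) where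
  smooth_re := hu
  smooth_im := hKu.neg_section
  mem y _ := (mem_iEigenspace_iff (hK y) _).2 rfl

/-- Closedness of the sections of the `i`-eigenbundle of `K` under an operation, in terms of the
Nijenhuis expression. -/
theorem sectionsClosedUnder_iff_nijenhuis [VectorBundle ℝ F B] {K : ∀ x, B x →ₗ[ℝ] B x}
    (hK : ∀ x v, K x (K x v) = -v) {op : (∀ x, B x) → (∀ x, B x) → ∀ x, B x}
    (hop : ∀ x, IsLocalOddOp I F (fun u v ↦ op u v x))  :
    SectionsClosedUnder I F (fun x ↦ iEigenspace (K x)) op ↔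
      ∀ (U : Set M) (u v : ∀ x, B x), IsOpen U → CMDiff[U] ∞ (T% u) → CMDiff[U] ∞ (T% v) →
        CMDiff[U] ∞ (T% (fun y ↦ K y (u y))) → CMDiff[U] ∞ (T% (fun y ↦ K y (v y))) →
        ∀ x ∈ U, nijenhuis K (fun u v ↦ op u v x) u v = 0 := by
  constructor
  · intro h U u v hU hu hv hKu hKv x hx
    have hZ := isSectionOn_iEigenspace_of_smooth hK hu hKu
    have hW := isSectionOn_iEigenspace_of_smooth hK hv hKv
    exact (nijenhuis_eq_zero_iff_cxExtendAt hK (hop x) hU hx hZ hW).1 (h U hU _ _ hZ hW x hx)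
  · intro h U hU Z W hZ hW x hx
    refine (nijenhuis_eq_zero_iff_cxExtendAt hK (hop x) hU hx hZ hW).2
      (h U _ _ hU hZ.smooth_re hW.smooth_re ?_ ?_ x hx)
    · refine (hZ.smooth_im.neg_section).congr fun y hy ↦ ?_
      simp [(mem_iEigenspace_iff (hK y) _).1 (hZ.mem y hy)]
    · refine (hW.smooth_im.neg_section).congr fun y hy ↦ ?_
      simp [(mem_iEigenspace_iff (hK y) _).1 (hW.mem y hy)]

end Nijenhuis

/-! ### One-forms and sections of the generalized tangent bundle. -/

section OneForms

variable {V : Type*} [NormedAddCommGroup V] [NormedSpace ℝ V]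
  {H : Type*} [TopologicalSpace H] {I : ModelWithCorners ℝ V H}
  {M : Type*} [TopologicalSpace M] [ChartedSpace H M] [IsManifold I ∞ M]

/-- The pairing of a smooth one-form and a smooth vector field is smooth. -/
theorem contMDiffOn_pairing {U : Set M} {η : ∀ x : M, CotangentSpace I x}
    {Z : ∀ x : M, TangentSpace I x}
    (hη : CMDiff[U] ∞ (fun y ↦ TotalSpace.mk' (V →L[ℝ] ℝ) (E := CotangentSpace I) y (η y)))
    (hZ : CMDiff[U] ∞ (T% Z)) : CMDiff[U] ∞ (fun y ↦ η y (Z y)) := by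
  have h := ContMDiffOn.clm_bundle_apply (F₁ := V) (F₂ := ℝ)
    (E₁ := (TangentSpace I : M → Type _)) (E₂ := fun _ : M ↦ ℝ) hη hZ
  exact fun x hx ↦ (contMDiffWithinAt_totalSpace.1 (h x hx)).2

/-- A section of `TM ⊕ T*M` is smooth iff its two components are. -/
theorem contMDiffOn_generalized_iff {U : Set M} {u : ∀ x : M, GTangentSpace I x} :
    ContMDiffOn I (I.prod 𝓘(ℝ, V × (V →L[ℝ] ℝ))) ∞
      (fun y ↦ TotalSpace.mk' (V × (V →L[ℝ] ℝ)) (E := fun y ↦ GTangentSpace I y) y (u y)) U ↔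
    CMDiff[U] ∞ (T% (fun y ↦ (u y).1)) ∧
    CMDiff[U] ∞ (fun y ↦ TotalSpace.mk' (V →L[ℝ] ℝ) (E := CotangentSpace I) y (u y).2) := by
  constructor
  · intro h
    refine ⟨fun x hx ↦ contMDiffWithinAt_section.2 ?_, fun x hx ↦ contMDiffWithinAt_section.2 ?_⟩
    · exact (ContinuousLinearMap.fst ℝ V (V →L[ℝ] ℝ)).contMDiff.contMDiffAt.comp_contMDiffWithinAt x
        (contMDiffWithinAt_section.1 (h x hx))
    · exact (ContinuousLinearMap.snd ℝ V (V →L[ℝ] ℝ)).contMDiff.contMDiffAt.comp_contMDiffWithinAt x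
        (contMDiffWithinAt_section.1 (h x hx))
  · rintro ⟨h1, h2⟩ x hx
    refine contMDiffWithinAt_section.2 ?_
    exact (contMDiffWithinAt_section.1 (h1 x hx)).prodMk_space (contMDiffWithinAt_section.1 (h2 x hx))

theorem mdifferentiableAt_generalized_iff {x : M} {u : ∀ x : M, GTangentSpace I x} :
    MDifferentiableAt I (I.prod 𝓘(ℝ, V × (V →L[ℝ] ℝ)))
      (fun y ↦ TotalSpace.mk' (V × (V →L[ℝ] ℝ)) (E := fun y ↦ GTangentSpace I y) y (u y)) x ↔
    MDiffAt (T% (fun y ↦ (u y).1)) x ∧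
    MDiffAt (fun y ↦ TotalSpace.mk' (V →L[ℝ] ℝ) (E := CotangentSpace I) y (u y).2) x := by
  constructor
  · intro h
    refine ⟨(mdifferentiableAt_section _ _).2 ?_, (mdifferentiableAt_section _ _).2 ?_⟩
    · exact (ContinuousLinearMap.fst ℝ V (V →L[ℝ] ℝ)).mdifferentiableAt.comp x
        ((mdifferentiableAt_section _ _).1 h)
    · exact (ContinuousLinearMap.snd ℝ V (V →L[ℝ] ℝ)).mdifferentiableAt.comp x
        ((mdifferentiableAt_section _ _).1 h)
  · rintro ⟨h1, h2⟩
    refine (mdifferentiableAt_section _ _).2 ?_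
    exact ((mdifferentiableAt_section _ _).1 h1).prodMk_space ((mdifferentiableAt_section _ _).1 h2)

variable [FiniteDimensional ℝ V]

/-- By tensoriality, the definition through one chosen extension of a vector gives the usual formula
for every differentiable `Z`. -/
theorem lieDerivOneForm_apply {X Z : ∀ x : M, TangentSpace I x} {η : ∀ x : M, CotangentSpace I x}
    {x : M} (hη : MDiffAt (fun y ↦ TotalSpace.mk' (V →L[ℝ] ℝ) (E := CotangentSpace I) y (η y)) x)
    (hZ : MDiffAt (T% Z) x) :
    lieDerivOneForm X η x (Z x) =
      mvfderiv I (fun y ↦ η y (Z y)) x (X x) - η x (mlieBracket I X Z x) := by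
  rw [lieDerivOneForm, dif_pos hη, TensorialAt.mkHom_apply _ hZ]

theorem dualConnection_apply (D : CovariantDerivative I V (TangentSpace I : M → Type _))
    {Z : ∀ x : M, TangentSpace I x} {ξ : ∀ x : M, CotangentSpace I x}
    {x : M} (hξ : MDiffAt (fun y ↦ TotalSpace.mk' (V →L[ℝ] ℝ) (E := CotangentSpace I) y (ξ y)) x)
    (hZ : MDiffAt (T% Z) x) (v : TangentSpace I x) :
    dualConnection D ξ x v (Z x) =
      mvfderiv I (fun y ↦ ξ y (Z y)) x v - ξ x (D Z x v) := by
  rw [dualConnection, dif_pos hξ, LinearMap.coe_mk, AddHom.coe_mk]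
  exact TensorialAt.mkHom_apply (tensorialAt_dualConnection D hξ v) hZ

end OneForms

/-! ### Separation of tangent vectors; smoothness of covariant derivatives. -/

section

variable {V : Type*} [NormedAddCommGroup V] [NormedSpace ℝ V]
  {H : Type*} [TopologicalSpace H] {I : ModelWithCorners ℝ V H}
  {M : Type*} [TopologicalSpace M] [ChartedSpace H M] [IsManifold I ∞ M]

/-- Tangent vectors are separated by the differentials of the smooth functions. -/
theorem tangentVector_eq_zero {x : M} {v : TangentSpace I x}
    (h : ∀ (U : Set M) (f : M → ℝ), IsOpen U → x ∈ U → CMDiff[U] ∞ f → mvfderiv I f x v = 0) :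
    v = 0 := by
  have hinj : Function.Injective (mfderiv I 𝓘(ℝ, V) (extChartAt I x) x) :=
    (isInvertible_mfderiv_extChartAt (mem_extChartAt_source x)).injective
  apply hinj
  rw [map_zero]
  by_contra hne
  obtain ⟨φ, hφ⟩ : ∃ φ : V →L[ℝ] ℝ, φ (mfderiv I 𝓘(ℝ, V) (extChartAt I x) x v) ≠ 0 := by
    by_contra! hcon
    exact hne (SeparatingDual.eq_zero_of_forall_dual_eq_zero (V := V) (R := ℝ) hcon)
  refine hφ ?_
  -- The test function is a linear functional of the chart which does not vanish on the image of
  -- `v`; it is only used on the chart domain.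
  have h1 := h (chartAt H x).source (φ ∘ extChartAt I x) (chartAt H x).open_source
    (mem_chart_source H x) (φ.contMDiff.comp_contMDiffOn (contMDiffOn_extChartAt))
  rw [mvfderiv, mfderiv_comp x φ.mdifferentiableAt
    (mdifferentiableAt_extChartAt (mem_chart_source H x))] at h1
  simpa using! h1

theorem CovariantDerivative.congr_of_smooth
    (D : CovariantDerivative I V (TangentSpace I : M → Type _)) {U : Set M} (hU : IsOpen U)
    {Y Y' : ∀ x : M, TangentSpace I x} (hY : CMDiff[U] ∞ (T% Y)) (h : ∀ y ∈ U, Y y = Y' y)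
    {x : M} (hx : x ∈ U) : D Y x = D Y' x := by
  have hY' : CMDiff[U] ∞ (T% Y') := hY.congr fun y hy ↦ by simp [h y hy]
  exact D.isCovariantDerivativeOnUniv.congr_of_eventuallyEq (mdifferentiableAt_of_contMDiffOn hU hY hx)
    (mdifferentiableAt_of_contMDiffOn hU hY' hx) Filter.univ_mem
    (Filter.eventually_of_mem (hU.mem_nhds hx) h)

/-- The connection `D` maps smooth vector fields to smooth vector fields. -/
def CovariantDerivative.PreservesSmooth
    (D : CovariantDerivative I V (TangentSpace I : M → Type _)) : Prop :=
  ∀ (U : Set M) (X Y : ∀ x : M, TangentSpace I x), IsOpen U → CMDiff[U] ∞ (T% X) →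
    CMDiff[U] ∞ (T% Y) → CMDiff[U] ∞ (T% (fun x ↦ D Y x (X x)))

/-- Smoothness of `D` concerns vector fields that are smooth on all of `M`. A bump function extends
a local field to such a field without changing it near the point; the Hausdorff property makes the
extension smooth. -/
theorem CovariantDerivative.ContMDiffCovariantDerivative.preservesSmooth
    [FiniteDimensional ℝ V] [T2Space M]
    {D : CovariantDerivative I V (TangentSpace I : M → Type _)}
    (hD : D.ContMDiffCovariantDerivative ∞) : D.PreservesSmooth := by
  intro U X Y hU hX hY x hx
  obtain ⟨ψ, -, hψ⟩ := (SmoothBumpFunction.nhds_basis_tsupport (I := I) x).mem_iff.1 (hU.mem_nhds hx)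
  have h1 : CMDiff ∞ (T% ((ψ : M → ℝ) • Y)) := by
    exact (ψ.contMDiff.contMDiffOn (s := U)).smul_section_of_tsupport hU hψ hY
  have h2 := (hD.contMDiff.contMDiff h1.contMDiffOn)
  obtain ⟨W, hWs, hW, hxW⟩ := mem_nhds_iff.1 (Filter.inter_mem ψ.eventuallyEq_one (hU.mem_nhds hx))
  have h3 := ContMDiffOn.clm_bundle_apply (F₁ := V) (F₂ := V)
    (E₁ := (TangentSpace I : M → Type _)) (E₂ := (TangentSpace I : M → Type _))
    (h2.mono (Set.subset_univ W)) (hX.mono (hWs.trans Set.inter_subset_right))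
  refine ((h3.congr fun y hy ↦ ?_).contMDiffAt (hW.mem_nhds hxW)).contMDiffWithinAt
  rw [D.congr_of_smooth hW (hY.mono (hWs.trans Set.inter_subset_right)) (Y' := (ψ : M → ℝ) • Y) _ hy]
  intro z hz
  have : ψ z = 1 := (hWs hz).1
  simp [this]

end

/-! ### Horizontal and vertical vectors as derivations of fibre-linear functions. -/

section

variable {V : Type*} [NormedAddCommGroup V] [NormedSpace ℝ V]
  {H : Type*} [TopologicalSpace H] {I : ModelWithCorners ℝ V H}
  {M : Type*} [TopologicalSpace M] [ChartedSpace H M] [IsManifold I ∞ M]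

/-- The function on `T*M` defined by a vector field on `M`, linear on the fibres. -/
def fiberLinear (Z : ∀ x : M, TangentSpace I x) (γ : CotangentBundle I M) : ℝ := γ.2 (Z γ.proj)

theorem contMDiffOn_fiberLinear {U : Set M} {Z : ∀ x : M, TangentSpace I x}
    (hZ : CMDiff[U] ∞ (T% Z)) :
    ContMDiffOn (I.prod 𝓘(ℝ, V →L[ℝ] ℝ)) 𝓘(ℝ, ℝ) ∞ (fiberLinear Z)
      ((TotalSpace.proj : CotangentBundle I M → M) ⁻¹' U) := by
  have h := ContMDiffOn.clm_bundle_apply (IM := I.prod 𝓘(ℝ, V →L[ℝ] ℝ)) (IB := I)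
    (F₁ := V) (F₂ := ℝ) (n := ∞) (M := CotangentBundle I M)
    (E₁ := (TangentSpace I : M → Type _)) (E₂ := fun _ : M ↦ ℝ)
    (s := (TotalSpace.proj : CotangentBundle I M → M) ⁻¹' U)
    (b := TotalSpace.proj) (ϕ := fun γ ↦ γ.2) (v := fun γ ↦ Z γ.proj)
    contMDiffOn_id (hZ.comp (contMDiffOn_proj _) (fun _ h ↦ h))
  exact fun x hx ↦ (contMDiffWithinAt_totalSpace.1 (h x hx)).2

theorem mdifferentiableAt_fiberLinear {γ : CotangentBundle I M} {Z : ∀ x : M, TangentSpace I x}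
    (hZ : MDiffAt (T% Z) γ.proj) :
    MDifferentiableAt (I.prod 𝓘(ℝ, V →L[ℝ] ℝ)) 𝓘(ℝ, ℝ) (fiberLinear Z) γ := by
  have h := MDifferentiableAt.clm_bundle_apply (IM := I.prod 𝓘(ℝ, V →L[ℝ] ℝ)) (IB := I)
    (F₁ := V) (F₂ := ℝ) (M := CotangentBundle I M)
    (E₁ := (TangentSpace I : M → Type _)) (E₂ := fun _ : M ↦ ℝ) (x := γ)
    (b := TotalSpace.proj) (ϕ := fun γ ↦ γ.2) (v := fun γ ↦ Z γ.proj)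
    mdifferentiableAt_id (hZ.comp γ (mdifferentiableAt_proj _))
  exact ((mdifferentiableAt_totalSpace _ _).1 h).2

theorem mdifferentiableAt_verticalCurve (γ : CotangentBundle I M) (ξ : CotangentSpace I γ.proj) :
    MDifferentiableAt 𝓘(ℝ, ℝ) (I.prod 𝓘(ℝ, V →L[ℝ] ℝ))
      (fun t : ℝ ↦ (TotalSpace.mk' (V →L[ℝ] ℝ) γ.proj (γ.2 + t • ξ) : CotangentBundle I M)) 0 := by
  rw [mdifferentiableAt_totalSpace]
  refine ⟨mdifferentiableAt_const, ?_⟩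
  have hx : γ.proj ∈ (trivializationAt (V →L[ℝ] ℝ) (CotangentSpace I : M → Type _) γ.proj).baseSet :=
    FiberBundle.mem_baseSet_trivializationAt' γ.proj
  set L := (trivializationAt (V →L[ℝ] ℝ) (CotangentSpace I : M → Type _)
    γ.proj).continuousLinearMapAt ℝ γ.proj with hL
  have h : (fun t : ℝ ↦ L γ.2 + t • L ξ) = fun t : ℝ ↦ (trivializationAt (V →L[ℝ] ℝ)
      (CotangentSpace I : M → Type _) γ.proj
      (TotalSpace.mk' (V →L[ℝ] ℝ) γ.proj (γ.2 + t • ξ) : CotangentBundle I M)).2 := by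
    funext t
    rw [← map_smul, ← map_add, hL, Trivialization.continuousLinearMapAt_apply,
      Trivialization.linearMapAt_apply, if_pos hx]
  change MDifferentiableAt 𝓘(ℝ, ℝ) 𝓘(ℝ, V →L[ℝ] ℝ) (fun t : ℝ ↦ (trivializationAt (V →L[ℝ] ℝ)
      (CotangentSpace I : M → Type _) _
      (TotalSpace.mk' (V →L[ℝ] ℝ) γ.proj (γ.2 + t • ξ) : CotangentBundle I M)).2) 0
  rw [← h]
  exact (by fun_prop : DifferentiableAt ℝ (fun t : ℝ ↦ L γ.2 + t • L ξ) 0).mdifferentiableAt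

/-- Along the curve `γ + tξ` the function is affine in `t` with slope `ξ(Z)`. -/
theorem mvfderiv_fiberLinear_verticalLift {γ : CotangentBundle I M}
    {Z : ∀ x : M, TangentSpace I x} (hZ : MDiffAt (T% Z) γ.proj) (ξ : CotangentSpace I γ.proj) :
    mvfderiv (I.prod 𝓘(ℝ, V →L[ℝ] ℝ)) (fiberLinear Z) γ (verticalLift γ ξ) = ξ (Z γ.proj) := by
  obtain ⟨P, hP⟩ : ∃ P : V × (V →L[ℝ] ℝ) →L[ℝ] ℝ,
      HasMFDerivAt (I.prod 𝓘(ℝ, V →L[ℝ] ℝ)) 𝓘(ℝ, ℝ) (fiberLinear Z) γ P :=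
    ⟨_, (mdifferentiableAt_fiberLinear hZ).hasMFDerivAt⟩
  obtain ⟨A, hA⟩ : ∃ A : ℝ →L[ℝ] V × (V →L[ℝ] ℝ),
      HasMFDerivAt 𝓘(ℝ, ℝ) (I.prod 𝓘(ℝ, V →L[ℝ] ℝ))
        (fun t : ℝ ↦ (TotalSpace.mk' (V →L[ℝ] ℝ) γ.proj (γ.2 + t • ξ) : CotangentBundle I M)) 0 A :=
    ⟨_, (mdifferentiableAt_verticalCurve γ ξ).hasMFDerivAt⟩
  have hP' : HasMFDerivAt (I.prod 𝓘(ℝ, V →L[ℝ] ℝ)) 𝓘(ℝ, ℝ) (fiberLinear Z)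
      (TotalSpace.mk' (V →L[ℝ] ℝ) γ.proj (γ.2 + (0 : ℝ) • ξ) : CotangentBundle I M) P := by
    rw [zero_smul, add_zero]; exact hP
  have h1 := hP'.comp (0 : ℝ) hA
  have h3 : (fiberLinear Z ∘ fun t : ℝ ↦
      (TotalSpace.mk' (V →L[ℝ] ℝ) γ.proj (γ.2 + t • ξ) : CotangentBundle I M)) =
      fun t : ℝ ↦ γ.2 (Z γ.proj) + t * ξ (Z γ.proj) := by
    funext t
    simp [fiberLinear]
  rw [h3] at h1
  have h4 : HasDerivAt (fun t : ℝ ↦ γ.2 (Z γ.proj) + t * ξ (Z γ.proj)) (ξ (Z γ.proj)) 0 := by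
    simpa using ((hasDerivAt_id (0 : ℝ)).mul_const (ξ (Z γ.proj))).const_add (γ.2 (Z γ.proj))
  have h5 : P.comp A = ContinuousLinearMap.toSpanSingleton ℝ (ξ (Z γ.proj)) :=
    hasMFDerivAt_unique h1 h4.hasFDerivAt.hasMFDerivAt
  have h6 : verticalLift γ ξ = A 1 := DFunLike.congr_fun hA.mfderiv (1 : ℝ)
  have h7 : mvfderiv (I.prod 𝓘(ℝ, V →L[ℝ] ℝ)) (fiberLinear Z) γ (A 1) = P (A 1) :=
    DFunLike.congr_fun hP.mfderiv (A 1)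
  rw [h6, h7]
  exact (DFunLike.congr_fun h5 (1 : ℝ)).trans (by simp)

theorem mvfderiv_comp_proj {γ : CotangentBundle I M} {f : M → ℝ}
    (hf : MDifferentiableAt I 𝓘(ℝ, ℝ) f γ.proj)
    (w : TangentSpace (I.prod 𝓘(ℝ, V →L[ℝ] ℝ)) γ) :
    mvfderiv (I.prod 𝓘(ℝ, V →L[ℝ] ℝ)) (fun γ : CotangentBundle I M ↦ f γ.proj) γ w =
      mvfderiv I f γ.proj (mfderiv (I.prod 𝓘(ℝ, V →L[ℝ] ℝ)) I
        (TotalSpace.proj : CotangentBundle I M → M) γ w) := by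
  have h1 := mfderiv_comp γ hf (mdifferentiableAt_proj (IB := I) (CotangentSpace I : M → Type _))
  exact DFunLike.congr_fun h1 w

theorem isOpen_preimage_proj {U : Set M} (hU : IsOpen U) :
    IsOpen ((TotalSpace.proj : CotangentBundle I M → M) ⁻¹' U) :=
  hU.preimage (FiberBundle.continuous_proj (V →L[ℝ] ℝ) (CotangentSpace I : M → Type _))

theorem contMDiffOn_comp_proj {f : M → ℝ} {U : Set M} (hf : CMDiff[U] ∞ f) :
    ContMDiffOn (I.prod 𝓘(ℝ, V →L[ℝ] ℝ)) 𝓘(ℝ, ℝ) ∞ (fun γ : CotangentBundle I M ↦ f γ.proj)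
      ((TotalSpace.proj : CotangentBundle I M → M) ⁻¹' U) :=
  hf.comp (contMDiffOn_proj _) (fun _ h ↦ h)

variable [FiniteDimensional ℝ V]

/-- For the one-form `s` that defines the lift, `ds(v)` differentiates the function to `v(s(Z))`.
The vertical correction subtracts `(D_v s)(Z) = v(s(Z)) - s(D_v Z)`, so only the value of `s` at the
point survives. -/
theorem mvfderiv_fiberLinear_horizontalLift
    (D : CovariantDerivative I V (TangentSpace I : M → Type _)) {γ : CotangentBundle I M}
    {Z : ∀ x : M, TangentSpace I x} (hZ : MDiffAt (T% Z) γ.proj) (v : TangentSpace I γ.proj) :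
    mvfderiv (I.prod 𝓘(ℝ, V →L[ℝ] ℝ)) (fiberLinear Z) γ (horizontalLift D γ v) =
      γ.2 (D Z γ.proj v) := by
  set s : ∀ y : M, CotangentSpace I y := fun y ↦ FiberBundle.extend (V →L[ℝ] ℝ) γ.2 y with hs
  have hsd : MDiffAt (fun y ↦ TotalSpace.mk' (V →L[ℝ] ℝ) (E := CotangentSpace I) y (s y)) γ.proj :=
    FiberBundle.mdifferentiableAt_extend I (V →L[ℝ] ℝ) γ.2
  have hsx : s γ.proj = γ.2 := FiberBundle.extend_apply_self _ _
  obtain ⟨P, hP⟩ : ∃ P : V × (V →L[ℝ] ℝ) →L[ℝ] ℝ,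
      HasMFDerivAt (I.prod 𝓘(ℝ, V →L[ℝ] ℝ)) 𝓘(ℝ, ℝ) (fiberLinear Z) γ P :=
    ⟨_, (mdifferentiableAt_fiberLinear hZ).hasMFDerivAt⟩
  obtain ⟨A, hA⟩ : ∃ A : V →L[ℝ] V × (V →L[ℝ] ℝ), HasMFDerivAt I (I.prod 𝓘(ℝ, V →L[ℝ] ℝ))
      (fun y ↦ TotalSpace.mk' (V →L[ℝ] ℝ) (E := CotangentSpace I) y (s y)) γ.proj A :=
    ⟨_, hsd.hasMFDerivAt⟩
  have hP' : HasMFDerivAt (I.prod 𝓘(ℝ, V →L[ℝ] ℝ)) 𝓘(ℝ, ℝ) (fiberLinear Z)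
      (TotalSpace.mk' (V →L[ℝ] ℝ) (E := CotangentSpace I) γ.proj (s γ.proj)) P := by
    rw [hsx]; exact hP
  have h1 := hP'.comp γ.proj hA
  have h2 : mvfderiv I (fun y ↦ s y (Z y)) γ.proj v = P (A v) := DFunLike.congr_fun h1.mfderiv v
  have h3 : extendDifferential γ v = A v := DFunLike.congr_fun hA.mfderiv v
  have h4 : mvfderiv (I.prod 𝓘(ℝ, V →L[ℝ] ℝ)) (fiberLinear Z) γ (A v) = P (A v) :=
    DFunLike.congr_fun hP.mfderiv (A v)
  rw [horizontalLift, LinearMap.sub_apply]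
  refine (ContinuousLinearMap.map_sub _ _ _).trans ?_
  rw [h3, h4, ← h2, LinearMap.comp_apply, mvfderiv_fiberLinear_verticalLift hZ,
    dualConnection_apply D hsd hZ, hsx]
  ring

theorem horizontalVerticalEquiv_apply
    (D : CovariantDerivative I V (TangentSpace I : M → Type _)) (γ : CotangentBundle I M)
    (u : GTangentSpace I γ.proj) :
    horizontalVerticalEquiv D γ u = horizontalLift D γ u.1 + verticalLift γ u.2 := rfl

theorem mfderiv_proj_horizontalVerticalEquiv
    (D : CovariantDerivative I V (TangentSpace I : M → Type _)) (γ : CotangentBundle I M)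
    (u : GTangentSpace I γ.proj) :
    mfderiv (I.prod 𝓘(ℝ, V →L[ℝ] ℝ)) I (TotalSpace.proj : CotangentBundle I M → M) γ
      (horizontalVerticalEquiv D γ u) = u.1 := by
  rw [horizontalVerticalEquiv_apply]
  refine (ContinuousLinearMap.map_add _ _ _).trans ?_
  rw [mfderiv_proj_horizontalLift, mfderiv_proj_verticalLift, add_zero]

theorem mvfderiv_fiberLinear_horizontalVerticalEquiv
    (D : CovariantDerivative I V (TangentSpace I : M → Type _)) {γ : CotangentBundle I M}
    {Z : ∀ x : M, TangentSpace I x} (hZ : MDiffAt (T% Z) γ.proj) (u : GTangentSpace I γ.proj) :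
    mvfderiv (I.prod 𝓘(ℝ, V →L[ℝ] ℝ)) (fiberLinear Z) γ (horizontalVerticalEquiv D γ u) =
      γ.2 (D Z γ.proj u.1) + u.2 (Z γ.proj) := by
  rw [horizontalVerticalEquiv_apply]
  refine (ContinuousLinearMap.map_add _ _ _).trans ?_
  rw [mvfderiv_fiberLinear_horizontalLift D hZ, mvfderiv_fiberLinear_verticalLift hZ]

end

/-! ### Smooth dependence of coefficients in local frames. -/

section Frames

variable {V : Type*} [NormedAddCommGroup V] [NormedSpace ℝ V]
  {H : Type*} [TopologicalSpace H] {I : ModelWithCorners ℝ V H}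
  {M : Type*} [TopologicalSpace M] [ChartedSpace H M]

/-- A smooth family of linear maps which is injective at a point has a smooth family of left
inverses near this point. -/
theorem exists_smooth_leftInverse {E₁ E₂ : Type*} [NormedAddCommGroup E₁] [NormedSpace ℝ E₁]
    [FiniteDimensional ℝ E₁] [NormedAddCommGroup E₂] [NormedSpace ℝ E₂] [FiniteDimensional ℝ E₂]
    {L : M → E₁ →L[ℝ] E₂} {p : M} (hL : ContMDiffAt I 𝓘(ℝ, E₁ →L[ℝ] E₂) ∞ L p)
    (hinj : Function.Injective (L p)) :
    ∃ T : M → E₂ →L[ℝ] E₁, ContMDiffAt I 𝓘(ℝ, E₂ →L[ℝ] E₁) ∞ T p ∧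
      ∀ᶠ q in 𝓝 p, ∀ c, T q (L q c) = c := by
  have : CompleteSpace E₁ := FiniteDimensional.complete ℝ E₁
  -- For a fixed left inverse `R` of `L p`, the endomorphism `R ∘ L q` is the identity at `q = p`,
  -- hence invertible nearby, and `(R ∘ L q)⁻¹ ∘ R` is a left inverse of `L q`.
  obtain ⟨R', hR'⟩ := (L p : E₁ →ₗ[ℝ] E₂).exists_leftInverse_of_injective
    (LinearMap.ker_eq_bot.2 hinj)
  set R : E₂ →L[ℝ] E₁ := LinearMap.toContinuousLinearMap R' with hR
  have hRL : R.comp (L p) = 1 := by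
    ext c
    exact DFunLike.congr_fun hR' c
  set S : M → E₁ →L[ℝ] E₁ := fun q ↦ R.comp (L q) with hS
  have hSs : ContMDiffAt I 𝓘(ℝ, E₁ →L[ℝ] E₁) ∞ S p := contMDiffAt_const.clm_comp hL
  have hSp : S p = ((1 : (E₁ →L[ℝ] E₁)ˣ) : E₁ →L[ℝ] E₁) := by rw [hS]; exact hRL
  refine ⟨fun q ↦ (Ring.inverse (S q)).comp R, ?_, ?_⟩
  · refine ContMDiffAt.clm_comp ?_ contMDiffAt_const
    have h1 : ContDiffAt ℝ ∞ Ring.inverse (S p) := by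
      rw [hSp]; exact contDiffAt_ringInverse ℝ _
    exact h1.contMDiffAt.comp p hSs
  · have h2 : ∀ᶠ q in 𝓝 p, IsUnit (S q) :=
      hSs.continuousAt.eventually (by rw [hSp]; exact Units.nhds _)
    filter_upwards [h2] with q hq c
    exact DFunLike.congr_fun (Ring.inverse_mul_cancel _ hq) c

section

variable {F : Type*} [NormedAddCommGroup F] [NormedSpace ℝ F] [FiniteDimensional ℝ F]
  {B : M → Type*} [TopologicalSpace (TotalSpace F B)]
  [∀ x, AddCommGroup (B x)] [∀ x, Module ℝ (B x)] [∀ x, TopologicalSpace (B x)]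
  [FiberBundle F B] [VectorBundle ℝ F B] {ι : Type*} [Fintype ι]

/-- The coefficients with respect to a smooth local frame of a section are obtained from its local
representation by a smooth family of linear maps. -/
theorem IsLocalFrameOn.exists_coeff_eq {s : ι → ∀ x, B x} {U : Set M} (hs : IsLocalFrameOn I F ∞ s U)
    (hU : IsOpen U) {x : M} (hx : x ∈ U) :
    ∃ T : M → F →L[ℝ] (ι → ℝ), ContMDiffAt I 𝓘(ℝ, F →L[ℝ] (ι → ℝ)) ∞ T x ∧
      ∀ᶠ y in 𝓝 x, ∀ v : B y, T y (trivializationAt F B x ⟨y, v⟩).2 = fun i ↦ hs.coeff i y v := by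
  set e := trivializationAt F B x
  have hxe : x ∈ e.baseSet := FiberBundle.mem_baseSet_trivializationAt' x
  -- `L y` sends coefficients to the local representation of the section they define; a smooth left
  -- inverse recovers the coefficients.
  set L : M → (ι → ℝ) →L[ℝ] F := fun y ↦ ∑ i, ContinuousLinearMap.smulRightL ℝ (ι → ℝ) F
    (ContinuousLinearMap.proj i) (e ⟨y, s i y⟩).2 with hL
  have hLs : ContMDiffAt I 𝓘(ℝ, (ι → ℝ) →L[ℝ] F) ∞ L x := by
    refine contMDiffAt_finsetSum fun i _ ↦ ?_
    exact (ContinuousLinearMap.smulRightL ℝ (ι → ℝ) F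
      (ContinuousLinearMap.proj i)).contMDiff.contMDiffAt.comp x
        ((contMDiffAt_section x).1 (hs.contMDiffAt hU hx i))
  have hLa : ∀ y ∈ e.baseSet, ∀ c, L y c = (e ⟨y, ∑ i, c i • s i y⟩).2 := by
    intro y hy c
    have h := map_sum (e.linearEquivAt ℝ y hy) (fun i ↦ c i • s i y) Finset.univ
    rw [Trivialization.linearEquivAt_apply] at h
    rw [h, hL]
    simp
  have hinj : Function.Injective (L x) := by
    rw [injective_iff_map_eq_zero]
    intro c hc
    rw [hLa x hxe] at hc
    have h1 : (e.linearEquivAt ℝ x hxe) (∑ i, c i • s i x) = 0 := hc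
    rw [LinearEquiv.map_eq_zero_iff] at h1
    funext i
    exact (Fintype.linearIndependent_iff.1 (hs.linearIndependent hx)) c h1 i
  obtain ⟨T, hT, hTL⟩ := exists_smooth_leftInverse hLs hinj
  refine ⟨T, hT, ?_⟩
  filter_upwards [hTL, e.open_baseSet.mem_nhds hxe, hU.mem_nhds hx] with y hy hye hyU v
  have h2 : v = ∑ i, hs.coeff i y v • s i y := by
    simpa using hs.coeff_sum_eq (FiberBundle.extend F v) hyU
  conv_lhs => rw [h2]
  rw [← hLa y hye (fun i ↦ hs.coeff i y v), hy]

theorem IsLocalFrameOn.contMDiffAt_coeff {s : ι → ∀ x, B x} {U : Set M}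
    (hs : IsLocalFrameOn I F ∞ s U) (hU : IsOpen U) {x : M} (hx : x ∈ U) {A : ∀ x, B x}
    (hA : CMDiffAt ∞ (T% A) x) (i : ι) : CMDiffAt ∞ (fun y ↦ hs.coeff i y (A y)) x := by
  obtain ⟨T, hT, h⟩ := hs.exists_coeff_eq hU hx
  have h1 := hT.clm_apply ((contMDiffAt_section x).1 hA)
  refine (contMDiffAt_pi_space.1 h1 i).congr_of_eventuallyEq ?_
  filter_upwards [h] with y hy
  rw [hy]

theorem IsLocalFrameOn.mdifferentiableAt_coeff {s : ι → ∀ x, B x} {U : Set M}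
    (hs : IsLocalFrameOn I F ∞ s U) (hU : IsOpen U) {x : M} (hx : x ∈ U) {A : ∀ x, B x}
    (hA : MDiffAt (T% A) x) (i : ι) : MDiffAt (fun y ↦ hs.coeff i y (A y)) x := by
  obtain ⟨T, hT, h⟩ := hs.exists_coeff_eq hU hx
  have h1 := (hT.mdifferentiableAt (by simp)).clm_apply ((mdifferentiableAt_section I A).1 hA)
  have h2 := (ContinuousLinearMap.proj (R := ℝ) (φ := fun _ : ι ↦ ℝ) i).mdifferentiableAt.comp x h1
  refine h2.congr_of_eventuallyEq ?_
  filter_upwards [h] with y hy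
  simp [hy]

end

/-- A vector field is smooth if its derivations of the functions in a family which separates tangent
vectors are smooth. -/
theorem contMDiffAt_vectorField_of_separating [IsManifold I ∞ M] [FiniteDimensional ℝ V]
    {ι : Type*} [Fintype ι] {f : ι → M → ℝ} {U : Set M} (hU : IsOpen U) {p : M} (hp : p ∈ U)
    (hf : ∀ i, CMDiff[U] ∞ (f i))
    (hsep : ∀ w : TangentSpace I p, (∀ i, mvfderiv I (f i) p w = 0) → w = 0)
    {A : ∀ x : M, TangentSpace I x} (hA : ∀ i, CMDiff[U] ∞ (fun q ↦ mvfderiv I (f i) q (A q))) :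
    CMDiffAt ∞ (T% A) p := by
  set e := trivializationAt V (TangentSpace I : M → Type _) p
  have hpe : p ∈ e.baseSet := FiberBundle.mem_baseSet_trivializationAt' p
  set b := Module.finBasis ℝ V
  set s := e.localFrame b
  have hs : IsLocalFrameOn I V ∞ s e.baseSet := e.isLocalFrameOn_localFrame_baseSet I ∞ b
  have hW : IsOpen (U ∩ e.baseSet) := hU.inter e.open_baseSet
  have hpW : p ∈ U ∩ e.baseSet := ⟨hp, hpe⟩
  -- `L q` sends the frame coefficients of a vector to its derivatives of all the `f i`. Separation
  -- at `p` is injectivity of `L p`, and a smooth left inverse computes the coefficients of `A` from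
  -- the functions `A (f i)`.
  set L : M → (Fin (Module.finrank ℝ V) → ℝ) →L[ℝ] (ι → ℝ) := fun q ↦
    ∑ j, ContinuousLinearMap.smulRightL ℝ (Fin (Module.finrank ℝ V) → ℝ) (ι → ℝ)
    (ContinuousLinearMap.proj j) (fun i ↦ mvfderiv I (f i) q (s j q)) with hL
  have hLs : ContMDiffAt I 𝓘(ℝ, (Fin (Module.finrank ℝ V) → ℝ) →L[ℝ] (ι → ℝ)) ∞ L p := by
    refine contMDiffAt_finsetSum fun j _ ↦ ?_
    refine (ContinuousLinearMap.smulRightL ℝ (Fin (Module.finrank ℝ V) → ℝ) (ι → ℝ)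
      (ContinuousLinearMap.proj j)).contMDiff.contMDiffAt.comp p (contMDiffAt_pi_space.2 fun i ↦ ?_)
    exact (contMDiffOn_mvfderiv_apply hW ((hf i).mono Set.inter_subset_left)
      ((hs.contMDiffOn j).mono Set.inter_subset_right)).contMDiffAt (hW.mem_nhds hpW)
  have hLa : ∀ q c, L q c = fun i ↦ mvfderiv I (f i) q (∑ j, c j • s j q) := by
    intro q c
    funext i
    rw [map_sum, hL]
    simp
  have hinj : Function.Injective (L p) := by
    rw [injective_iff_map_eq_zero]
    intro c hc
    rw [hLa p] at hc
    have h1 := hsep _ (fun i ↦ congrFun hc i)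
    funext i
    exact (Fintype.linearIndependent_iff.1 (hs.linearIndependent hpe)) c h1 i
  obtain ⟨T, hT, hTL⟩ := exists_smooth_leftInverse hLs hinj
  have h2 : ContMDiffAt I 𝓘(ℝ, Fin (Module.finrank ℝ V) → ℝ) ∞
      (fun q ↦ T q (fun i ↦ mvfderiv I (f i) q (A q))) p :=
    hT.clm_apply (contMDiffAt_pi_space.2 fun i ↦ (hA i).contMDiffAt (hU.mem_nhds hp))
  refine hs.contMDiffAt_of_coeff_aux (fun j ↦ ?_) e.open_baseSet hpe
  refine (contMDiffAt_pi_space.1 h2 j).congr_of_eventuallyEq ?_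
  filter_upwards [hTL, e.open_baseSet.mem_nhds hpe] with q hq hqe
  have h3 := hq (fun j ↦ hs.coeff j q (A q))
  rw [hLa, ← hs.coeff_sum_eq A hqe] at h3
  rw [h3]
  rfl

end Frames

/-! ### Lifts of sections of `TM ⊕ T*M` to `T*M`, and their Lie brackets. -/

section Lifts

variable {V : Type*} [NormedAddCommGroup V] [NormedSpace ℝ V] [FiniteDimensional ℝ V]
  {H : Type*} [TopologicalSpace H] {I : ModelWithCorners ℝ V H}
  {M : Type*} [TopologicalSpace M] [ChartedSpace H M] [IsManifold I ∞ M]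

/-- The vector field on `T*M` which corresponds to the pull-back of a section of `TM ⊕ T*M`. -/
def liftField (D : CovariantDerivative I V (TangentSpace I : M → Type _))
    (u : ∀ x : M, GTangentSpace I x) (γ : CotangentBundle I M) :
    TangentSpace (I.prod 𝓘(ℝ, V →L[ℝ] ℝ)) γ :=
  horizontalVerticalEquiv D γ (u γ.proj)

theorem mvfderiv_comp_proj_liftField (D : CovariantDerivative I V (TangentSpace I : M → Type _))
    (u : ∀ x : M, GTangentSpace I x) {γ : CotangentBundle I M} {f : M → ℝ}
    (hf : MDifferentiableAt I 𝓘(ℝ, ℝ) f γ.proj) :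
    mvfderiv (I.prod 𝓘(ℝ, V →L[ℝ] ℝ)) (fun γ : CotangentBundle I M ↦ f γ.proj) γ
      (liftField D u γ) = mvfderiv I f γ.proj (u γ.proj).1 := by
  rw [mvfderiv_comp_proj hf, liftField, mfderiv_proj_horizontalVerticalEquiv]

/-- A lift maps a fibre-linear function to the sum of a fibre-linear function and a function of the
base, so a second lift can be applied to the result. This is what makes commutators of lifts
computable. -/
theorem mvfderiv_fiberLinear_liftField
    (D : CovariantDerivative I V (TangentSpace I : M → Type _)) {γ : CotangentBundle I M}
    {Z : ∀ x : M, TangentSpace I x} (hZ : MDiffAt (T% Z) γ.proj) (u : ∀ x : M, GTangentSpace I x) :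
    mvfderiv (I.prod 𝓘(ℝ, V →L[ℝ] ℝ)) (fiberLinear Z) γ (liftField D u γ) =
      fiberLinear (fun x ↦ D Z x (u x).1) γ + (u γ.proj).2 (Z γ.proj) :=
  mvfderiv_fiberLinear_horizontalVerticalEquiv D hZ _

/-- Lifts of smooth sections are smooth vector fields. -/
theorem contMDiffOn_liftField {D : CovariantDerivative I V (TangentSpace I : M → Type _)}
    (hD : D.PreservesSmooth) {u : ∀ x : M, GTangentSpace I x} {U : Set M} (hU : IsOpen U)
    (hu₁ : CMDiff[U] ∞ (T% (fun y ↦ (u y).1)))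
    (hu₂ : CMDiff[U] ∞ (fun y ↦ TotalSpace.mk' (V →L[ℝ] ℝ) (E := CotangentSpace I) y (u y).2)) :
    ContMDiffOn (I.prod 𝓘(ℝ, V →L[ℝ] ℝ)) (I.prod 𝓘(ℝ, V →L[ℝ] ℝ)).tangent ∞
      (fun γ : CotangentBundle I M ↦ (⟨γ, liftField D u γ⟩ :
        TangentBundle (I.prod 𝓘(ℝ, V →L[ℝ] ℝ)) (CotangentBundle I M)))
      ((TotalSpace.proj : CotangentBundle I M → M) ⁻¹' U) := by
  intro γ hγ
  set b := Module.finBasis ℝ V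
  set e := trivializationAt V (TangentSpace I : M → Type _) γ.proj
  have hxe : γ.proj ∈ e.baseSet := FiberBundle.mem_baseSet_trivializationAt' γ.proj
  set s := e.localFrame b
  have hs : IsLocalFrameOn I V ∞ s e.baseSet := e.isLocalFrameOn_localFrame_baseSet I ∞ b
  set W : Set M := U ∩ (e.baseSet ∩ (chartAt H γ.proj).source)
  have hW : IsOpen W := hU.inter (e.open_baseSet.inter (chartAt H γ.proj).open_source)
  have hγW : γ.proj ∈ W := ⟨hγ, hxe, mem_chart_source H γ.proj⟩
  have hWU : W ⊆ U := Set.inter_subset_left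
  have hsW : ∀ i, CMDiff[W] ∞ (T% (s i)) := fun i ↦
    (hs.contMDiffOn i).mono (Set.inter_subset_right.trans Set.inter_subset_left)
  -- Separating functions near `γ`: the coordinates of the base detect the horizontal part, and the
  -- fibre-linear functions of a frame then detect the vertical part.
  set g : Fin (Module.finrank ℝ V) → M → ℝ := fun i ↦
    (LinearMap.toContinuousLinearMap (b.coord i)) ∘ extChartAt I γ.proj with hg
  have hgW : ∀ i, CMDiff[W] ∞ (g i) := fun i ↦
    (ContinuousLinearMap.contMDiff _).comp_contMDiffOn
      (contMDiffOn_extChartAt.mono (Set.inter_subset_right.trans Set.inter_subset_right))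
  refine (contMDiffAt_vectorField_of_separating (I := I.prod 𝓘(ℝ, V →L[ℝ] ℝ))
    (f := Sum.elim (fun i (γ : CotangentBundle I M) ↦ g i γ.proj) (fun i ↦ fiberLinear (s i)))
    (isOpen_preimage_proj hW) hγW ?_ ?_ ?_).contMDiffWithinAt
  · rintro (i | i)
    · exact contMDiffOn_comp_proj (hgW i)
    · exact contMDiffOn_fiberLinear (hsW i)
  · intro w hw
    obtain ⟨⟨v, ξ⟩, rfl⟩ := (horizontalVerticalEquiv D γ).surjective w
    have hv : v = 0 := by
      apply (isInvertible_mfderiv_extChartAt (mem_extChartAt_source (I := I) γ.proj)).injective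
      rw [map_zero]
      refine b.ext_elem fun i ↦ ?_
      have h1 := hw (Sum.inl i)
      rw [Sum.elim_inl, mvfderiv_comp_proj (mdifferentiableAt_of_contMDiffOn hW (hgW i) hγW),
        mfderiv_proj_horizontalVerticalEquiv, hg] at h1
      have h2 := mfderiv_comp γ.proj
        (LinearMap.toContinuousLinearMap (b.coord i)).mdifferentiableAt
        (mdifferentiableAt_extChartAt (I := I) (mem_chart_source H γ.proj))
      have h3 := (DFunLike.congr_fun h2 v).symm.trans h1
      rw [ContinuousLinearMap.mfderiv_eq] at h3
      exact h3.trans (DFunLike.congr_fun b.repr.map_zero i).symm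
    subst hv
    have hξ : ξ = 0 := by
      ext z
      have h4 : z = ∑ i, hs.coeff i γ.proj z • s i γ.proj := by
        simpa using hs.coeff_sum_eq (FiberBundle.extend V z) hxe
      rw [h4, map_sum]
      refine Finset.sum_eq_zero fun i _ ↦ ?_
      have h1 := hw (Sum.inr i)
      rw [Sum.elim_inr, mvfderiv_fiberLinear_horizontalVerticalEquiv D
        (mdifferentiableAt_of_contMDiffOn hW (hsW i) hγW), map_zero, map_zero, zero_add] at h1
      rw [map_smul, h1, smul_zero]
    rw [hξ]
    exact (horizontalVerticalEquiv D γ).map_zero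
  · rintro (i | i)
    · refine (contMDiffOn_comp_proj (contMDiffOn_mvfderiv_apply hW (hgW i)
        (hu₁.mono hWU))).congr fun δ hδ ↦ ?_
      exact mvfderiv_comp_proj_liftField D u (mdifferentiableAt_of_contMDiffOn hW (hgW i) hδ)
    · refine ((contMDiffOn_fiberLinear (hD W _ _ hW (hu₁.mono hWU) (hsW i))).add
        (contMDiffOn_comp_proj (contMDiffOn_pairing (hu₂.mono hWU) (hsW i)))).congr fun δ hδ ↦ ?_
      exact mvfderiv_fiberLinear_liftField D (mdifferentiableAt_of_contMDiffOn hW (hsW i) hδ) u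

/-- The Lie bracket at `γ` of the lifts of two sections of `TM ⊕ T*M`. -/
def liftBracket (D : CovariantDerivative I V (TangentSpace I : M → Type _))
    (γ : CotangentBundle I M) (u v : ∀ x : M, GTangentSpace I x) : GTangentSpace I γ.proj :=
  (horizontalVerticalEquiv D γ).symm
    (mlieBracket (I.prod 𝓘(ℝ, V →L[ℝ] ℝ)) (liftField D u) (liftField D v) γ)

theorem horizontalVerticalEquiv_liftBracket
    (D : CovariantDerivative I V (TangentSpace I : M → Type _))
    (γ : CotangentBundle I M) (u v : ∀ x : M, GTangentSpace I x) :
    horizontalVerticalEquiv D γ (liftBracket D γ u v) =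
      mlieBracket (I.prod 𝓘(ℝ, V →L[ℝ] ℝ)) (liftField D u) (liftField D v) γ :=
  (horizontalVerticalEquiv D γ).apply_symm_apply _

variable {D : CovariantDerivative I V (TangentSpace I : M → Type _)}
  {u v : ∀ x : M, GTangentSpace I x} {U : Set M} {γ : CotangentBundle I M}

/-- A lift is related by the projection to the vector part of the section, hence so are the
brackets. This is checked on functions pulled back from `M`. -/
theorem liftBracket_fst (hD : D.PreservesSmooth) (hU : IsOpen U) (hγ : γ.proj ∈ U)
    (hu : ContMDiffOn I (I.prod 𝓘(ℝ, V × (V →L[ℝ] ℝ))) ∞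
      (fun y ↦ TotalSpace.mk' (V × (V →L[ℝ] ℝ)) (E := fun y ↦ GTangentSpace I y) y (u y)) U)
    (hv : ContMDiffOn I (I.prod 𝓘(ℝ, V × (V →L[ℝ] ℝ))) ∞
      (fun y ↦ TotalSpace.mk' (V × (V →L[ℝ] ℝ)) (E := fun y ↦ GTangentSpace I y) y (v y)) U) :
    (liftBracket D γ u v).1 = mlieBracket I (fun y ↦ (u y).1) (fun y ↦ (v y).1) γ.proj := by
  rw [contMDiffOn_generalized_iff] at hu hv
  rw [← sub_eq_zero]
  refine tangentVector_eq_zero fun W f hW hγW hf ↦ ?_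
  have hWU := hW.inter hU
  have hx : γ.proj ∈ W ∩ U := ⟨hγW, hγ⟩
  replace hf := hf.mono (Set.inter_subset_left (s := W) (t := U))
  have hu₁ := hu.1.mono (Set.inter_subset_right (s := W) (t := U))
  have hv₁ := hv.1.mono (Set.inter_subset_right (s := W) (t := U))
  have hu₂ := hu.2.mono (Set.inter_subset_right (s := W) (t := U))
  have hv₂ := hv.2.mono (Set.inter_subset_right (s := W) (t := U))
  rw [map_sub, mvfderiv_mlieBracket hWU hx hu₁ hv₁ hf]
  have h1 := mvfderiv_mlieBracket (isOpen_preimage_proj hWU) (x := γ) hx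
    (contMDiffOn_liftField hD hWU hu₁ hu₂) (contMDiffOn_liftField hD hWU hv₁ hv₂)
    (contMDiffOn_comp_proj hf)
  have key : ∀ w : ∀ x : M, GTangentSpace I x, (fun δ ↦ mvfderiv (I.prod 𝓘(ℝ, V →L[ℝ] ℝ))
      (fun γ : CotangentBundle I M ↦ f γ.proj) δ (liftField D w δ)) =ᶠ[𝓝 γ]
      fun δ ↦ (fun x ↦ mvfderiv I f x (w x).1) δ.proj := fun w ↦ by
    filter_upwards [(isOpen_preimage_proj hWU).mem_nhds hx] with δ hδ
    exact mvfderiv_comp_proj_liftField D w (mdifferentiableAt_of_contMDiffOn hWU hf hδ)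
  rw [← horizontalVerticalEquiv_liftBracket, mvfderiv_comp_proj
    (mdifferentiableAt_of_contMDiffOn hWU hf hx), mfderiv_proj_horizontalVerticalEquiv,
    (key u).mvfderiv_eq, (key v).mvfderiv_eq,
    mvfderiv_comp_proj_liftField D u (mdifferentiableAt_of_contMDiffOn hWU
      (contMDiffOn_mvfderiv_apply hWU hf hv₁) hx),
    mvfderiv_comp_proj_liftField D v (mdifferentiableAt_of_contMDiffOn hWU
      (contMDiffOn_mvfderiv_apply hWU hf hu₁) hx)] at h1
  rw [h1, sub_self]

/-- The commutator of the two lifts is applied to `fiberLinear Z`. Its fibre-linear part gives `D_X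
D_Y Z - D_Y D_X Z`, from which the horizontal part of the bracket removes `D_{[X,Y]} Z`; the base
functions give `(D_X η - D_Y ξ)(Z)`. Thus `γ` enters only through the curvature. -/
theorem liftBracket_snd_apply (hD : D.PreservesSmooth) (hU : IsOpen U) (hγ : γ.proj ∈ U)
    (hu : ContMDiffOn I (I.prod 𝓘(ℝ, V × (V →L[ℝ] ℝ))) ∞
      (fun y ↦ TotalSpace.mk' (V × (V →L[ℝ] ℝ)) (E := fun y ↦ GTangentSpace I y) y (u y)) U)
    (hv : ContMDiffOn I (I.prod 𝓘(ℝ, V × (V →L[ℝ] ℝ))) ∞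
      (fun y ↦ TotalSpace.mk' (V × (V →L[ℝ] ℝ)) (E := fun y ↦ GTangentSpace I y) y (v y)) U)
    {Z : ∀ x : M, TangentSpace I x} (hZ : CMDiff[U] ∞ (T% Z)) :
    (liftBracket D γ u v).2 (Z γ.proj) =
      mvfderiv I (fun y ↦ (v y).2 (Z y)) γ.proj (u γ.proj).1
        - mvfderiv I (fun y ↦ (u y).2 (Z y)) γ.proj (v γ.proj).1
        - (v γ.proj).2 (D Z γ.proj (u γ.proj).1) + (u γ.proj).2 (D Z γ.proj (v γ.proj).1)
        + γ.2 (D (fun y ↦ D Z y (v y).1) γ.proj (u γ.proj).1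
          - D (fun y ↦ D Z y (u y).1) γ.proj (v γ.proj).1
          - D Z γ.proj (mlieBracket I (fun y ↦ (u y).1) (fun y ↦ (v y).1) γ.proj)) := by
  have h0 := liftBracket_fst hD hU hγ hu hv
  rw [contMDiffOn_generalized_iff] at hu hv
  have hZd : ∀ x ∈ U, MDiffAt (T% Z) x := fun x hx ↦ mdifferentiableAt_of_contMDiffOn hU hZ hx
  have h1 := mvfderiv_mlieBracket (isOpen_preimage_proj hU) (x := γ) hγ
    (contMDiffOn_liftField hD hU hu.1 hu.2) (contMDiffOn_liftField hD hU hv.1 hv.2)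
    (contMDiffOn_fiberLinear hZ)
  have key : ∀ w : ∀ x : M, GTangentSpace I x, (fun δ ↦ mvfderiv (I.prod 𝓘(ℝ, V →L[ℝ] ℝ))
      (fiberLinear Z) δ (liftField D w δ)) =ᶠ[𝓝 γ]
      fiberLinear (fun x ↦ D Z x (w x).1) + fun δ ↦ (fun x ↦ (w x).2 (Z x)) δ.proj := fun w ↦ by
    filter_upwards [(isOpen_preimage_proj hU).mem_nhds hγ] with δ hδ
    exact mvfderiv_fiberLinear_liftField D (hZd _ hδ) w
  have key2 : ∀ w w' : ∀ x : M, GTangentSpace I x, CMDiff[U] ∞ (T% (fun y ↦ (w y).1)) →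
      CMDiff[U] ∞ (fun y ↦ TotalSpace.mk' (V →L[ℝ] ℝ) (E := CotangentSpace I) y (w y).2) →
      mvfderiv (I.prod 𝓘(ℝ, V →L[ℝ] ℝ)) (fun δ ↦ mvfderiv (I.prod 𝓘(ℝ, V →L[ℝ] ℝ))
        (fiberLinear Z) δ (liftField D w δ)) γ (liftField D w' γ) =
      γ.2 (D (fun x ↦ D Z x (w x).1) γ.proj (w' γ.proj).1)
        + (w' γ.proj).2 (D Z γ.proj (w γ.proj).1)
        + mvfderiv I (fun x ↦ (w x).2 (Z x)) γ.proj (w' γ.proj).1 := by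
    intro w w' hw₁ hw₂
    have h2 := mdifferentiableAt_of_contMDiffOn hU (hD U _ _ hU hw₁ hZ) hγ
    have h3 := mdifferentiableAt_of_contMDiffOn hU (contMDiffOn_pairing hw₂ hZ) hγ
    have h4 := mdifferentiableAt_of_contMDiffOn (isOpen_preimage_proj hU)
      (contMDiffOn_comp_proj (contMDiffOn_pairing hw₂ hZ)) (x := γ) hγ
    rw [(key w).mvfderiv_eq, mvfderiv_add (mdifferentiableAt_fiberLinear h2) h4, add_apply,
      mvfderiv_fiberLinear_liftField D h2, mvfderiv_comp_proj_liftField D w' h3]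
    rfl
  rw [← horizontalVerticalEquiv_liftBracket, mvfderiv_fiberLinear_horizontalVerticalEquiv D
    (hZd _ hγ), key2 v u hv.1 hv.2, key2 u v hu.1 hu.2, h0] at h1
  rw [map_sub, map_sub]
  linear_combination h1

end Lifts

/-! ### Tensoriality of the Nijenhuis tensor of an almost complex structure. -/

section AlmostComplex

variable {V : Type*} [NormedAddCommGroup V] [NormedSpace ℝ V] [CompleteSpace V]
  {H : Type*} [TopologicalSpace H] {I : ModelWithCorners ℝ V H}
  {M : Type*} [TopologicalSpace M] [ChartedSpace H M] [IsManifold I ∞ M]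

theorem isLocalOddOp_mlieBracket (x : M) :
    IsLocalOddOp I V (B := (TangentSpace I : M → Type _)) (x := x)
      (fun A B ↦ mlieBracket I A B x) where
  congr hU hx _ _ h h' := Filter.EventuallyEq.mlieBracket_vectorField_eq
    (Filter.eventually_of_mem (hU.mem_nhds hx) h) (Filter.eventually_of_mem (hU.mem_nhds hx) h')
  neg_left {U u v} hU hx hu hv := by
    have h := mlieBracket_const_smul_left (I := I) (W := v) (c := (-1 : ℝ))
      (mdifferentiableAt_of_contMDiffOn hU hu hx)
    simpa using h
  neg_right {U u v} hU hx hu hv := by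
    have h := mlieBracket_const_smul_right (I := I) (V := u) (c := (-1 : ℝ))
      (mdifferentiableAt_of_contMDiffOn hU hv hx)
    simpa using h

variable {K : ∀ x : M, TangentSpace I x →ₗ[ℝ] TangentSpace I x}

/-- The derivatives of `f` along `K B` cancel between the first and the third bracket; those along
`B` cancel between the second and the fourth because `K² = -1`. -/
theorem tensorialAt_nijenhuis_left (hK : ∀ x v, K x (K x v) = -v) {x : M}
    (hKd : ∀ A : ∀ x : M, TangentSpace I x, MDiffAt (T% A) x → MDiffAt (T% (fun y ↦ K y (A y))) x)
    (B : ∀ x : M, TangentSpace I x) :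
    TensorialAt I V (fun A ↦ nijenhuis K (fun A B ↦ mlieBracket I A B x) A B) x where
  smul {f A} hf hA := by
    have h : (fun y ↦ K y ((f • A) y)) = f • fun y ↦ K y (A y) := by
      funext y; simp
    simp only [nijenhuis]
    rw [h, mlieBracket_smul_left hf (hKd A hA), mlieBracket_smul_left hf (hKd A hA),
      mlieBracket_smul_left hf hA, mlieBracket_smul_left hf hA]
    simp only [map_add, map_smul, hK]
    module
  add {A A'} hA hA' := by
    have h : (fun y ↦ K y ((A + A') y)) = (fun y ↦ K y (A y)) + fun y ↦ K y (A' y) := by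
      funext y; simp
    simp only [nijenhuis]
    rw [h, mlieBracket_add_left (hKd A hA) (hKd A' hA'),
      mlieBracket_add_left (hKd A hA) (hKd A' hA'), mlieBracket_add_left hA hA',
      mlieBracket_add_left hA hA']
    simp only [map_add]
    module

theorem tensorialAt_nijenhuis_right (hK : ∀ x v, K x (K x v) = -v) {x : M}
    (hKd : ∀ A : ∀ x : M, TangentSpace I x, MDiffAt (T% A) x → MDiffAt (T% (fun y ↦ K y (A y))) x)
    (A : ∀ x : M, TangentSpace I x) :
    TensorialAt I V (fun B ↦ nijenhuis K (fun A B ↦ mlieBracket I A B x) A B) x where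
  smul {f B} hf hB := by
    have h : (fun y ↦ K y ((f • B) y)) = f • fun y ↦ K y (B y) := by
      funext y; simp
    simp only [nijenhuis]
    rw [h, mlieBracket_smul_right hf (hKd B hB), mlieBracket_smul_right hf (hKd B hB),
      mlieBracket_smul_right hf hB, mlieBracket_smul_right hf hB]
    simp only [map_add, map_smul, hK]
    module
  add {B B'} hB hB' := by
    have h : (fun y ↦ K y ((B + B') y)) = (fun y ↦ K y (B y)) + fun y ↦ K y (B' y) := by
      funext y; simp
    simp only [nijenhuis]
    rw [h, mlieBracket_add_right (hKd B hB) (hKd B' hB'),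
      mlieBracket_add_right (hKd B hB) (hKd B' hB'), mlieBracket_add_right hB hB',
      mlieBracket_add_right hB hB']
    simp only [map_add]
    module

end AlmostComplex

/-! ### Integrability on the cotangent bundle, tested on lifts. -/

section Cotangent

variable {V : Type*} [NormedAddCommGroup V] [NormedSpace ℝ V]
  {H : Type*} [TopologicalSpace H] {I : ModelWithCorners ℝ V H}
  {M : Type*} [TopologicalSpace M] [ChartedSpace H M] [IsManifold I ∞ M]

theorem GeneralizedComplexStructure.contMDiffOn_apply (J : GeneralizedComplexStructure I M)
    {U : Set M} {u : ∀ x : M, GTangentSpace I x}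
    (hu : ContMDiffOn I (I.prod 𝓘(ℝ, V × (V →L[ℝ] ℝ))) ∞
      (fun y ↦ TotalSpace.mk' (V × (V →L[ℝ] ℝ)) (E := fun y ↦ GTangentSpace I y) y (u y)) U) :
    ContMDiffOn I (I.prod 𝓘(ℝ, V × (V →L[ℝ] ℝ))) ∞
      (fun y ↦ TotalSpace.mk' (V × (V →L[ℝ] ℝ)) (E := fun y ↦ GTangentSpace I y) y
        (J.toFun y (u y))) U :=
  ContMDiffOn.clm_bundle_apply (F₁ := V × (V →L[ℝ] ℝ)) (F₂ := V × (V →L[ℝ] ℝ))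
    (E₁ := fun y : M ↦ GTangentSpace I y) (E₂ := fun y : M ↦ GTangentSpace I y)
    J.smooth.contMDiffOn hu

variable [FiniteDimensional ℝ V]

theorem cotangentAlmostComplex_liftField (J : GeneralizedComplexStructure I M)
    (D : CovariantDerivative I V (TangentSpace I : M → Type _)) (u : ∀ x : M, GTangentSpace I x)
    (γ : CotangentBundle I M) :
    cotangentAlmostComplex J D γ (liftField D u γ) = liftField D (fun x ↦ J.toFun x (u x)) γ := by
  simp only [cotangentAlmostComplex, LinearMap.comp_apply, LinearEquiv.coe_coe, liftField,
    LinearEquiv.symm_apply_apply, ContinuousLinearMap.coe_coe]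

variable {D : CovariantDerivative I V (TangentSpace I : M → Type _)}

theorem contMDiffOn_liftField' (hD : D.PreservesSmooth) {u : ∀ x : M, GTangentSpace I x}
    {U : Set M} (hU : IsOpen U)
    (hu : ContMDiffOn I (I.prod 𝓘(ℝ, V × (V →L[ℝ] ℝ))) ∞
      (fun y ↦ TotalSpace.mk' (V × (V →L[ℝ] ℝ)) (E := fun y ↦ GTangentSpace I y) y (u y)) U) :
    ContMDiffOn (I.prod 𝓘(ℝ, V →L[ℝ] ℝ)) (I.prod 𝓘(ℝ, V →L[ℝ] ℝ)).tangent ∞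
      (fun γ : CotangentBundle I M ↦ (⟨γ, liftField D u γ⟩ :
        TangentBundle (I.prod 𝓘(ℝ, V →L[ℝ] ℝ)) (CotangentBundle I M)))
      ((TotalSpace.proj : CotangentBundle I M → M) ⁻¹' U) :=
  contMDiffOn_liftField hD hU (contMDiffOn_generalized_iff.1 hu).1
    (contMDiffOn_generalized_iff.1 hu).2

/-- The lifts of a local frame `s j` form a frame of the tangent bundle of `T*M`. The structure
keeps the coefficients of `A` and replaces each lift of `s j` by the smooth lift of `J (s j)`. -/
theorem mdifferentiableAt_cotangentAlmostComplex (hD : D.PreservesSmooth)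
    (J : GeneralizedComplexStructure I M) {γ : CotangentBundle I M}
    {A : ∀ γ : CotangentBundle I M, TangentSpace (I.prod 𝓘(ℝ, V →L[ℝ] ℝ)) γ}
    (hA : MDifferentiableAt (I.prod 𝓘(ℝ, V →L[ℝ] ℝ)) (I.prod 𝓘(ℝ, V →L[ℝ] ℝ)).tangent
      (fun δ : CotangentBundle I M ↦ (⟨δ, A δ⟩ :
        TangentBundle (I.prod 𝓘(ℝ, V →L[ℝ] ℝ)) (CotangentBundle I M))) γ) :
    MDifferentiableAt (I.prod 𝓘(ℝ, V →L[ℝ] ℝ)) (I.prod 𝓘(ℝ, V →L[ℝ] ℝ)).tangent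
      (fun δ : CotangentBundle I M ↦ (⟨δ, cotangentAlmostComplex J D δ (A δ)⟩ :
        TangentBundle (I.prod 𝓘(ℝ, V →L[ℝ] ℝ)) (CotangentBundle I M))) γ := by
  set e := trivializationAt (V × (V →L[ℝ] ℝ)) (fun y : M ↦ GTangentSpace I y) γ.proj
  have hxe : γ.proj ∈ e.baseSet := FiberBundle.mem_baseSet_trivializationAt' γ.proj
  set b := Module.finBasis ℝ (V × (V →L[ℝ] ℝ))
  set s := e.localFrame b
  have hs : IsLocalFrameOn I (V × (V →L[ℝ] ℝ)) ∞ s e.baseSet :=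
    e.isLocalFrameOn_localFrame_baseSet I ∞ b
  have hO := isOpen_preimage_proj (I := I) e.open_baseSet
  have hS : IsLocalFrameOn (I.prod 𝓘(ℝ, V →L[ℝ] ℝ)) (V × (V →L[ℝ] ℝ)) ∞
      (fun j ↦ liftField D (s j)) ((TotalSpace.proj : CotangentBundle I M → M) ⁻¹' e.baseSet) :=
    { linearIndependent := fun {δ} hδ ↦ (hs.linearIndependent hδ).map'
        (horizontalVerticalEquiv D δ).toLinearMap (LinearEquiv.ker _)
      generating := fun {δ} hδ ↦ by
        have h := congrArg (Submodule.map (horizontalVerticalEquiv D δ).toLinearMap)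
          (top_le_iff.1 (hs.generating hδ))
        rw [Submodule.map_span, ← Set.range_comp, Submodule.map_top, LinearEquiv.range] at h
        exact h.ge
      contMDiffOn := fun j ↦ contMDiffOn_liftField' hD e.open_baseSet (hs.contMDiffOn j) }
  have h1 : MDifferentiableAt (I.prod 𝓘(ℝ, V →L[ℝ] ℝ)) (I.prod 𝓘(ℝ, V →L[ℝ] ℝ)).tangent
      (fun δ : CotangentBundle I M ↦ (⟨δ, ∑ j, hS.coeff j δ (A δ) •
        liftField D (fun x ↦ J.toFun x (s j x)) δ⟩ :
        TangentBundle (I.prod 𝓘(ℝ, V →L[ℝ] ℝ)) (CotangentBundle I M))) γ := by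
    refine MDifferentiableAt.sum_section fun j _ ↦ ?_
    exact (hS.mdifferentiableAt_coeff hO hxe hA j).smul_section
      (mdifferentiableAt_of_contMDiffOn hO (contMDiffOn_liftField' hD e.open_baseSet
        (J.contMDiffOn_apply (hs.contMDiffOn j))) hxe)
  refine h1.congr_of_eventuallyEq ?_
  filter_upwards [hO.mem_nhds hxe] with δ hδ
  congr 1
  conv_lhs => rw [hS.coeff_sum_eq A hδ]
  rw [map_sum]
  refine Finset.sum_congr rfl fun j _ ↦ ?_
  rw [map_smul, cotangentAlmostComplex_liftField]

/-- The Nijenhuis tensor of `J^{𝒥,D}` in terms of the brackets of the lifts of sections. -/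
theorem nijenhuis_cotangentAlmostComplex (hD : D.PreservesSmooth)
    (J : GeneralizedComplexStructure I M) {γ : CotangentBundle I M}
    {A B : ∀ γ : CotangentBundle I M, TangentSpace (I.prod 𝓘(ℝ, V →L[ℝ] ℝ)) γ}
    (hA : MDifferentiableAt (I.prod 𝓘(ℝ, V →L[ℝ] ℝ)) (I.prod 𝓘(ℝ, V →L[ℝ] ℝ)).tangent
      (fun δ : CotangentBundle I M ↦ (⟨δ, A δ⟩ :
        TangentBundle (I.prod 𝓘(ℝ, V →L[ℝ] ℝ)) (CotangentBundle I M))) γ) (hB : MDifferentiableAt (I.prod 𝓘(ℝ, V →L[ℝ] ℝ)) (I.prod 𝓘(ℝ, V →L[ℝ] ℝ)).tangent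
      (fun δ : CotangentBundle I M ↦ (⟨δ, B δ⟩ :
        TangentBundle (I.prod 𝓘(ℝ, V →L[ℝ] ℝ)) (CotangentBundle I M))) γ) {u v : ∀ x : M, GTangentSpace I x}
    {U : Set M} (hU : IsOpen U) (hγ : γ.proj ∈ U)
    (hu : ContMDiffOn I (I.prod 𝓘(ℝ, V × (V →L[ℝ] ℝ))) ∞
      (fun y ↦ TotalSpace.mk' (V × (V →L[ℝ] ℝ)) (E := fun y ↦ GTangentSpace I y) y (u y)) U)
    (hv : ContMDiffOn I (I.prod 𝓘(ℝ, V × (V →L[ℝ] ℝ))) ∞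
      (fun y ↦ TotalSpace.mk' (V × (V →L[ℝ] ℝ)) (E := fun y ↦ GTangentSpace I y) y (v y)) U)
    (hAu : A γ = liftField D u γ) (hBv : B γ = liftField D v γ) :
    nijenhuis (cotangentAlmostComplex J D)
      (fun A B ↦ mlieBracket (I.prod 𝓘(ℝ, V →L[ℝ] ℝ)) A B γ) A B =
    horizontalVerticalEquiv D γ (nijenhuis (B := fun y ↦ GTangentSpace I y)
      (fun x ↦ (J.toFun x : GTangentSpace I x →ₗ[ℝ] GTangentSpace I x)) (liftBracket D γ) u v) := by
  have hO := isOpen_preimage_proj (I := I) hU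
  -- By tensoriality `A` and `B` may be replaced by lifts with the same values at `γ`, on which the
  -- structure acts through `J`.
  have h1 := TensorialAt.pointwise₂
    (fun τ _ ↦ tensorialAt_nijenhuis_left (cotangentAlmostComplex_sq J D) (x := γ)
      (fun A hA ↦ mdifferentiableAt_cotangentAlmostComplex hD J hA) τ)
    (fun σ _ ↦ tensorialAt_nijenhuis_right (cotangentAlmostComplex_sq J D) (x := γ)
      (fun A hA ↦ mdifferentiableAt_cotangentAlmostComplex hD J hA) σ) hA
    (mdifferentiableAt_of_contMDiffOn hO (contMDiffOn_liftField' hD hU hu) hγ) hB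
    (mdifferentiableAt_of_contMDiffOn hO (contMDiffOn_liftField' hD hU hv) hγ) hAu hBv
  rw [h1]
  simp only [nijenhuis, cotangentAlmostComplex_liftField, ContinuousLinearMap.coe_coe]
  have h2 : ∀ w : GTangentSpace I γ.proj, horizontalVerticalEquiv D γ (J.toFun γ.proj w) =
      cotangentAlmostComplex J D γ (horizontalVerticalEquiv D γ w) := fun w ↦ by
    simp only [cotangentAlmostComplex, LinearMap.comp_apply, LinearEquiv.coe_coe,
      LinearEquiv.symm_apply_apply, ContinuousLinearMap.coe_coe]
  rw [map_sub, map_sub, map_sub, h2, h2]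
  simp only [horizontalVerticalEquiv_liftBracket]

/-- Integrability of `J^{𝒥,D}` in terms of the brackets of the lifts of sections. -/
theorem isIntegrableAlmostComplex_iff (hD : D.PreservesSmooth)
    (J : GeneralizedComplexStructure I M) :
    IsIntegrableAlmostComplex (I.prod 𝓘(ℝ, V →L[ℝ] ℝ)) (cotangentAlmostComplex J D) ↔
    ∀ (γ : CotangentBundle I M) (U : Set M) (u v : ∀ x : M, GTangentSpace I x), IsOpen U →
      γ.proj ∈ U → ContMDiffOn I (I.prod 𝓘(ℝ, V × (V →L[ℝ] ℝ))) ∞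
      (fun y ↦ TotalSpace.mk' (V × (V →L[ℝ] ℝ)) (E := fun y ↦ GTangentSpace I y) y (u y)) U →
      ContMDiffOn I (I.prod 𝓘(ℝ, V × (V →L[ℝ] ℝ))) ∞
      (fun y ↦ TotalSpace.mk' (V × (V →L[ℝ] ℝ)) (E := fun y ↦ GTangentSpace I y) y (v y)) U →
      nijenhuis (B := fun y ↦ GTangentSpace I y)
        (fun x ↦ (J.toFun x : GTangentSpace I x →ₗ[ℝ] GTangentSpace I x))
        (liftBracket D γ) u v = 0 := by
  rw [IsIntegrableAlmostComplex, IsInvolutive, sectionsClosedUnder_iff_nijenhuis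
    (cotangentAlmostComplex_sq J D) isLocalOddOp_mlieBracket]
  constructor
  · intro h γ U u v hU hγ hu hv
    have hu' := contMDiffOn_liftField' hD hU hu
    have hv' := contMDiffOn_liftField' hD hU hv
    have h1 := h _ (liftField D u) (liftField D v) (isOpen_preimage_proj hU) hu' hv'
      (by simpa only [cotangentAlmostComplex_liftField] using
        contMDiffOn_liftField' hD hU (J.contMDiffOn_apply hu))
      (by simpa only [cotangentAlmostComplex_liftField] using
        contMDiffOn_liftField' hD hU (J.contMDiffOn_apply hv)) γ hγ
    rw [nijenhuis_cotangentAlmostComplex hD J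
      (mdifferentiableAt_of_contMDiffOn (isOpen_preimage_proj hU) hu' hγ)
      (mdifferentiableAt_of_contMDiffOn (isOpen_preimage_proj hU) hv' hγ) hU hγ hu hv rfl rfl] at h1
    exact (LinearEquiv.map_eq_zero_iff _).1 h1
  · intro h W A B hW hA hB _ _ γ hγ
    -- Arbitrary fields on `T*M` need not be lifts, but only the values at `γ` matter: any sections
    -- through the components of `A γ` and `B γ` will do.
    obtain ⟨U, u, hU, hγU, -, hu, hux⟩ := exists_smooth_section_through (I := I) (V × (V →L[ℝ] ℝ))
      (B := fun y ↦ GTangentSpace I y) isOpen_univ (Set.mem_univ γ.proj)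
      ((horizontalVerticalEquiv D γ).symm (A γ))
    obtain ⟨U', v, hU', hγU', hUU', hv, hvx⟩ := exists_smooth_section_through (I := I)
      (V × (V →L[ℝ] ℝ)) (B := fun y ↦ GTangentSpace I y) hU hγU
      ((horizontalVerticalEquiv D γ).symm (B γ))
    rw [nijenhuis_cotangentAlmostComplex hD J (mdifferentiableAt_of_contMDiffOn hW hA hγ)
      (mdifferentiableAt_of_contMDiffOn hW hB hγ) hU' hγU' (hu.mono hUU') hv
      (by rw [liftField, hux, LinearEquiv.apply_symm_apply])
      (by rw [liftField, hvx, LinearEquiv.apply_symm_apply]),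
      h γ U' u v hU' hγU' (hu.mono hUU') hv, map_zero]

end Cotangent

/-! ### The Courant bracket compared with the bracket of lifts: real sections. -/

section Ext

variable {V : Type*} [NormedAddCommGroup V] [NormedSpace ℝ V]
  {H : Type*} [TopologicalSpace H] {I : ModelWithCorners ℝ V H}
  {M : Type*} [TopologicalSpace M] [ChartedSpace H M] [IsManifold I ∞ M]

theorem covector_ext {U : Set M} {x : M} (hU : IsOpen U) (hx : x ∈ U) {φ ψ : CotangentSpace I x}
    (h : ∀ (W : Set M) (Z : ∀ x : M, TangentSpace I x), IsOpen W → x ∈ W → W ⊆ U →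
      CMDiff[W] ∞ (T% Z) → φ (Z x) = ψ (Z x)) : φ = ψ := by
  ext c
  obtain ⟨W, Z, hW, hxW, hWU, hZ, rfl⟩ := exists_smooth_section_through (I := I) V
    (B := (TangentSpace I : M → Type _)) hU hx c
  exact h W Z hW hxW hWU hZ

end Ext

section Brackets

variable {V : Type*} [NormedAddCommGroup V] [NormedSpace ℝ V] [FiniteDimensional ℝ V]
  {H : Type*} [TopologicalSpace H] {I : ModelWithCorners ℝ V H}
  {M : Type*} [TopologicalSpace M] [ChartedSpace H M] [IsManifold I ∞ M]
  {D : CovariantDerivative I V (TangentSpace I : M → Type _)}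
  {u v : ∀ x : M, GTangentSpace I x} {U : Set M}

theorem courantBracket_swap (u v : ∀ x : M, GTangentSpace I x) (x : M) :
    courantBracket u v x = -courantBracket v u x := by
  have h : mvfderiv I (fun y ↦ (u y).2 (v y).1 - (v y).2 (u y).1) x =
      -mvfderiv I (fun y ↦ (v y).2 (u y).1 - (u y).2 (v y).1) x := by
    rw [← mvfderiv_neg]
    congr 1
    funext y
    exact (neg_sub _ _).symm
  refine Prod.ext mlieBracket_swap_apply ?_
  simp only [courantBracket, Prod.snd_neg, h, smul_neg]
  abel

theorem courantBracket_snd_apply {x : M}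
    (hu : MDifferentiableAt I (I.prod 𝓘(ℝ, V × (V →L[ℝ] ℝ)))
      (fun y ↦ TotalSpace.mk' (V × (V →L[ℝ] ℝ)) (E := fun y ↦ GTangentSpace I y) y (u y)) x)
    (hv : MDifferentiableAt I (I.prod 𝓘(ℝ, V × (V →L[ℝ] ℝ)))
      (fun y ↦ TotalSpace.mk' (V × (V →L[ℝ] ℝ)) (E := fun y ↦ GTangentSpace I y) y (v y)) x)
    {Z : ∀ x : M, TangentSpace I x} (hZ : MDiffAt (T% Z) x) :
    (courantBracket u v x).2 (Z x) =
      mvfderiv I (fun y ↦ (v y).2 (Z y)) x (u x).1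
        - (v x).2 (mlieBracket I (fun y ↦ (u y).1) Z x)
        - (mvfderiv I (fun y ↦ (u y).2 (Z y)) x (v x).1
          - (u x).2 (mlieBracket I (fun y ↦ (v y).1) Z x))
        + (1 / 2) * (mvfderiv I (fun y ↦ (u y).2 (v y).1) x (Z x)
          - mvfderiv I (fun y ↦ (v y).2 (u y).1) x (Z x)) := by
  rw [mdifferentiableAt_generalized_iff] at hu hv
  have h3 : mvfderiv I (fun y ↦ (u y).2 (v y).1 - (v y).2 (u y).1) x =
      mvfderiv I (fun y ↦ (u y).2 (v y).1) x - mvfderiv I (fun y ↦ (v y).2 (u y).1) x :=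
    mvfderiv_sub (mdifferentiableAt_pairing hu.2 hv.1) (mdifferentiableAt_pairing hv.2 hu.1)
  simp only [courantBracket, add_apply, sub_apply, smul_apply, h3, smul_eq_mul]
  rw [lieDerivOneForm_apply hv.2 hZ, lieDerivOneForm_apply hu.2 hZ]

theorem courantBracket_neg_left (hU : IsOpen U) {x : M} (hx : x ∈ U)
    (hu : ContMDiffOn I (I.prod 𝓘(ℝ, V × (V →L[ℝ] ℝ))) ∞
      (fun y ↦ TotalSpace.mk' (V × (V →L[ℝ] ℝ)) (E := fun y ↦ GTangentSpace I y) y (u y)) U)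
    (hv : ContMDiffOn I (I.prod 𝓘(ℝ, V × (V →L[ℝ] ℝ))) ∞
      (fun y ↦ TotalSpace.mk' (V × (V →L[ℝ] ℝ)) (E := fun y ↦ GTangentSpace I y) y (v y)) U) :
    courantBracket (-u) v x = -courantBracket u v x := by
  have e : mlieBracket I (fun y ↦ ((-u) y).1) (fun y ↦ (v y).1) x =
      -mlieBracket I (fun y ↦ (u y).1) (fun y ↦ (v y).1) x :=
    (isLocalOddOp_mlieBracket x).neg_left hU hx (contMDiffOn_generalized_iff.1 hu).1
      (contMDiffOn_generalized_iff.1 hv).1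
  refine Prod.ext e ?_
  refine covector_ext hU hx fun W Z hW hxW hWU hZ ↦ ?_
  have e1 : mlieBracket I (fun y ↦ ((-u) y).1) Z x = -mlieBracket I (fun y ↦ (u y).1) Z x :=
    (isLocalOddOp_mlieBracket x).neg_left hW hxW
      ((contMDiffOn_generalized_iff.1 hu).1.mono hWU) hZ
  have e2 : mvfderiv I (fun y ↦ ((-u) y).2 (Z y)) x = -mvfderiv I (fun y ↦ (u y).2 (Z y)) x :=
    mvfderiv_neg
  have e3 : mvfderiv I (fun y ↦ ((-u) y).2 (v y).1) x = -mvfderiv I (fun y ↦ (u y).2 (v y).1) x :=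
    mvfderiv_neg
  have e4 : mvfderiv I (fun y ↦ (v y).2 ((-u) y).1) x = -mvfderiv I (fun y ↦ (v y).2 (u y).1) x := by
    rw [← mvfderiv_neg]
    congr 1
    funext y
    exact (v y).2.map_neg _
  rw [Prod.snd_neg, neg_apply, courantBracket_snd_apply (mdifferentiableAt_of_contMDiffOn hU hu hx)
        (mdifferentiableAt_of_contMDiffOn hU hv hx) (mdifferentiableAt_of_contMDiffOn hW hZ hxW),
    courantBracket_snd_apply (mdifferentiableAt_of_contMDiffOn hU hu.neg_section hx)
        (mdifferentiableAt_of_contMDiffOn hU hv hx) (mdifferentiableAt_of_contMDiffOn hW hZ hxW),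
    e1, e2, e3, e4]
  simp only [Pi.neg_apply, Prod.fst_neg, Prod.snd_neg, neg_apply, map_neg]
  ring

/-- The form part contains Lie derivatives defined by cases, so both properties are verified after
evaluation on vector fields. They make the Nijenhuis criterion for eigenbundles applicable to the
Courant bracket. -/
theorem isLocalOddOp_courantBracket (x : M) :
    IsLocalOddOp I (V × (V →L[ℝ] ℝ)) (B := fun y : M ↦ GTangentSpace I y) (x := x)
      (fun u v ↦ courantBracket u v x) where
  congr {U u u' v v'} hU hx hu hv h h' := by
    have hu' : ContMDiffOn I (I.prod 𝓘(ℝ, V × (V →L[ℝ] ℝ))) ∞ (fun y ↦ TotalSpace.mk'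
        (V × (V →L[ℝ] ℝ)) (E := fun y ↦ GTangentSpace I y) y (u' y)) U :=
      hu.congr fun y hy ↦ by rw [h y hy]
    have hv' : ContMDiffOn I (I.prod 𝓘(ℝ, V × (V →L[ℝ] ℝ))) ∞ (fun y ↦ TotalSpace.mk'
        (V × (V →L[ℝ] ℝ)) (E := fun y ↦ GTangentSpace I y) y (v' y)) U :=
      hv.congr fun y hy ↦ by rw [h' y hy]
    have hn : ∀ᶠ y in 𝓝 x, u y = u' y := Filter.eventually_of_mem (hU.mem_nhds hx) h
    have hn' : ∀ᶠ y in 𝓝 x, v y = v' y := Filter.eventually_of_mem (hU.mem_nhds hx) h'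
    have e1 : ∀ᶠ y in 𝓝 x, (u y).1 = (u' y).1 := hn.mono fun y hy ↦ congrArg Prod.fst hy
    have e2 : ∀ᶠ y in 𝓝 x, (v y).1 = (v' y).1 := hn'.mono fun y hy ↦ congrArg Prod.fst hy
    refine Prod.ext (Filter.EventuallyEq.mlieBracket_vectorField_eq e1 e2) ?_
    refine covector_ext hU hx fun W Z hW hxW hWU hZ ↦ ?_
    have e3 : mlieBracket I (fun y ↦ (u y).1) Z x = mlieBracket I (fun y ↦ (u' y).1) Z x :=
      Filter.EventuallyEq.mlieBracket_vectorField_eq e1 .rfl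
    have e4 : mlieBracket I (fun y ↦ (v y).1) Z x = mlieBracket I (fun y ↦ (v' y).1) Z x :=
      Filter.EventuallyEq.mlieBracket_vectorField_eq e2 .rfl
    rw [courantBracket_snd_apply (mdifferentiableAt_of_contMDiffOn hU hu hx)
        (mdifferentiableAt_of_contMDiffOn hU hv hx) (mdifferentiableAt_of_contMDiffOn hW hZ hxW),
      courantBracket_snd_apply (mdifferentiableAt_of_contMDiffOn hU hu' hx)
        (mdifferentiableAt_of_contMDiffOn hU hv' hx) (mdifferentiableAt_of_contMDiffOn hW hZ hxW), e3, e4, h x hx, h' x hx,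
      Filter.EventuallyEq.mvfderiv_eq (f := fun y ↦ (v y).2 (Z y)) (g := fun y ↦ (v' y).2 (Z y))
        (hn'.mono fun y hy ↦ by simp only [hy]),
      Filter.EventuallyEq.mvfderiv_eq (f := fun y ↦ (u y).2 (Z y)) (g := fun y ↦ (u' y).2 (Z y))
        (hn.mono fun y hy ↦ by simp only [hy]),
      Filter.EventuallyEq.mvfderiv_eq (f := fun y ↦ (u y).2 (v y).1)
        (g := fun y ↦ (u' y).2 (v' y).1) (hn.mp (hn'.mono fun y hy hy' ↦ by simp only [hy, hy'])),
      Filter.EventuallyEq.mvfderiv_eq (f := fun y ↦ (v y).2 (u y).1)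
        (g := fun y ↦ (v' y).2 (u' y).1) (hn.mp (hn'.mono fun y hy hy' ↦ by simp only [hy, hy']))]
  neg_left hU hx hu hv := courantBracket_neg_left hU hx hu hv
  neg_right {U u v} hU hx hu hv := by
    rw [courantBracket_swap, courantBracket_swap u v]
    exact congrArg Neg.neg (courantBracket_neg_left hU hx hv hu)

theorem liftField_neg (D : CovariantDerivative I V (TangentSpace I : M → Type _))
    (u : ∀ x : M, GTangentSpace I x) : liftField D (-u) = -liftField D u := by
  funext γ
  exact map_neg (horizontalVerticalEquiv D γ) (u γ.proj)

theorem isLocalOddOp_liftBracket (hD : D.PreservesSmooth) (γ : CotangentBundle I M) :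
    IsLocalOddOp I (V × (V →L[ℝ] ℝ)) (B := fun y : M ↦ GTangentSpace I y) (liftBracket D γ) where
  congr {U u u' v v'} hU hx _ _ h h' := by
    have hO := (isOpen_preimage_proj (I := I) hU).mem_nhds hx
    refine congrArg (horizontalVerticalEquiv D γ).symm
      (Filter.EventuallyEq.mlieBracket_vectorField_eq ?_ ?_)
    · exact Filter.eventually_of_mem hO fun δ hδ ↦
        congrArg (horizontalVerticalEquiv D δ) (h δ.proj hδ)
    · exact Filter.eventually_of_mem hO fun δ hδ ↦
        congrArg (horizontalVerticalEquiv D δ) (h' δ.proj hδ)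
  neg_left {U u v} hU hx hu hv := by
    rw [liftBracket, liftField_neg]
    refine (congrArg (horizontalVerticalEquiv D γ).symm ((isLocalOddOp_mlieBracket γ).neg_left
      (isOpen_preimage_proj hU) hx (contMDiffOn_liftField' hD hU hu)
      (contMDiffOn_liftField' hD hU hv))).trans ?_
    exact map_neg (horizontalVerticalEquiv D γ).symm _
  neg_right {U u v} hU hx hu hv := by
    rw [liftBracket, liftField_neg]
    refine (congrArg (horizontalVerticalEquiv D γ).symm ((isLocalOddOp_mlieBracket γ).neg_right
      (isOpen_preimage_proj hU) hx (contMDiffOn_liftField' hD hU hu)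
      (contMDiffOn_liftField' hD hU hv))).trans ?_
    exact map_neg (horizontalVerticalEquiv D γ).symm _

/-- The difference between the Courant bracket and the bracket of lifts. -/
theorem courantBracket_sub_liftBracket_snd_apply (hD : D.PreservesSmooth) (hU : IsOpen U)
    {γ : CotangentBundle I M} (hγ : γ.proj ∈ U)
    (hu : ContMDiffOn I (I.prod 𝓘(ℝ, V × (V →L[ℝ] ℝ))) ∞
      (fun y ↦ TotalSpace.mk' (V × (V →L[ℝ] ℝ)) (E := fun y ↦ GTangentSpace I y) y (u y)) U)
    (hv : ContMDiffOn I (I.prod 𝓘(ℝ, V × (V →L[ℝ] ℝ))) ∞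
      (fun y ↦ TotalSpace.mk' (V × (V →L[ℝ] ℝ)) (E := fun y ↦ GTangentSpace I y) y (v y)) U)
    {Z : ∀ x : M, TangentSpace I x} (hZ : CMDiff[U] ∞ (T% Z)) :
    (courantBracket u v γ.proj).2 (Z γ.proj) - (liftBracket D γ u v).2 (Z γ.proj) =
      (v γ.proj).2 (D Z γ.proj (u γ.proj).1) - (v γ.proj).2
        (mlieBracket I (fun y ↦ (u y).1) Z γ.proj)
      - ((u γ.proj).2 (D Z γ.proj (v γ.proj).1) - (u γ.proj).2
        (mlieBracket I (fun y ↦ (v y).1) Z γ.proj))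
      + (1 / 2) * (mvfderiv I (fun y ↦ (u y).2 (v y).1) γ.proj (Z γ.proj)
          - mvfderiv I (fun y ↦ (v y).2 (u y).1) γ.proj (Z γ.proj))
      - (γ.2 (D (fun y ↦ D Z y (v y).1) γ.proj (u γ.proj).1)
          - γ.2 (D (fun y ↦ D Z y (u y).1) γ.proj (v γ.proj).1)
          - γ.2 (D Z γ.proj (mlieBracket I (fun y ↦ (u y).1) (fun y ↦ (v y).1) γ.proj))) := by
  -- The terms `X(η(Z)) - Y(ξ(Z))` occur in both brackets and cancel.
  rw [courantBracket_snd_apply (mdifferentiableAt_of_contMDiffOn hU hu hγ)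
    (mdifferentiableAt_of_contMDiffOn hU hv hγ) (mdifferentiableAt_of_contMDiffOn hU hZ hγ), liftBracket_snd_apply hD hU hγ hu hv hZ]
  rw [map_sub, map_sub]
  ring

end Brackets

/-! ### Complex sections, their pairings and the holomorphic bundle. -/

section Complexification

variable {V : Type*} [AddCommGroup V]

@[simp] theorem Complexification.re_sub (z w : Complexification V) :
    (z - w).re = z.re - w.re := rfl
@[simp] theorem Complexification.im_sub (z w : Complexification V) :
    (z - w).im = z.im - w.im := rfl
@[simp] theorem Complexification.re_neg (z : Complexification V) : (-z).re = -z.re := rfl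
@[simp] theorem Complexification.im_neg (z : Complexification V) : (-z).im = -z.im := rfl

end Complexification

section ComplexSections

variable {V : Type*} [NormedAddCommGroup V] [NormedSpace ℝ V]
  {H : Type*} [TopologicalSpace H] {I : ModelWithCorners ℝ V H}
  {M : Type*} [TopologicalSpace M] [ChartedSpace H M]

theorem IsSectionOn.mono {F : Type*} [NormedAddCommGroup F] [NormedSpace ℝ F]
    {B : M → Type*} [TopologicalSpace (TotalSpace F B)]
    [∀ x, AddCommGroup (B x)] [∀ x, Module ℝ (B x)] [∀ x, TopologicalSpace (B x)]
    [FiberBundle F B] {S : ∀ x, Submodule ℂ (Complexification (B x))} {U U' : Set M}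
    {Z : ∀ x, Complexification (B x)} (h : IsSectionOn I F S U Z) (hU : U' ⊆ U) :
    IsSectionOn I F S U' Z :=
  ⟨h.smooth_re.mono hU, h.smooth_im.mono hU, fun x hx ↦ h.mem x (hU hx)⟩

/-- Every vector of a smooth complex subbundle is the value of a local section. -/
theorem IsComplexSubbundle.exists_section {F : Type*} [NormedAddCommGroup F] [NormedSpace ℝ F]
    {B : M → Type*} [TopologicalSpace (TotalSpace F B)]
    [∀ x, AddCommGroup (B x)] [∀ x, Module ℝ (B x)] [∀ x, TopologicalSpace (B x)]
    [FiberBundle F B] [VectorBundle ℝ F B] {S : ∀ x, Submodule ℂ (Complexification (B x))}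
    (hS : IsComplexSubbundle I F S) {x : M} {c : Complexification (B x)} (hc : c ∈ S x) :
    ∃ (U : Set M) (Z : ∀ x, Complexification (B x)), IsOpen U ∧ x ∈ U ∧ IsSectionOn I F S U Z ∧
      Z x = c := by
  obtain ⟨U, hU, hx, k, Z, hZ, hspan⟩ := hS x
  refine ⟨U, ?_⟩
  simp only [hU, hx, true_and]
  rw [← (hspan x hx).2] at hc
  -- The vectors that extend to sections over the domain `U` of the frame form a complex subspace.
  -- Keeping `U` fixed allows sections to be added.
  induction hc using Submodule.span_induction with
  | mem c h =>
    obtain ⟨j, rfl⟩ := h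
    exact ⟨Z j, hZ j, rfl⟩
  | zero =>
    exact ⟨fun _ ↦ 0, ⟨contMDiffOn_zeroSection _ _, contMDiffOn_zeroSection _ _,
      fun y _ ↦ (S y).zero_mem⟩, rfl⟩
  | add c c' _ _ h h' =>
    obtain ⟨Z, hZ, rfl⟩ := h
    obtain ⟨Z', hZ', rfl⟩ := h'
    exact ⟨fun y ↦ Z y + Z' y, ⟨hZ.smooth_re.add_section hZ'.smooth_re,
      hZ.smooth_im.add_section hZ'.smooth_im,
      fun y hy ↦ (S y).add_mem (hZ.mem y hy) (hZ'.mem y hy)⟩, rfl⟩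
  | smul a c _ h =>
    obtain ⟨Z, hZ, rfl⟩ := h
    exact ⟨fun y ↦ a • Z y, ⟨(hZ.smooth_re.const_smul_section (a := a.re)).sub_section
      (hZ.smooth_im.const_smul_section (a := a.im)),
      (hZ.smooth_im.const_smul_section (a := a.re)).add_section
      (hZ.smooth_re.const_smul_section (a := a.im)),
      fun y hy ↦ (S y).smul_mem a (hZ.mem y hy)⟩, rfl⟩

theorem mvfderiv_complex {x : M} {a b : M → ℝ} (ha : MDiffAt a x) (hb : MDiffAt b x)
    (w : TangentSpace I x) :
    mvfderiv I (fun y ↦ (⟨a y, b y⟩ : ℂ)) x w = ⟨mvfderiv I a x w, mvfderiv I b x w⟩ := by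
  have h1 : MDifferentiableAt I 𝓘(ℝ, ℂ) (fun y ↦ (⟨a y, b y⟩ : ℂ)) x :=
    Complex.equivRealProdCLM.symm.mdifferentiableAt.comp x (ha.prodMk_space hb)
  obtain ⟨A, hA⟩ : ∃ A : V →L[ℝ] ℂ, HasMFDerivAt I 𝓘(ℝ, ℂ) (fun y ↦ (⟨a y, b y⟩ : ℂ)) x A :=
    ⟨_, h1.hasMFDerivAt⟩
  have hre : mfderiv I 𝓘(ℝ, ℝ) a x = Complex.reCLM.comp A :=
    (Complex.reCLM.hasMFDerivAt.comp x hA).mfderiv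
  have him : mfderiv I 𝓘(ℝ, ℝ) b x = Complex.imCLM.comp A :=
    (Complex.imCLM.hasMFDerivAt.comp x hA).mfderiv
  have e1 : mvfderiv I (fun y ↦ (⟨a y, b y⟩ : ℂ)) x w = A w := DFunLike.congr_fun hA.mfderiv w
  have e2 : mvfderiv I a x w = (A w).re := DFunLike.congr_fun hre w
  have e3 : mvfderiv I b x w = (A w).im := DFunLike.congr_fun him w
  rw [e1, e2, e3]

end ComplexSections

section Linear

variable {V : Type*} [NormedAddCommGroup V] [NormedSpace ℝ V]
  {H : Type*} [TopologicalSpace H] {I : ModelWithCorners ℝ V H}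
  {M : Type*} [TopologicalSpace M] [ChartedSpace H M]

theorem cxFormApply_sub {x : M} (u : Complexification (GTangentSpace I x)) (Y Z : CxTangent I x) :
    cxFormApply u (Y - Z) = cxFormApply u Y - cxFormApply u Z := by
  apply Complex.ext
  · simp only [cxFormApply, re_sub, im_sub, map_sub, Complex.sub_re]
    ring
  · simp only [cxFormApply, re_sub, im_sub, map_sub, Complex.sub_im]
    ring

theorem cxFormApply_neg {x : M} (u : Complexification (GTangentSpace I x)) (Y : CxTangent I x) :
    cxFormApply u (-Y) = -cxFormApply u Y := by
  apply Complex.ext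
  · simp only [cxFormApply, re_neg, im_neg, map_neg, Complex.neg_re]
    ring
  · simp only [cxFormApply, re_neg, im_neg, map_neg, Complex.neg_im]
    ring

/-- Membership in `L(E, α)` sees only the vector part and the restriction of the form part to `E`;
this is why the two brackets need to agree on `E` only. -/
theorem mem_holomorphicSpace_congr {x : M} {E : Submodule ℂ (CxTangent I x)}
    {α : E →ₗ[ℂ] E →ₗ[ℂ] ℂ} {a b : Complexification (GTangentSpace I x)}
    (h : cxVector a = cxVector b) (h' : ∀ Y ∈ E, cxFormApply a Y = cxFormApply b Y) :
    a ∈ holomorphicSpace E α ↔ b ∈ holomorphicSpace E α := by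
  simp only [holomorphicSpace, Set.mem_ofPred_eq]
  constructor
  · rintro ⟨h1, h2⟩
    refine ⟨h ▸ h1, fun Y ↦ ?_⟩
    rw [← h' Y Y.2, h2 Y]
    simp only [h]
  · rintro ⟨h1, h2⟩
    refine ⟨h ▸ h1, fun Y ↦ ?_⟩
    rw [h' Y Y.2, h2 Y]
    simp only [h]

/-- The `i`-eigenbundle of a skew-symmetric structure is isotropic: `i g(u, v) = g(𝒥u, v) = -g(u,
𝒥v) = -i g(u, v)`. The real and imaginary parts are treated separately. -/
theorem GeneralizedComplexStructure.IsSkewSymmetric.cxFormApply_add_eq_zero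
    [IsManifold I 1 M] {J : GeneralizedComplexStructure I M} (hJ : J.IsSkewSymmetric) {x : M}
    {u v : Complexification (GTangentSpace I x)} (hu : u ∈ J.holomorphicBundle x)
    (hv : v ∈ J.holomorphicBundle x) :
    cxFormApply u (cxVector v) + cxFormApply v (cxVector u) = 0 := by
  have hJJ : ∀ w, (J.toFun x : GTangentSpace I x →ₗ[ℝ] GTangentSpace I x)
      ((J.toFun x : GTangentSpace I x →ₗ[ℝ] GTangentSpace I x) w) = -w := J.sq x
  have hu' : u.im = -J.toFun x u.re := (mem_iEigenspace_iff hJJ u).1 hu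
  have hv' : v.im = -J.toFun x v.re := (mem_iEigenspace_iff hJJ v).1 hv
  have h1 := hJ x u.re (J.toFun x v.re)
  rw [J.sq] at h1
  have h2 := hJ x u.re v.re
  simp only [gCan] at h1 h2
  apply Complex.ext
  · simp only [cxFormApply, cxVector, hu', hv', Complex.add_re, Complex.zero_re, Prod.fst_neg,
      Prod.snd_neg, neg_apply, map_neg] at h1 ⊢
    linear_combination (-2) * h1
  · simp only [cxFormApply, cxVector, hu', hv', Complex.add_im, Complex.zero_im, Prod.fst_neg,
      Prod.snd_neg, neg_apply, map_neg] at h2 ⊢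
    linear_combination (-2) * h2

variable [FiniteDimensional ℝ V]

/-- Every complex linear form on a subspace of the complexified tangent space is the restriction of
the form part of a complex generalized tangent vector with prescribed vector part. -/
theorem exists_cxFormApply_eq {x : M} {E : Submodule ℂ (CxTangent I x)} (X : CxTangent I x)
    (φ : E →ₗ[ℂ] ℂ) : ∃ u : Complexification (GTangentSpace I x), cxVector u = X ∧
      ∀ Y : E, cxFormApply u (Y : CxTangent I x) = φ Y := by
  -- A complex linear extension of the form to the whole complexified tangent space is determined by
  -- its values on real vectors, whose real and imaginary parts are the covectors `a` and `b` below.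
  obtain ⟨ψ, hψ⟩ := φ.exists_extend
  have : FiniteDimensional ℝ (TangentSpace I x) := inferInstanceAs (FiniteDimensional ℝ V)
  have : T2Space (TangentSpace I x) := inferInstanceAs (T2Space V)
  have hadd : ∀ v w : TangentSpace I x, (⟨v + w, 0⟩ : CxTangent I x) = ⟨v, 0⟩ + ⟨w, 0⟩ :=
    fun v w ↦ by ext <;> simp
  have hsmul : ∀ (c : ℝ) (v : TangentSpace I x),
      (⟨c • v, 0⟩ : CxTangent I x) = (c : ℂ) • ⟨v, 0⟩ := fun c v ↦ by
    ext <;> simp only [re_smul, im_smul, Complex.ofReal_re, Complex.ofReal_im, zero_smul, sub_zero,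
      smul_zero, add_zero]
  let a : CotangentSpace I x := LinearMap.toContinuousLinearMap
    { toFun := fun v ↦ (ψ ⟨v, 0⟩).re
      map_add' := fun v w ↦ by rw [hadd, map_add, Complex.add_re]
      map_smul' := fun c v ↦ by rw [hsmul, map_smul]; simp }
  let b : CotangentSpace I x := LinearMap.toContinuousLinearMap
    { toFun := fun v ↦ (ψ ⟨v, 0⟩).im
      map_add' := fun v w ↦ by rw [hadd, map_add, Complex.add_im]
      map_smul' := fun c v ↦ by rw [hsmul, map_smul]; simp }
  refine ⟨⟨(X.re, a), (X.im, b)⟩, rfl, fun Y ↦ ?_⟩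
  have h1 : (Y : CxTangent I x) = ⟨(Y : CxTangent I x).re, 0⟩
      + Complex.I • ⟨(Y : CxTangent I x).im, 0⟩ := by ext <;> simp
  have h2 : φ Y = ψ Y := (DFunLike.congr_fun hψ Y).symm
  rw [h2, h1, map_add, map_smul]
  apply Complex.ext
  · simp [cxFormApply, a, b]
    ring
  · simp [cxFormApply, a, b]
    ring

/-- For skew-symmetric `𝒥` with holomorphic bundle `L(E, α)` the form `α` is skew-symmetric. -/
theorem GeneralizedComplexStructure.IsSkewSymmetric.form_skew
    [IsManifold I 1 M] {J : GeneralizedComplexStructure I M} (hJ : J.IsSkewSymmetric) {x : M}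
    {E : Submodule ℂ (CxTangent I x)} {α : E →ₗ[ℂ] E →ₗ[ℂ] ℂ}
    (hL : (J.holomorphicBundle x : Set (Complexification (GTangentSpace I x))) =
      holomorphicSpace E α) (A B : E) : α A B = -α B A := by
  -- The vectors `A` and `B` are completed to elements of `L` by extending `α(A, ·)` and `α(B, ·)`;
  -- isotropy of `L` then is the skew-symmetry of `α`.
  obtain ⟨u, hu, hu'⟩ := exists_cxFormApply_eq (A : CxTangent I x) (α A)
  obtain ⟨v, hv, hv'⟩ := exists_cxFormApply_eq (B : CxTangent I x) (α B)
  have h1 : u ∈ J.holomorphicBundle x := by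
    refine (Set.ext_iff.1 hL u).2 ⟨by rw [hu]; exact A.2, fun Y ↦ ?_⟩
    rw [hu' Y]
    congr 2
    exact Subtype.ext hu.symm
  have h2 : v ∈ J.holomorphicBundle x := by
    refine (Set.ext_iff.1 hL v).2 ⟨by rw [hv]; exact B.2, fun Y ↦ ?_⟩
    rw [hv' Y]
    congr 2
    exact Subtype.ext hv.symm
  have h3 := hJ.cxFormApply_add_eq_zero h1 h2
  rw [hu, hv, hu' B, hv' A] at h3
  exact eq_neg_of_add_eq_zero_left h3

end Linear

/-! ### Complex linear extensions of the bracket and of the connection. -/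

section LieBracket

variable {V : Type*} [NormedAddCommGroup V] [NormedSpace ℝ V]
  {H : Type*} [TopologicalSpace H] {I : ModelWithCorners ℝ V H}
  {M : Type*} [TopologicalSpace M] [ChartedSpace H M]

theorem cxLieBracket_swap (X Y : ∀ x : M, CxTangent I x) (x : M) :
    cxLieBracket X Y x = -cxLieBracket Y X x := by
  apply Complexification.ext
  · simp only [cxLieBracket, cxExtend, re_neg]
    rw [mlieBracket_swap_apply, mlieBracket_swap_apply (V := fun y ↦ (X y).im)]
    abel
  · simp only [cxLieBracket, cxExtend, im_neg]
    rw [mlieBracket_swap_apply, mlieBracket_swap_apply (V := fun y ↦ (X y).im)]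
    abel

end LieBracket

section Connection

variable {V : Type*} [NormedAddCommGroup V] [NormedSpace ℝ V]
  {H : Type*} [TopologicalSpace H] {I : ModelWithCorners ℝ V H}
  {M : Type*} [TopologicalSpace M] [ChartedSpace H M] [IsManifold I ∞ M] {U : Set M}

theorem CovariantDerivative.add_apply_of_smooth
    (D : CovariantDerivative I V (TangentSpace I : M → Type _)) (hU : IsOpen U)
    {A B : ∀ x : M, TangentSpace I x} (hA : CMDiff[U] ∞ (T% A)) (hB : CMDiff[U] ∞ (T% B))
    {x : M} (hx : x ∈ U) : D (fun y ↦ A y + B y) x = D A x + D B x :=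
  D.isCovariantDerivativeOnUniv.add (mdifferentiableAt_of_contMDiffOn hU hA hx)
    (mdifferentiableAt_of_contMDiffOn hU hB hx)

theorem CovariantDerivative.sub_apply_of_smooth
    (D : CovariantDerivative I V (TangentSpace I : M → Type _)) (hU : IsOpen U)
    {A B : ∀ x : M, TangentSpace I x} (hA : CMDiff[U] ∞ (T% A)) (hB : CMDiff[U] ∞ (T% B))
    {x : M} (hx : x ∈ U) : D (fun y ↦ A y - B y) x = D A x - D B x := by
  have h : D (fun y ↦ (A - B) y + B y) x = D (fun y ↦ A y - B y) x + D B x :=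
    D.add_apply_of_smooth hU (hA.sub_section hB) hB hx
  rw [eq_sub_iff_add_eq, ← h]
  congr 1
  funext y
  exact sub_add_cancel (A y) (B y)

variable {D : CovariantDerivative I V (TangentSpace I : M → Type _)}

/-- A complex vector field is smooth over `U` if its real and imaginary parts are. -/
structure IsSmoothCxField (U : Set M) (X : ∀ x : M, CxTangent I x) : Prop where
  re : CMDiff[U] ∞ (T% (fun y ↦ (X y).re))
  im : CMDiff[U] ∞ (T% (fun y ↦ (X y).im))

theorem cxConnection_cxConnection (hD : D.PreservesSmooth) (hU : IsOpen U)
    {X Y S : ∀ x : M, CxTangent I x} (hY : IsSmoothCxField U Y) (hS : IsSmoothCxField U S)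
    {x : M} (hx : x ∈ U) :
    cxConnection D X (cxConnection D Y S) x =
      ⟨D (fun y ↦ D (fun y ↦ (S y).re) y (Y y).re) x (X x).re
        - D (fun y ↦ D (fun y ↦ (S y).im) y (Y y).im) x (X x).re
        - (D (fun y ↦ D (fun y ↦ (S y).im) y (Y y).re) x (X x).im
        + D (fun y ↦ D (fun y ↦ (S y).re) y (Y y).im) x (X x).im),
      D (fun y ↦ D (fun y ↦ (S y).im) y (Y y).re) x (X x).re
        + D (fun y ↦ D (fun y ↦ (S y).re) y (Y y).im) x (X x).re
        + (D (fun y ↦ D (fun y ↦ (S y).re) y (Y y).re) x (X x).im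
        - D (fun y ↦ D (fun y ↦ (S y).im) y (Y y).im) x (X x).im)⟩ := by
  have e1 := D.sub_apply_of_smooth hU (hD _ _ _ hU hY.re hS.re) (hD _ _ _ hU hY.im hS.im) hx
  have e2 := D.add_apply_of_smooth hU (hD _ _ _ hU hY.re hS.im) (hD _ _ _ hU hY.im hS.re) hx
  simp only [cxConnection, cxExtend, e1, e2, sub_apply, add_apply]

end Connection

/-! ### The two brackets on sections of `L(E, α)`, and the first equivalence. -/

section Comparison

variable {V : Type*} [NormedAddCommGroup V] [NormedSpace ℝ V] [FiniteDimensional ℝ V]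
  {H : Type*} [TopologicalSpace H] {I : ModelWithCorners ℝ V H}
  {M : Type*} [TopologicalSpace M] [ChartedSpace H M] [IsManifold I ∞ M]
  {D : CovariantDerivative I V (TangentSpace I : M → Type _)} {U : Set M}

theorem cxTorsion_eq (hU : IsOpen U) {X Y : ∀ x : M, CxTangent I x}
    (hX : IsSmoothCxField U X) (hY : IsSmoothCxField U Y) {x : M} (hx : x ∈ U) :
    cxTorsion D X Y x = cxConnection D X Y x - cxConnection D Y X x - cxLieBracket X Y x := by
  have h1 := mdifferentiableAt_of_contMDiffOn hU hX.re hx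
  have h2 := mdifferentiableAt_of_contMDiffOn hU hX.im hx
  have h3 := mdifferentiableAt_of_contMDiffOn hU hY.re hx
  have h4 := mdifferentiableAt_of_contMDiffOn hU hY.im hx
  apply Complexification.ext
  · simp only [cxTorsion, cxConnection, cxLieBracket, cxExtend, D.torsion_apply h1 h3,
      D.torsion_apply h2 h4, re_sub]
    abel
  · simp only [cxTorsion, cxConnection, cxLieBracket, cxExtend, D.torsion_apply h1 h4,
      D.torsion_apply h2 h3, im_sub]
    abel

variable {E : ∀ x : M, Submodule ℂ (CxTangent I x)} {α : ∀ x : M, E x →ₗ[ℂ] E x →ₗ[ℂ] ℂ}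
  {J : GeneralizedComplexStructure I M} {u v : ∀ x : M, Complexification (GTangentSpace I x)}
  {S : ∀ x : M, CxTangent I x}

/-- The difference of the form parts of the Courant bracket and the bracket of lifts, for complex
sections of an isotropic bundle. -/
theorem cxFormApply_courantBracket_sub_liftBracket (hD : D.PreservesSmooth) (hU : IsOpen U)
    {γ : CotangentBundle I M} (hγ : γ.proj ∈ U)
    (hure : ContMDiffOn I (I.prod 𝓘(ℝ, V × (V →L[ℝ] ℝ))) ∞ (fun y ↦ TotalSpace.mk'
      (V × (V →L[ℝ] ℝ)) (E := fun y ↦ GTangentSpace I y) y (u y).re) U)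
    (huim : ContMDiffOn I (I.prod 𝓘(ℝ, V × (V →L[ℝ] ℝ))) ∞ (fun y ↦ TotalSpace.mk'
      (V × (V →L[ℝ] ℝ)) (E := fun y ↦ GTangentSpace I y) y (u y).im) U)
    (hvre : ContMDiffOn I (I.prod 𝓘(ℝ, V × (V →L[ℝ] ℝ))) ∞ (fun y ↦ TotalSpace.mk'
      (V × (V →L[ℝ] ℝ)) (E := fun y ↦ GTangentSpace I y) y (v y).re) U)
    (hvim : ContMDiffOn I (I.prod 𝓘(ℝ, V × (V →L[ℝ] ℝ))) ∞ (fun y ↦ TotalSpace.mk'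
      (V × (V →L[ℝ] ℝ)) (E := fun y ↦ GTangentSpace I y) y (v y).im) U)
    (hS : IsSmoothCxField U S)
    (hiso : ∀ y ∈ U, cxFormApply (u y) (cxVector (v y)) + cxFormApply (v y) (cxVector (u y)) = 0) :
    cxFormApply (cxExtendAt (B := fun y : M ↦ GTangentSpace I y)
        (fun u v ↦ courantBracket u v γ.proj) u v) (S γ.proj)
      - cxFormApply (cxExtendAt (B := fun y : M ↦ GTangentSpace I y) (liftBracket D γ) u v)
        (S γ.proj) =
    cxFormApply (v γ.proj) (cxConnection D (fun y ↦ cxVector (u y)) S γ.proj)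
      - cxFormApply (v γ.proj) (cxLieBracket (fun y ↦ cxVector (u y)) S γ.proj)
      - cxFormApply (u γ.proj) (cxConnection D (fun y ↦ cxVector (v y)) S γ.proj)
      + cxFormApply (u γ.proj) (cxLieBracket (fun y ↦ cxVector (v y)) S γ.proj)
      + cxDeriv I (S γ.proj) (fun y ↦ cxFormApply (u y) (cxVector (v y)))
      + ⟨γ.2 (cxCurvature D (fun y ↦ cxVector (u y)) (fun y ↦ cxVector (v y)) S γ.proj).re,
        γ.2 (cxCurvature D (fun y ↦ cxVector (u y)) (fun y ↦ cxVector (v y)) S γ.proj).im⟩ := by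
  have hur := contMDiffOn_generalized_iff.1 hure
  have hui := contMDiffOn_generalized_iff.1 huim
  have hvr := contMDiffOn_generalized_iff.1 hvre
  have hvi := contMDiffOn_generalized_iff.1 hvim
  have hX : IsSmoothCxField U (fun y ↦ cxVector (u y)) := ⟨hur.1, hui.1⟩
  have hY : IsSmoothCxField U (fun y ↦ cxVector (v y)) := ⟨hvr.1, hvi.1⟩
  -- One real comparison for each choice of the real or imaginary part of `u`, `v` and `S`; the last
  -- three letters of the name record the choice in this order.
  have drrr := courantBracket_sub_liftBracket_snd_apply hD hU hγ hure hvre hS.re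
  have drri := courantBracket_sub_liftBracket_snd_apply hD hU hγ hure hvre hS.im
  have drir := courantBracket_sub_liftBracket_snd_apply hD hU hγ hure hvim hS.re
  have drii := courantBracket_sub_liftBracket_snd_apply hD hU hγ hure hvim hS.im
  have dirr := courantBracket_sub_liftBracket_snd_apply hD hU hγ huim hvre hS.re
  have diri := courantBracket_sub_liftBracket_snd_apply hD hU hγ huim hvre hS.im
  have diir := courantBracket_sub_liftBracket_snd_apply hD hU hγ huim hvim hS.re
  have diii := courantBracket_sub_liftBracket_snd_apply hD hU hγ huim hvim hS.im
  have prr := mdifferentiableAt_of_contMDiffOn hU (contMDiffOn_pairing hur.2 hvr.1) hγ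
  have pri := mdifferentiableAt_of_contMDiffOn hU (contMDiffOn_pairing hur.2 hvi.1) hγ
  have pir := mdifferentiableAt_of_contMDiffOn hU (contMDiffOn_pairing hui.2 hvr.1) hγ
  have pii := mdifferentiableAt_of_contMDiffOn hU (contMDiffOn_pairing hui.2 hvi.1) hγ
  have qrr := mdifferentiableAt_of_contMDiffOn hU (contMDiffOn_pairing hvr.2 hur.1) hγ
  have qri := mdifferentiableAt_of_contMDiffOn hU (contMDiffOn_pairing hvr.2 hui.1) hγ
  have qir := mdifferentiableAt_of_contMDiffOn hU (contMDiffOn_pairing hvi.2 hur.1) hγ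
  have qii := mdifferentiableAt_of_contMDiffOn hU (contMDiffOn_pairing hvi.2 hui.1) hγ
  -- Isotropy says `η(X) = -ξ(Y)` on `U`, so the half differential of `ξ(Y) - η(X)` becomes
  -- `d(ξ(Y))`. This is its real part, and `him` is its imaginary part.
  have hre : mvfderiv I (fun y ↦ (u y).re.2 (v y).re.1 - (u y).im.2 (v y).im.1) γ.proj =
      -mvfderiv I (fun y ↦ (v y).re.2 (u y).re.1 - (v y).im.2 (u y).im.1) γ.proj := by
    rw [← mvfderiv_neg]
    refine Filter.EventuallyEq.mvfderiv_eq (Filter.eventually_of_mem (hU.mem_nhds hγ) fun y hy ↦ ?_)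
    have h := congrArg Complex.re (hiso y hy)
    simp only [cxFormApply, cxVector, Complex.add_re, Complex.zero_re] at h
    exact eq_neg_of_add_eq_zero_left h
  have him : mvfderiv I (fun y ↦ (u y).re.2 (v y).im.1 + (u y).im.2 (v y).re.1) γ.proj =
      -mvfderiv I (fun y ↦ (v y).re.2 (u y).im.1 + (v y).im.2 (u y).re.1) γ.proj := by
    rw [← mvfderiv_neg]
    refine Filter.EventuallyEq.mvfderiv_eq (Filter.eventually_of_mem (hU.mem_nhds hγ) fun y hy ↦ ?_)
    have h := congrArg Complex.im (hiso y hy)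
    simp only [cxFormApply, cxVector, Complex.add_im, Complex.zero_im] at h
    exact eq_neg_of_add_eq_zero_left h
  have sub1 : mvfderiv I (fun y ↦ (u y).re.2 (v y).re.1 - (u y).im.2 (v y).im.1) γ.proj =
    mvfderiv I (fun y ↦ (u y).re.2 (v y).re.1) γ.proj
      - mvfderiv I (fun y ↦ (u y).im.2 (v y).im.1) γ.proj := mvfderiv_sub prr pii
  have sub2 : mvfderiv I (fun y ↦ (v y).re.2 (u y).re.1 - (v y).im.2 (u y).im.1) γ.proj =
    mvfderiv I (fun y ↦ (v y).re.2 (u y).re.1) γ.proj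
      - mvfderiv I (fun y ↦ (v y).im.2 (u y).im.1) γ.proj := mvfderiv_sub qrr qii
  have add1 : mvfderiv I (fun y ↦ (u y).re.2 (v y).im.1 + (u y).im.2 (v y).re.1) γ.proj =
    mvfderiv I (fun y ↦ (u y).re.2 (v y).im.1) γ.proj
      + mvfderiv I (fun y ↦ (u y).im.2 (v y).re.1) γ.proj := mvfderiv_add pri pir
  have add2 : mvfderiv I (fun y ↦ (v y).re.2 (u y).im.1 + (v y).im.2 (u y).re.1) γ.proj =
    mvfderiv I (fun y ↦ (v y).re.2 (u y).im.1) γ.proj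
      + mvfderiv I (fun y ↦ (v y).im.2 (u y).re.1) γ.proj := mvfderiv_add qri qir
  have hder : cxDeriv I (S γ.proj) (fun y ↦ cxFormApply (u y) (cxVector (v y))) =
      ⟨mvfderiv I (fun y ↦ (u y).re.2 (v y).re.1) γ.proj (S γ.proj).re
        - mvfderiv I (fun y ↦ (u y).im.2 (v y).im.1) γ.proj (S γ.proj).re
        - (mvfderiv I (fun y ↦ (u y).re.2 (v y).im.1) γ.proj (S γ.proj).im
        + mvfderiv I (fun y ↦ (u y).im.2 (v y).re.1) γ.proj (S γ.proj).im),
      mvfderiv I (fun y ↦ (u y).re.2 (v y).im.1) γ.proj (S γ.proj).re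
        + mvfderiv I (fun y ↦ (u y).im.2 (v y).re.1) γ.proj (S γ.proj).re
        + (mvfderiv I (fun y ↦ (u y).re.2 (v y).re.1) γ.proj (S γ.proj).im
        - mvfderiv I (fun y ↦ (u y).im.2 (v y).im.1) γ.proj (S γ.proj).im)⟩ := by
    have h : ∀ w : TangentSpace I γ.proj, mvfderiv I
        (fun y ↦ cxFormApply (u y) (cxVector (v y))) γ.proj w =
        ⟨mvfderiv I (fun y ↦ (u y).re.2 (v y).re.1) γ.proj w
          - mvfderiv I (fun y ↦ (u y).im.2 (v y).im.1) γ.proj w,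
        mvfderiv I (fun y ↦ (u y).re.2 (v y).im.1) γ.proj w
          + mvfderiv I (fun y ↦ (u y).im.2 (v y).re.1) γ.proj w⟩ := by
      intro w
      refine (mvfderiv_complex (prr.sub pii) (pri.add pir) w).trans ?_
      exact Complex.ext (DFunLike.congr_fun sub1 w) (DFunLike.congr_fun add1 w)
    rw [cxDeriv, h, h]
    apply Complex.ext
    · simp
      ring
    · simp
  have hrer := DFunLike.congr_fun hre (S γ.proj).re
  have hrei := DFunLike.congr_fun hre (S γ.proj).im
  have himr := DFunLike.congr_fun him (S γ.proj).re
  have himi := DFunLike.congr_fun him (S γ.proj).im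
  simp only [sub1, sub2, add1, add2, sub_apply, add_apply, neg_apply] at hrer hrei himr himi
  rw [hder]
  simp only [cxCurvature, cxConnection_cxConnection hD hU hY hS hγ,
    cxConnection_cxConnection hD hU hX hS hγ]
  apply Complex.ext
  · simp only [cxFormApply, cxExtendAt, cxConnection, cxLieBracket, cxExtend, cxVector,
      Complex.sub_re, Complex.add_re, re_add, re_neg, Prod.snd_sub, Prod.snd_add, sub_apply,
      add_apply, map_sub, map_add, map_neg]
    linear_combination drrr - diir - drii - diri - (1 / 2) * hrer + (1 / 2) * himi
  · simp only [cxFormApply, cxExtendAt, cxConnection, cxLieBracket, cxExtend, cxVector,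
      Complex.sub_im, Complex.add_im, im_add, im_neg, Prod.snd_sub, Prod.snd_add, sub_apply,
      add_apply, map_sub, map_add, map_neg]
    linear_combination drri - diii + drir + dirr - (1 / 2) * hrei - (1 / 2) * himr

/-- The form parts, restricted to `E`, of the complexified Courant bracket and of the complexified
bracket of lifts agree on sections of `L(E, α)`. -/
theorem cxFormApply_courantBracket_eq_liftBracket (hJ : J.IsSkewSymmetric)
    (hD : D.PreservesSmooth)
    (hL : ∀ x, (J.holomorphicBundle x : Set (Complexification (GTangentSpace I x))) =
      holomorphicSpace (E x) (α x))
    (hinv : IsInvolutive I E) (hDE : PreservesSections D E) (hR : CurvatureVanishesOn D E)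
    (hT : TorsionRelation D E α) (hU : IsOpen U) {γ : CotangentBundle I M} (hγ : γ.proj ∈ U)
    (hu : IsSectionOn I (V × (V →L[ℝ] ℝ)) J.holomorphicBundle U u)
    (hv : IsSectionOn I (V × (V →L[ℝ] ℝ)) J.holomorphicBundle U v)
    (hS : IsSectionOn I V E U S) :
    cxFormApply (cxExtendAt (B := fun y : M ↦ GTangentSpace I y)
        (fun u v ↦ courantBracket u v γ.proj) u v) (S γ.proj) =
      cxFormApply (cxExtendAt (B := fun y : M ↦ GTangentSpace I y) (liftBracket D γ) u v)
        (S γ.proj) := by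
  have hmem : ∀ {w : ∀ x : M, Complexification (GTangentSpace I x)},
      IsSectionOn I (V × (V →L[ℝ] ℝ)) J.holomorphicBundle U w → ∀ y ∈ U,
      w y ∈ holomorphicSpace (E y) (α y) := fun hw y hy ↦ by
    rw [← hL y]
    exact hw.mem y hy
  have hsec : ∀ {w : ∀ x : M, Complexification (GTangentSpace I x)},
      IsSectionOn I (V × (V →L[ℝ] ℝ)) J.holomorphicBundle U w →
      IsSectionOn I V E U (fun y ↦ cxVector (w y)) := fun {w} hw ↦
    ⟨(contMDiffOn_generalized_iff.1 hw.smooth_re).1, (contMDiffOn_generalized_iff.1 hw.smooth_im).1,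
      fun y hy ↦ (hmem hw y hy).1⟩
  have hX := hsec hu
  have hY := hsec hv
  have hX' : IsSmoothCxField U (fun y ↦ cxVector (u y)) := ⟨hX.smooth_re, hX.smooth_im⟩
  have hY' : IsSmoothCxField U (fun y ↦ cxVector (v y)) := ⟨hY.smooth_re, hY.smooth_im⟩
  have hS' : IsSmoothCxField U S := ⟨hS.smooth_re, hS.smooth_im⟩
  have eval : ∀ {w : ∀ x : M, Complexification (GTangentSpace I x)},
      IsSectionOn I (V × (V →L[ℝ] ℝ)) J.holomorphicBundle U w → ∀ y ∈ U, ∀ A ∈ E y,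
      evalOn (E y) (α y) (cxVector (w y)) A = cxFormApply (w y) A := fun {w} hw y hy A hA ↦ by
    obtain ⟨h1, h2⟩ := hmem hw y hy
    rw [evalOn, dif_pos ⟨h1, hA⟩]
    exact (h2 ⟨A, hA⟩).symm
  -- Skew-symmetry of `α` lets the form part of a section compute `α` also when its vector part
  -- stands in the second slot.
  have eval' : ∀ {w : ∀ x : M, Complexification (GTangentSpace I x)},
      IsSectionOn I (V × (V →L[ℝ] ℝ)) J.holomorphicBundle U w → ∀ y ∈ U, ∀ A ∈ E y,
      evalOn (E y) (α y) A (cxVector (w y)) = -cxFormApply (w y) A := fun {w} hw y hy A hA ↦ by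
    obtain ⟨h1, h2⟩ := hmem hw y hy
    rw [evalOn, dif_pos ⟨hA, h1⟩, hJ.form_skew (hL y)]
    exact congrArg Neg.neg (h2 ⟨A, hA⟩).symm
  have hT1 := hT U hU _ _ S hX hY hS γ.proj hγ
  -- Since `evalOn` is zero off `E`, each argument in the torsion relation must be shown to lie in
  -- `E`: covariant derivatives by preservation, brackets by involutivity, torsion by both.
  have hSX : cxConnection D S (fun y ↦ cxVector (u y)) γ.proj ∈ E γ.proj :=
    hDE U hU _ _ hS hX _ hγ
  have hXS : cxConnection D (fun y ↦ cxVector (u y)) S γ.proj ∈ E γ.proj :=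
    hDE U hU _ _ hX hS _ hγ
  have hSY : cxConnection D S (fun y ↦ cxVector (v y)) γ.proj ∈ E γ.proj :=
    hDE U hU _ _ hS hY _ hγ
  have hYS : cxConnection D (fun y ↦ cxVector (v y)) S γ.proj ∈ E γ.proj :=
    hDE U hU _ _ hY hS _ hγ
  have hbX : cxLieBracket S (fun y ↦ cxVector (u y)) γ.proj ∈ E γ.proj :=
    hinv U hU _ _ hS hX _ hγ
  have hbY : cxLieBracket S (fun y ↦ cxVector (v y)) γ.proj ∈ E γ.proj :=
    hinv U hU _ _ hS hY _ hγ
  have hTX : cxTorsion D S (fun y ↦ cxVector (u y)) γ.proj ∈ E γ.proj := by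
    rw [cxTorsion_eq hU hS' hX' hγ]
    exact sub_mem (sub_mem hSX hXS) hbX
  have hTY : cxTorsion D S (fun y ↦ cxVector (v y)) γ.proj ∈ E γ.proj := by
    rw [cxTorsion_eq hU hS' hY' hγ]
    exact sub_mem (sub_mem hSY hYS) hbY
  have hder : ∀ w : TangentSpace I γ.proj,
      mvfderiv I (fun y ↦ evalOn (E y) (α y) (cxVector (u y)) (cxVector (v y))) γ.proj w =
        mvfderiv I (fun y ↦ cxFormApply (u y) (cxVector (v y))) γ.proj w := fun w ↦
    DFunLike.congr_fun (Filter.EventuallyEq.mvfderiv_eq (Filter.eventually_of_mem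
      (hU.mem_nhds hγ) fun y hy ↦ eval hu y hy _ (hmem hv y hy).1)) w
  -- With `T_S X = D_S X - D_X S - [S, X]`, and likewise for `Y`, the terms with `D_S` cancel. What
  -- remains in the torsion relation is the difference of the brackets without its curvature term.
  rw [eval' hv _ hγ _ hSX, eval hu _ hγ _ hSY, eval' hv _ hγ _ hTX, eval hu _ hγ _ hTY,
    cxTorsion_eq hU hS' hX' hγ, cxTorsion_eq hU hS' hY' hγ, cxDeriv, hder, hder, ← cxDeriv,
    cxFormApply_sub, cxFormApply_sub, cxFormApply_sub, cxFormApply_sub,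
    cxLieBracket_swap S, cxLieBracket_swap S, cxFormApply_neg, cxFormApply_neg] at hT1
  have h := cxFormApply_courantBracket_sub_liftBracket hD hU hγ hu.smooth_re hu.smooth_im
    hv.smooth_re hv.smooth_im hS'
    (fun y hy ↦ hJ.cxFormApply_add_eq_zero (hu.mem y hy) (hv.mem y hy))
  have hz : (⟨γ.2 (0 : CxTangent I γ.proj).re, γ.2 (0 : CxTangent I γ.proj).im⟩ : ℂ) = 0 := by
    simp only [re_zero, im_zero, map_zero]
    rfl
  rw [hR U hU _ _ S hX hY hS _ hγ, hz] at h
  linear_combination h + hT1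

/-- The vector parts of both brackets are the same Lie bracket, and the form parts agree on `E`
because every vector of `E` extends to a local section. The equivalence holds for each `γ`
separately. -/
theorem cxExtendAt_courantBracket_mem_iff (hJ : J.IsSkewSymmetric)
    (hD : D.PreservesSmooth) (hE : IsComplexSubbundle I V E)
    (hL : ∀ x, (J.holomorphicBundle x : Set (Complexification (GTangentSpace I x))) =
      holomorphicSpace (E x) (α x))
    (hinv : IsInvolutive I E) (hDE : PreservesSections D E) (hR : CurvatureVanishesOn D E)
    (hT : TorsionRelation D E α) (hU : IsOpen U) {γ : CotangentBundle I M} (hγ : γ.proj ∈ U)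
    (hu : IsSectionOn I (V × (V →L[ℝ] ℝ)) J.holomorphicBundle U u)
    (hv : IsSectionOn I (V × (V →L[ℝ] ℝ)) J.holomorphicBundle U v) :
    cxExtendAt (B := fun y : M ↦ GTangentSpace I y) (fun u v ↦ courantBracket u v γ.proj) u v ∈
      J.holomorphicBundle γ.proj ↔
    cxExtendAt (B := fun y : M ↦ GTangentSpace I y) (liftBracket D γ) u v ∈
      J.holomorphicBundle γ.proj := by
  rw [← SetLike.mem_coe, ← SetLike.mem_coe, hL]
  apply mem_holomorphicSpace_congr
  · have e1 := liftBracket_fst hD hU hγ hu.smooth_re hv.smooth_re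
    have e2 := liftBracket_fst hD hU hγ hu.smooth_im hv.smooth_im
    have e3 := liftBracket_fst hD hU hγ hu.smooth_re hv.smooth_im
    have e4 := liftBracket_fst hD hU hγ hu.smooth_im hv.smooth_re
    apply Complexification.ext
    · simp only [cxVector, cxExtendAt, Prod.fst_sub, e1, e2, courantBracket]
    · simp only [cxVector, cxExtendAt, Prod.fst_add, e3, e4, courantBracket]
  · intro Y hY
    obtain ⟨W, S, hW, hγW, hS, rfl⟩ := hE.exists_section hY
    exact cxFormApply_courantBracket_eq_liftBracket hJ hD hL hinv hDE hR hT (hU.inter hW)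
      ⟨hγ, hγW⟩ (hu.mono Set.inter_subset_left) (hv.mono Set.inter_subset_left)
      (hS.mono Set.inter_subset_right)

theorem isIntegrableAlmostComplex_cotangent_iff_isCourantIntegrable (hJ : J.IsSkewSymmetric)
    (hD : D.PreservesSmooth) (hE : IsComplexSubbundle I V E)
    (hL : ∀ x, (J.holomorphicBundle x : Set (Complexification (GTangentSpace I x))) =
      holomorphicSpace (E x) (α x))
    (hinv : IsInvolutive I E) (hDE : PreservesSections D E) (hR : CurvatureVanishesOn D E)
    (hT : TorsionRelation D E α) :
    IsIntegrableAlmostComplex (I.prod 𝓘(ℝ, V →L[ℝ] ℝ)) (cotangentAlmostComplex J D) ↔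
      J.IsCourantIntegrable := by
  have hJJ : ∀ x w, (J.toFun x : GTangentSpace I x →ₗ[ℝ] GTangentSpace I x)
      ((J.toFun x : GTangentSpace I x →ₗ[ℝ] GTangentSpace I x) w) = -w := J.sq
  rw [isIntegrableAlmostComplex_iff hD]
  constructor
  · intro h U hU u v hu hv x hx
    -- Any covector over `x` would serve, as the comparison holds at every point of the fibre.
    let γ : CotangentBundle I M := ⟨x, 0⟩
    refine (cxExtendAt_courantBracket_mem_iff hJ hD hE hL hinv hDE hR hT hU (γ := γ) hx hu hv).2 ?_
    exact (nijenhuis_eq_zero_iff_cxExtendAt hJJ (isLocalOddOp_liftBracket hD γ) hU hx hu hv).2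
      (h γ U _ _ hU hx hu.smooth_re hv.smooth_re)
  · intro h γ U u v hU hγ hu hv
    have hZ := isSectionOn_iEigenspace_of_smooth (I := I) hJJ hu (J.contMDiffOn_apply hu)
    have hW := isSectionOn_iEigenspace_of_smooth (I := I) hJJ hv (J.contMDiffOn_apply hv)
    refine (nijenhuis_eq_zero_iff_cxExtendAt hJJ (isLocalOddOp_liftBracket hD γ) hU hγ hZ hW).1 ?_
    exact (cxExtendAt_courantBracket_mem_iff hJ hD hE hL hinv hDE hR hT hU hγ hZ hW).1
      (h U hU _ _ hZ hW _ hγ)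

end Comparison

/-! ### Smoothness of one-forms, tested on a frame. -/

section OneFormFrame

variable {V : Type*} [NormedAddCommGroup V] [NormedSpace ℝ V] [FiniteDimensional ℝ V]
  {H : Type*} [TopologicalSpace H] {I : ModelWithCorners ℝ V H}
  {M : Type*} [TopologicalSpace M] [ChartedSpace H M] [IsManifold I ∞ M]

/-- A one-form is smooth if its values on a smooth frame are. -/
theorem contMDiffAt_oneForm_of_frame {ι : Type*} [Fintype ι] {s : ι → ∀ x : M, TangentSpace I x}
    {U : Set M} (hs : IsLocalFrameOn I V ∞ s U) (hU : IsOpen U) {x : M} (hx : x ∈ U)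
    {η : ∀ x : M, CotangentSpace I x} (hη : ∀ i, CMDiffAt ∞ (fun y ↦ η y (s i y)) x) :
    ContMDiffAt I (I.prod 𝓘(ℝ, V →L[ℝ] ℝ)) ∞
      (fun y ↦ TotalSpace.mk' (V →L[ℝ] ℝ) (E := CotangentSpace I) y (η y)) x := by
  obtain ⟨T, hT, h⟩ := hs.exists_coeff_eq hU hx
  set e := trivializationAt V (TangentSpace I : M → Type _) x
  have hxe : x ∈ e.baseSet := FiberBundle.mem_baseSet_trivializationAt' x
  refine (contMDiffAt_section x).2 ?_
  -- The one-form is the sum of its values on the frame times the coefficient functionals, which the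
  -- smooth family `T` represents in the trivialization.
  have h1 : CMDiffAt ∞ (fun y ↦ ∑ i, η y (s i y) •
      (ContinuousLinearMap.proj (R := ℝ) (φ := fun _ : ι ↦ ℝ) i).comp (T y)) x := by
    refine contMDiffAt_finsetSum fun i _ ↦ ?_
    exact (hη i).smul (contMDiffAt_const.clm_comp hT)
  refine h1.congr_of_eventuallyEq ?_
  filter_upwards [h, e.open_baseSet.mem_nhds hxe, hU.mem_nhds hx] with y hy hye hyU
  ext f
  have h2 : ((trivializationAt (V →L[ℝ] ℝ) (fun x : M ↦ CotangentSpace I x) x)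
      ⟨y, η y⟩).2 f = η y (e.symmL ℝ y f) := by
    rw [hom_trivializationAt_apply]
    simp [ContinuousLinearMap.inCoordinates]
    rfl
  have h3 : T y f = fun i ↦ hs.coeff i y (e.symmL ℝ y f) := by
    rw [← hy, e.symmL_apply (R := ℝ) hye, e.apply_mk_symm hye]
  have h4 : e.symmL ℝ y f = ∑ i, hs.coeff i y (e.symmL ℝ y f) • s i y := by
    simpa using hs.coeff_sum_eq (FiberBundle.extend V (e.symmL ℝ y f)) hyU
  refine h2.trans ?_
  rw [h4, map_sum]
  simp [h3, mul_comm]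

end OneFormFrame

/-! ### Left-invariant frames and sections, and the connection `D^c`. -/

section LieGroupFrames

variable {V : Type*} [NormedAddCommGroup V] [NormedSpace ℝ V]
  {H : Type*} [TopologicalSpace H] {I : ModelWithCorners ℝ V H}
  {G : Type*} [TopologicalSpace G] [ChartedSpace H G] [Group G] [LieGroup I ∞ G]

/-- Left-invariant vector fields are smooth. -/
theorem contMDiff_infty_mulInvariantVectorField (v : GroupLieAlgebra I G) :
    CMDiff ∞ (fun g : G ↦ (mulInvariantVectorField v g : TangentBundle I G)) := by
  -- The value at `g` is the differential of the multiplication at `(g, 1)` applied to `(0, v)`,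
  -- which exhibits the field as a composition of smooth maps.
  let fg : G → TangentBundle I G := fun g ↦ TotalSpace.mk' V g 0
  have sfg : CMDiff ∞ fg := contMDiff_zeroSection _ _
  let fv : G → TangentBundle I G := fun _ ↦ TotalSpace.mk' V 1 v
  have sfv : CMDiff ∞ fv := contMDiff_const
  let F₁ : G → (TangentBundle I G × TangentBundle I G) := fun g ↦ (fg g, fv g)
  have S₁ : CMDiff ∞ F₁ := sfg.prodMk sfv
  let F₂ : (TangentBundle I G × TangentBundle I G) → TangentBundle (I.prod I) (G × G) :=
    (equivTangentBundleProd I G I G).symm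
  have S₂ : CMDiff ∞ F₂ := contMDiff_equivTangentBundleProd_symm
  let F₃ : TangentBundle (I.prod I) (G × G) → TangentBundle I G :=
    tangentMap% (fun (p : G × G) ↦ p.1 * p.2)
  have S₃ : CMDiff ∞ F₃ := by
    apply ContMDiff.contMDiff_tangentMap _ (m := ∞) le_rfl
    exact contMDiff_mul I ∞
  let S := (S₃.comp S₂).comp S₁
  convert! S with g
  · simp [F₁, F₂, F₃, fg, fv]
  · simp only [Function.comp_apply, tangentMap, F₃, F₂, F₁, fg, fv]
    rw [mfderiv_prod_eq_add_apply ((contMDiff_mul I ∞).mdifferentiableAt (by simp))]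
    exact (zero_add _).symm.trans (congrArg₂ (fun a b : V ↦ a + b)
      (ContinuousLinearMap.map_zero _).symm rfl)

/-- Evaluation at `g` of left-invariant fields is inverse to `leftTrivialize g`, so independence and
generation come from the basis of the Lie algebra. -/
theorem isLocalFrameOn_mulInvariantVectorField {ι : Type*} (b : Module.Basis ι ℝ (GroupLieAlgebra I G)) :
    IsLocalFrameOn I V ∞ (fun i ↦ (mulInvariantVectorField (b i) : ∀ g : G, TangentSpace I g))
      Set.univ where
  linearIndependent {g} _ := by
    refine LinearIndependent.of_comp (leftTrivialize g).toLinearMap ?_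
    have h : (leftTrivialize g).toLinearMap ∘ (fun i ↦ mulInvariantVectorField (b i) g) = b :=
      funext fun i ↦ leftTrivialize_mulInvariantVectorField g (b i)
    rw [h]
    exact b.linearIndependent
  generating {g} _ v _ := by
    have h : leftTrivialize g v ∈ Submodule.span ℝ (Set.range b) := by
      rw [b.span_eq]
      trivial
    rw [← mulInvariantVectorField_leftTrivialize g v]
    generalize leftTrivialize g v = w at h ⊢
    induction h using Submodule.span_induction with
    | mem w hw =>
      obtain ⟨i, rfl⟩ := hw
      exact Submodule.subset_span ⟨i, rfl⟩
    | zero =>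
      have h0 : mulInvariantVectorField (0 : GroupLieAlgebra I G) g = 0 :=
        (mfderiv I I (fun k ↦ g * k) (1 : G)).map_zero
      rw [h0]
      exact zero_mem _
    | add w w' _ _ h h' =>
      rw [mulInvariantVectorField_add]
      exact add_mem h h'
    | smul c w _ h =>
      rw [mulInvariantVectorField_smul]
      exact Submodule.smul_mem _ c h
  contMDiffOn i := (contMDiff_infty_mulInvariantVectorField (b i)).contMDiffOn

/-- The left-invariant section of `TG ⊕ T*G` with the value `w` at the identity. -/
def leftInvariantSection (w : GTangentSpace I (1 : G)) (g : G) : GTangentSpace I g :=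
  (mulInvariantVectorField (w.1 : GroupLieAlgebra I G) g, w.2.comp (leftTrivialize g))

/-- There is a left-invariant section through every vector. -/
theorem exists_leftInvariantSection_eq {g : G} (c : GTangentSpace I g) :
    ∃ w : GTangentSpace I (1 : G), leftInvariantSection w g = c := by
  let A : GroupLieAlgebra I G →L[ℝ] TangentSpace I g :=
    (mfderiv I I (fun k ↦ g * k) (1 : G) : V →L[ℝ] V)
  refine ⟨(leftTrivialize g c.1, c.2.comp A), Prod.ext
    (mulInvariantVectorField_leftTrivialize g c.1) ?_⟩
  ext v
  exact congrArg c.2 (mulInvariantVectorField_leftTrivialize g v)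

theorem GeneralizedComplexStructure.IsLeftInvariant.apply_leftInvariantSection
    {J : GeneralizedComplexStructure I G} (hJ : J.IsLeftInvariant) (w : GTangentSpace I (1 : G))
    (g : G) : J.toFun g (leftInvariantSection w g) = leftInvariantSection (J.toFun 1 w) g := by
  -- Invariance under translation by `g` at the identity lands in the fibre over `g * 1`.
  -- Generalizing this point and working in the model space avoids transport along `g * 1 = g`.
  have key : ∀ (p : G), g * 1 = p → ∀ (X : V) (η : V →L[ℝ] ℝ),
      let A : V →L[ℝ] V := mfderiv I I (fun k ↦ g * k) (1 : G)
      let Jp : V × (V →L[ℝ] ℝ) → V × (V →L[ℝ] ℝ) := J.toFun p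
      let J1 : V × (V →L[ℝ] ℝ) → V × (V →L[ℝ] ℝ) := J.toFun (1 : G)
      (Jp (A X, η)).1 = A (J1 (X, η.comp A)).1 ∧
        (Jp (A X, η)).2.comp A = (J1 (X, η.comp A)).2 := by
    rintro p rfl X η
    exact hJ g 1 X η
  let B : V →L[ℝ] V := (leftTrivialize g : TangentSpace I g →L[ℝ] GroupLieAlgebra I G)
  let A : V →L[ℝ] V := mfderiv I I (fun k ↦ g * k) (1 : G)
  have hBA : ∀ v, B (A v) = v := fun v ↦ leftTrivialize_mulInvariantVectorField (I := I) g v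
  have hAB : ∀ v, A (B v) = v := fun v ↦ mulInvariantVectorField_leftTrivialize (I := I) g v
  have h := key g (mul_one g) w.1 ((w.2 : V →L[ℝ] ℝ).comp B)
  have h2 : ((w.2 : V →L[ℝ] ℝ).comp B).comp A = w.2 := by
    ext v
    exact congrArg w.2 (hBA v)
  obtain ⟨h3, h4⟩ := h
  refine Prod.ext (h3.trans ?_) ?_
  · exact congrArg (fun z : V →L[ℝ] ℝ ↦ A ((J.toFun (1 : G)) (w.1, z)).1) h2
  · have h5 := h4.trans (congrArg (fun z : V →L[ℝ] ℝ ↦ ((J.toFun (1 : G)) (w.1, z)).2) h2)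
    ext v
    have h6 := DFunLike.congr_fun h5 (B v)
    refine Eq.trans ?_ h6
    exact (congrArg (J.toFun g (leftInvariantSection w g)).2 (hAB v)).symm

variable [FiniteDimensional ℝ V]

/-- Along a left-invariant field, `D^c` is the bracket on arbitrary fields `Y`, not only on
invariant ones. -/
theorem lieBracketConnection_apply_mulInvariantVectorField (v : GroupLieAlgebra I G)
    (Y : ∀ g : G, TangentSpace I g) (g : G) :
    lieBracketConnection Y g (mulInvariantVectorField v g) =
      mlieBracket I (mulInvariantVectorField v) Y g := by
  have h : lieBracketConnection Y g (mulInvariantVectorField v g) = mlieBracket I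
    (mulInvariantVectorField (leftTrivialize g (mulInvariantVectorField v g))) Y g := rfl
  rw [h, leftTrivialize_mulInvariantVectorField]

/-- If `X` has the coefficients `x_i` in a left-invariant frame `e_i`, then `D^c_X Y` is the sum of
the `x_i [e_i, Y]`. -/
theorem lieBracketConnection_preservesSmooth :
    (lieBracketConnection (I := I) (G := G)).PreservesSmooth := by
  intro U X Y hU hX hY
  have : FiniteDimensional ℝ (GroupLieAlgebra I G) := inferInstanceAs (FiniteDimensional ℝ V)
  set b := Module.finBasis ℝ (GroupLieAlgebra I G)
  have hs := isLocalFrameOn_mulInvariantVectorField b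
  have h1 : CMDiff[U] ∞ (T% (fun g ↦ ∑ i, hs.coeff i g (X g) •
      mlieBracket I (mulInvariantVectorField (b i)) Y g)) := by
    refine ContMDiffOn.sum_section fun i _ ↦ ?_
    refine ContMDiffOn.smul_section (fun g hg ↦ ?_) (contMDiffOn_mlieBracket hU
      (contMDiff_infty_mulInvariantVectorField (b i)).contMDiffOn hY)
    exact (hs.contMDiffAt_coeff isOpen_univ (Set.mem_univ g)
      (hX.contMDiffAt (hU.mem_nhds hg)) i).contMDiffWithinAt
  refine h1.congr fun g _ ↦ ?_
  congr 1
  conv_lhs => rw [hs.coeff_sum_eq X (Set.mem_univ g)]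
  rw [map_sum]
  refine Finset.sum_congr rfl fun i _ ↦ ?_
  rw [map_smul, lieBracketConnection_apply_mulInvariantVectorField]

/-- The covector part takes constant values on a left-invariant frame. -/
theorem contMDiff_leftInvariantSection (w : GTangentSpace I (1 : G)) (U : Set G) :
    ContMDiffOn I (I.prod 𝓘(ℝ, V × (V →L[ℝ] ℝ))) ∞
      (fun g ↦ TotalSpace.mk' (V × (V →L[ℝ] ℝ)) (E := fun g ↦ GTangentSpace I g) g
        (leftInvariantSection w g)) U := by
  refine contMDiffOn_generalized_iff.2 ⟨(contMDiff_infty_mulInvariantVectorField _).contMDiffOn, ?_⟩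
  have : FiniteDimensional ℝ (GroupLieAlgebra I G) := inferInstanceAs (FiniteDimensional ℝ V)
  set b := Module.finBasis ℝ (GroupLieAlgebra I G)
  have hs := isLocalFrameOn_mulInvariantVectorField b
  intro g _
  refine (contMDiffAt_oneForm_of_frame hs isOpen_univ (Set.mem_univ g) fun i ↦ ?_).contMDiffWithinAt
  have h : (fun y : G ↦ (leftInvariantSection w y).2 (mulInvariantVectorField (b i) y)) =
      fun _ ↦ w.2 (b i) := by
    funext y
    exact congrArg w.2 (leftTrivialize_mulInvariantVectorField y (b i))
  rw [h]
  exact contMDiffAt_const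

end LieGroupFrames

/-! ### Tensoriality of the Nijenhuis expression of the Courant bracket. -/

section CourantTensor

variable {V : Type*} [NormedAddCommGroup V] [NormedSpace ℝ V]
  {H : Type*} [TopologicalSpace H] {I : ModelWithCorners ℝ V H}
  {M : Type*} [TopologicalSpace M] [ChartedSpace H M] [IsManifold I ∞ M]

theorem GeneralizedComplexStructure.mdifferentiableAt_apply (J : GeneralizedComplexStructure I M)
    {x : M} {u : ∀ x : M, GTangentSpace I x}
    (hu : MDifferentiableAt I (I.prod 𝓘(ℝ, V × (V →L[ℝ] ℝ)))
      (fun y ↦ TotalSpace.mk' (V × (V →L[ℝ] ℝ)) (E := fun y ↦ GTangentSpace I y) y (u y)) x) :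
    MDifferentiableAt I (I.prod 𝓘(ℝ, V × (V →L[ℝ] ℝ)))
      (fun y ↦ TotalSpace.mk' (V × (V →L[ℝ] ℝ)) (E := fun y ↦ GTangentSpace I y) y
        (J.toFun y (u y))) x :=
  MDifferentiableAt.clm_bundle_apply (F₁ := V × (V →L[ℝ] ℝ)) (F₂ := V × (V →L[ℝ] ℝ))
    (E₁ := fun y : M ↦ GTangentSpace I y) (E₂ := fun y : M ↦ GTangentSpace I y)
    (J.smooth.mdifferentiableAt (by simp)) hu

variable [FiniteDimensional ℝ V] {u v w : ∀ x : M, GTangentSpace I x} {x : M}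

/-- The term `-L_{fY} ξ` contributes `-ξ(Y) df` and the exact term contributes `½ (ξ(Y) - η(X)) df`;
together they give the anomaly `-g(u, v) df` in the Leibniz rule. -/
theorem courantBracket_smul_right {f : M → ℝ} (hf : MDiffAt f x)
    (hu : MDifferentiableAt I (I.prod 𝓘(ℝ, V × (V →L[ℝ] ℝ)))
      (fun y ↦ TotalSpace.mk' (V × (V →L[ℝ] ℝ)) (E := fun y ↦ GTangentSpace I y) y (u y)) x)
    (hv : MDifferentiableAt I (I.prod 𝓘(ℝ, V × (V →L[ℝ] ℝ)))
      (fun y ↦ TotalSpace.mk' (V × (V →L[ℝ] ℝ)) (E := fun y ↦ GTangentSpace I y) y (v y)) x) :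
    courantBracket u (f • v) x = f x • courantBracket u v x + mvfderiv I f x (u x).1 • v x
      - gCan I (u x) (v x) • ((0, mvfderiv I f x) : GTangentSpace I x) := by
  have hu' := mdifferentiableAt_generalized_iff.1 hu
  have hv' := mdifferentiableAt_generalized_iff.1 hv
  have hfv : MDifferentiableAt I (I.prod 𝓘(ℝ, V × (V →L[ℝ] ℝ)))
      (fun y ↦ TotalSpace.mk' (V × (V →L[ℝ] ℝ)) (E := fun y ↦ GTangentSpace I y) y ((f • v) y)) x :=
    hf.smul_section hv
  refine Prod.ext ?_ ?_
  · have h : mlieBracket I (fun y ↦ (u y).1) (f • fun y ↦ (v y).1) x = _ :=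
      mlieBracket_smul_right hf hv'.1
    simp only [Prod.fst_add, Prod.fst_sub, Prod.smul_fst, smul_zero, sub_zero]
    exact h.trans (add_comm _ _)
  · refine covector_ext isOpen_univ (Set.mem_univ x) fun W Z hW hxW _ hZ ↦ ?_
    have hZx := mdifferentiableAt_of_contMDiffOn hW hZ hxW
    have e1 : mlieBracket I (f • fun y ↦ (v y).1) Z x = _ := mlieBracket_smul_left hf hv'.1
    have e2 : mvfderiv I (f * fun y ↦ (v y).2 (Z y)) x = _ :=
      mvfderiv_mul hf (mdifferentiableAt_pairing hv'.2 hZx)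
    have e3 : mvfderiv I (f * fun y ↦ (v y).2 (u y).1) x = _ :=
      mvfderiv_mul hf (mdifferentiableAt_pairing hv'.2 hu'.1)
    have e4 : mvfderiv I (f * fun y ↦ (u y).2 (v y).1) x = _ :=
      mvfderiv_mul hf (mdifferentiableAt_pairing hu'.2 hv'.1)
    have f4 : (fun y ↦ (u y).2 ((f • v) y).1) = f * fun y ↦ (u y).2 (v y).1 := by
      funext y
      exact (u y).2.map_smul (f y) _
    have h := courantBracket_snd_apply hu hfv hZx
    rw [f4, e4] at h
    change _ = mvfderiv I (f * fun y ↦ (v y).2 (Z y)) x (u x).1 - _ - (_ - (u x).2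
      (mlieBracket I (f • fun y ↦ (v y).1) Z x)) + _ * (_ -
        mvfderiv I (f * fun y ↦ (v y).2 (u y).1) x (Z x)) at h
    rw [e1, e2, e3] at h
    rw [h]
    simp only [Prod.snd_add, Prod.snd_sub, Prod.smul_snd, add_apply, sub_apply, smul_apply,
      courantBracket_snd_apply hu hv hZx, smul_eq_mul, gCan, Pi.smul_apply', Prod.smul_fst,
      map_add, map_smul, map_neg, neg_smul]
    ring

theorem courantBracket_add_right
    (hu : MDifferentiableAt I (I.prod 𝓘(ℝ, V × (V →L[ℝ] ℝ)))
      (fun y ↦ TotalSpace.mk' (V × (V →L[ℝ] ℝ)) (E := fun y ↦ GTangentSpace I y) y (u y)) x)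
    (hv : MDifferentiableAt I (I.prod 𝓘(ℝ, V × (V →L[ℝ] ℝ)))
      (fun y ↦ TotalSpace.mk' (V × (V →L[ℝ] ℝ)) (E := fun y ↦ GTangentSpace I y) y (v y)) x)
    (hw : MDifferentiableAt I (I.prod 𝓘(ℝ, V × (V →L[ℝ] ℝ)))
      (fun y ↦ TotalSpace.mk' (V × (V →L[ℝ] ℝ)) (E := fun y ↦ GTangentSpace I y) y (w y)) x) :
    courantBracket u (v + w) x = courantBracket u v x + courantBracket u w x := by
  have hu' := mdifferentiableAt_generalized_iff.1 hu
  have hv' := mdifferentiableAt_generalized_iff.1 hv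
  have hw' := mdifferentiableAt_generalized_iff.1 hw
  have hvw : MDifferentiableAt I (I.prod 𝓘(ℝ, V × (V →L[ℝ] ℝ)))
      (fun y ↦ TotalSpace.mk' (V × (V →L[ℝ] ℝ)) (E := fun y ↦ GTangentSpace I y) y ((v + w) y)) x :=
    mdifferentiableAt_add_section hv hw
  refine Prod.ext ?_ ?_
  · exact mlieBracket_add_right hv'.1 hw'.1
  · refine covector_ext isOpen_univ (Set.mem_univ x) fun W Z hW hxW _ hZ ↦ ?_
    have hZx := mdifferentiableAt_of_contMDiffOn hW hZ hxW
    have e1 : mlieBracket I ((fun y ↦ (v y).1) + fun y ↦ (w y).1) Z x = _ :=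
      mlieBracket_add_left hv'.1 hw'.1
    have e2 : mvfderiv I ((fun y ↦ (v y).2 (Z y)) + fun y ↦ (w y).2 (Z y)) x = _ :=
      mvfderiv_add (mdifferentiableAt_pairing hv'.2 hZx) (mdifferentiableAt_pairing hw'.2 hZx)
    have e3 : mvfderiv I ((fun y ↦ (v y).2 (u y).1) + fun y ↦ (w y).2 (u y).1) x = _ :=
      mvfderiv_add (mdifferentiableAt_pairing hv'.2 hu'.1) (mdifferentiableAt_pairing hw'.2 hu'.1)
    have e4 : mvfderiv I ((fun y ↦ (u y).2 (v y).1) + fun y ↦ (u y).2 (w y).1) x = _ :=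
      mvfderiv_add (mdifferentiableAt_pairing hu'.2 hv'.1) (mdifferentiableAt_pairing hu'.2 hw'.1)
    have f4 : (fun y ↦ (u y).2 ((v + w) y).1) = (fun y ↦ (u y).2 (v y).1)
        + fun y ↦ (u y).2 (w y).1 := by
      funext y
      exact (u y).2.map_add _ _
    have h := courantBracket_snd_apply hu hvw hZx
    rw [f4, e4] at h
    change _ = mvfderiv I ((fun y ↦ (v y).2 (Z y)) + fun y ↦ (w y).2 (Z y)) x (u x).1 - _ -
      (_ - (u x).2 (mlieBracket I ((fun y ↦ (v y).1) + fun y ↦ (w y).1) Z x)) + _ * (_ -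
        mvfderiv I ((fun y ↦ (v y).2 (u y).1) + fun y ↦ (w y).2 (u y).1) x (Z x)) at h
    rw [e1, e2, e3] at h
    rw [h]
    simp only [Prod.snd_add, add_apply, courantBracket_snd_apply hu hv hZx,
      courantBracket_snd_apply hu hw hZx, Pi.add_apply, Prod.fst_add, map_add]
    ring

variable {J : GeneralizedComplexStructure I M}

/-- The derivatives of `f` along vector parts cancel as for an almost complex structure. The
anomalies in `df` cancel because skew-symmetry gives `g(𝒥u, 𝒥v) = g(u, v)` and `g(𝒥u, v) = -g(u,
𝒥v)`. -/
theorem tensorialAt_nijenhuis_courantBracket_right (hJ : J.IsSkewSymmetric)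
    (hu : MDifferentiableAt I (I.prod 𝓘(ℝ, V × (V →L[ℝ] ℝ)))
      (fun y ↦ TotalSpace.mk' (V × (V →L[ℝ] ℝ)) (E := fun y ↦ GTangentSpace I y) y (u y)) x) :
    TensorialAt I (V × (V →L[ℝ] ℝ)) (V := fun y : M ↦ GTangentSpace I y)
      (fun v ↦ nijenhuis (B := fun y ↦ GTangentSpace I y)
        (fun x ↦ (J.toFun x : GTangentSpace I x →ₗ[ℝ] GTangentSpace I x))
        (fun u v ↦ courantBracket u v x) u v) x where
  smul {f v} hf hv := by
    have h : (fun y ↦ J.toFun y ((f • v) y)) = f • fun y ↦ J.toFun y (v y) := by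
      funext y
      exact (J.toFun y).map_smul (f y) _
    have hKu := J.mdifferentiableAt_apply hu
    have hKv := J.mdifferentiableAt_apply hv
    simp only [nijenhuis, ContinuousLinearMap.coe_coe]
    rw [h, courantBracket_smul_right hf hKu hKv, courantBracket_smul_right hf hKu hv,
      courantBracket_smul_right hf hu hKv, courantBracket_smul_right hf hu hv,
      hJ x (u x), hJ x (u x), J.sq]
    have hg : gCan I (u x) (-v x) = -gCan I (u x) (v x) := by
      simp only [gCan, Prod.fst_neg, Prod.snd_neg, map_neg, neg_apply]
      ring
    have hadd : ∀ a b, J.toFun x (a + b) = J.toFun x a + J.toFun x b := (J.toFun x).map_add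
    have hsub : ∀ a b, J.toFun x (a - b) = J.toFun x a - J.toFun x b := (J.toFun x).map_sub
    have hsmul : ∀ (c : ℝ) a, J.toFun x (c • a) = c • J.toFun x a := (J.toFun x).map_smul
    rw [hg]
    simp only [hadd, hsub, hsmul, J.sq]
    module
  add {v w} hv hw := by
    have h : (fun y ↦ J.toFun y ((v + w) y)) = (fun y ↦ J.toFun y (v y)) + fun y ↦ J.toFun y (w y) := by
      funext y
      exact (J.toFun y).map_add _ _
    have hKu := J.mdifferentiableAt_apply hu
    have hKv := J.mdifferentiableAt_apply hv
    have hKw := J.mdifferentiableAt_apply hw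
    simp only [nijenhuis, ContinuousLinearMap.coe_coe]
    rw [h, courantBracket_add_right hKu hKv hKw, courantBracket_add_right hKu hv hw,
      courantBracket_add_right hu hKv hKw, courantBracket_add_right hu hv hw]
    have hadd : ∀ a b, J.toFun x (a + b) = J.toFun x a + J.toFun x b := (J.toFun x).map_add
    simp only [hadd]
    module

theorem nijenhuis_courantBracket_swap (u v : ∀ x : M, GTangentSpace I x) :
    nijenhuis (B := fun y ↦ GTangentSpace I y)
        (fun x ↦ (J.toFun x : GTangentSpace I x →ₗ[ℝ] GTangentSpace I x))
        (fun u v ↦ courantBracket u v x) u v =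
      -nijenhuis (B := fun y ↦ GTangentSpace I y)
        (fun x ↦ (J.toFun x : GTangentSpace I x →ₗ[ℝ] GTangentSpace I x))
        (fun u v ↦ courantBracket u v x) v u := by
  simp only [nijenhuis]
  rw [courantBracket_swap u v, courantBracket_swap u, courantBracket_swap _ v,
    courantBracket_swap (fun y ↦ (J.toFun y : GTangentSpace I y →ₗ[ℝ] GTangentSpace I y) (u y))
      (fun y ↦ (J.toFun y : GTangentSpace I y →ₗ[ℝ] GTangentSpace I y) (v y))]
  simp only [map_neg]
  abel

theorem tensorialAt_nijenhuis_courantBracket_left (hJ : J.IsSkewSymmetric)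
    (hv : MDifferentiableAt I (I.prod 𝓘(ℝ, V × (V →L[ℝ] ℝ)))
      (fun y ↦ TotalSpace.mk' (V × (V →L[ℝ] ℝ)) (E := fun y ↦ GTangentSpace I y) y (v y)) x) :
    TensorialAt I (V × (V →L[ℝ] ℝ)) (V := fun y : M ↦ GTangentSpace I y)
      (fun u ↦ nijenhuis (B := fun y ↦ GTangentSpace I y)
        (fun x ↦ (J.toFun x : GTangentSpace I x →ₗ[ℝ] GTangentSpace I x))
        (fun u v ↦ courantBracket u v x) u v) x where
  smul hf hu := by
    rw [nijenhuis_courantBracket_swap, (tensorialAt_nijenhuis_courantBracket_right hJ hv).smul hf hu,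
      nijenhuis_courantBracket_swap _ v, smul_neg]
  add hu hw := by
    rw [nijenhuis_courantBracket_swap, (tensorialAt_nijenhuis_courantBracket_right hJ hv).add hu hw,
      nijenhuis_courantBracket_swap _ v, nijenhuis_courantBracket_swap _ v, neg_add]

end CourantTensor

/-! ### The equivalence on Lie groups. -/

section LieGroupIntegrability

variable {V : Type*} [NormedAddCommGroup V] [NormedSpace ℝ V] [FiniteDimensional ℝ V]
  {H : Type*} [TopologicalSpace H] {I : ModelWithCorners ℝ V H}
  {G : Type*} [TopologicalSpace G] [ChartedSpace H G] [Group G] [LieGroup I ∞ G]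

/-- On left-invariant sections the Courant bracket agrees with the bracket of the lifts with respect
to the connection `D^c`. -/
theorem courantBracket_leftInvariantSection (γ : CotangentBundle I G)
    (w w' : GTangentSpace I (1 : G)) :
    courantBracket (leftInvariantSection w) (leftInvariantSection w') γ.proj =
      liftBracket lieBracketConnection γ (leftInvariantSection w) (leftInvariantSection w') := by
  have hD := lieBracketConnection_preservesSmooth (I := I) (G := G)
  have hu := contMDiff_leftInvariantSection w Set.univ
  have hv := contMDiff_leftInvariantSection w' Set.univ
  refine Prod.ext (liftBracket_fst hD isOpen_univ (Set.mem_univ _) hu hv).symm ?_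
  ext z
  obtain ⟨c, rfl⟩ : ∃ c : GroupLieAlgebra I G, mulInvariantVectorField c γ.proj = z :=
    ⟨_, mulInvariantVectorField_leftTrivialize γ.proj z⟩
  have h := courantBracket_sub_liftBracket_snd_apply hD isOpen_univ (Set.mem_univ γ.proj) hu hv
    (contMDiff_infty_mulInvariantVectorField c).contMDiffOn
  -- Pairings of left-invariant sections are constant, so the exact term of the Courant bracket
  -- drops out.
  have hconst : ∀ p q : GTangentSpace I (1 : G),
      (fun y : G ↦ (leftInvariantSection p y).2 (leftInvariantSection q y).1) =
        fun _ ↦ p.2 q.1 := fun p q ↦ funext fun y ↦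
    congrArg p.2 (leftTrivialize_mulInvariantVectorField y q.1)
  have hconn : ∀ (p : GTangentSpace I (1 : G)) (Y : ∀ g : G, TangentSpace I g) (y : G),
      lieBracketConnection Y y (leftInvariantSection p y).1 =
        mlieBracket I (fun y ↦ (leftInvariantSection p y).1) Y y := fun p Y y ↦
    lieBracketConnection_apply_mulInvariantVectorField p.1 Y y
  -- The bracket of left-invariant fields is left-invariant, so `D^c` along it is again a bracket.
  -- The curvature term at `γ` thereby becomes the Jacobi expression handled by `hjac`.
  have hbr : lieBracketConnection (mulInvariantVectorField c) γ.proj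
      (mlieBracket I (fun y ↦ (leftInvariantSection w y).1)
        (fun y ↦ (leftInvariantSection w' y).1) γ.proj) =
      mlieBracket I (mlieBracket I (fun y ↦ (leftInvariantSection w y).1)
        (fun y ↦ (leftInvariantSection w' y).1)) (mulInvariantVectorField c) γ.proj := by
    have h1 := mulInvariantVector_mlieBracket (I := I) (G := G) (w.1 : GroupLieAlgebra I G) w'.1
    change lieBracketConnection (mulInvariantVectorField c) γ.proj
      (mlieBracket I (mulInvariantVectorField (w.1 : GroupLieAlgebra I G))
        (mulInvariantVectorField (w'.1 : GroupLieAlgebra I G)) γ.proj) =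
      mlieBracket I (mlieBracket I (mulInvariantVectorField (w.1 : GroupLieAlgebra I G))
        (mulInvariantVectorField (w'.1 : GroupLieAlgebra I G))) (mulInvariantVectorField c) γ.proj
    rw [← h1]
    exact lieBracketConnection_apply_mulInvariantVectorField _ _ _
  have hsm : ∀ v : GroupLieAlgebra I G, CMDiffAt (minSmoothness ℝ 2)
      (T% (fun g : G ↦ mulInvariantVectorField v g)) γ.proj := fun v ↦
    contMDiffAt_mulInvariantVectorField v
  have hjac : mlieBracket I (fun y ↦ (leftInvariantSection w y).1)
      (mlieBracket I (fun y ↦ (leftInvariantSection w' y).1) (mulInvariantVectorField c)) γ.proj =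
      mlieBracket I (mlieBracket I (fun y ↦ (leftInvariantSection w y).1)
        (fun y ↦ (leftInvariantSection w' y).1)) (mulInvariantVectorField c) γ.proj +
      mlieBracket I (fun y ↦ (leftInvariantSection w' y).1)
        (mlieBracket I (fun y ↦ (leftInvariantSection w y).1) (mulInvariantVectorField c)) γ.proj :=
    leibniz_identity_mlieBracket_apply (hsm _) (hsm _) (hsm _)
  simp only [hconst, hconn] at h
  rw [hbr] at h
  have hjac' := congrArg γ.2 hjac
  rw [map_add] at hjac'
  rw [← sub_eq_zero]
  refine h.trans ?_
  simp only [mvfderiv_const, zero_apply]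
  linear_combination -hjac'

/-- An invariant `J` preserves left-invariant sections, so only brackets of such sections occur, and
these agree. -/
theorem GeneralizedComplexStructure.IsLeftInvariant.nijenhuis_eq
    {J : GeneralizedComplexStructure I G} (hJ : J.IsLeftInvariant) (γ : CotangentBundle I G)
    (w w' : GTangentSpace I (1 : G)) :
    nijenhuis (B := fun y ↦ GTangentSpace I y)
        (fun x ↦ (J.toFun x : GTangentSpace I x →ₗ[ℝ] GTangentSpace I x))
        (fun u v ↦ courantBracket u v γ.proj) (leftInvariantSection w) (leftInvariantSection w') =
      nijenhuis (B := fun y ↦ GTangentSpace I y)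
        (fun x ↦ (J.toFun x : GTangentSpace I x →ₗ[ℝ] GTangentSpace I x))
        (liftBracket lieBracketConnection γ) (leftInvariantSection w) (leftInvariantSection w') := by
  have h : ∀ w, (fun y ↦ J.toFun y (leftInvariantSection w y)) =
      leftInvariantSection (J.toFun 1 w) := fun w ↦ funext (hJ.apply_leftInvariantSection w)
  simp only [nijenhuis, ContinuousLinearMap.coe_coe, h, courantBracket_leftInvariantSection]

/-- Both Nijenhuis expressions depend only on the values at a point, every value is taken by a
left-invariant section, and there the expressions coincide. -/
theorem isCourantIntegrable_iff_of_isLeftInvariant {J : GeneralizedComplexStructure I G}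
    (hJ : J.IsSkewSymmetric) (hJl : J.IsLeftInvariant) :
    J.IsCourantIntegrable ↔ IsIntegrableAlmostComplex (I.prod 𝓘(ℝ, V →L[ℝ] ℝ))
      (cotangentAlmostComplex J lieBracketConnection) := by
  have hJJ : ∀ x w, (J.toFun x : GTangentSpace I x →ₗ[ℝ] GTangentSpace I x)
      ((J.toFun x : GTangentSpace I x →ₗ[ℝ] GTangentSpace I x) w) = -w := J.sq
  have hD := lieBracketConnection_preservesSmooth (I := I) (G := G)
  have hli := fun w : GTangentSpace I (1 : G) ↦ contMDiff_leftInvariantSection w Set.univ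
  have hd := fun (w : GTangentSpace I (1 : G)) (g : G) ↦
    mdifferentiableAt_of_contMDiffOn isOpen_univ (hli w) (Set.mem_univ g)
  rw [isIntegrableAlmostComplex_iff hD]
  have hC : J.IsCourantIntegrable ↔ _ :=
    sectionsClosedUnder_iff_nijenhuis hJJ isLocalOddOp_courantBracket
  rw [hC]
  constructor
  · intro h γ U u v hU hγ hu hv
    obtain ⟨w, hw⟩ := exists_leftInvariantSection_eq (u γ.proj)
    obtain ⟨w', hw'⟩ := exists_leftInvariantSection_eq (v γ.proj)
    have hO := isOpen_preimage_proj (I := I) hU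
    have hA := mdifferentiableAt_of_contMDiffOn hO (contMDiffOn_liftField' hD hU hu) hγ
    have hB := mdifferentiableAt_of_contMDiffOn hO (contMDiffOn_liftField' hD hU hv) hγ
    -- The same value of the Nijenhuis tensor on `T*M` is computed from `u`, `v` and from the
    -- invariant sections through their values; this makes the expression for the bracket of lifts
    -- pointwise.
    have h1 := nijenhuis_cotangentAlmostComplex hD J hA hB hU hγ hu hv rfl rfl
    rw [nijenhuis_cotangentAlmostComplex hD J hA hB isOpen_univ (Set.mem_univ _) (hli w) (hli w')
      (by rw [liftField, liftField, hw]) (by rw [liftField, liftField, hw'])] at h1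
    rw [← (horizontalVerticalEquiv lieBracketConnection γ).injective h1, ← hJl.nijenhuis_eq]
    exact h _ _ _ isOpen_univ (hli w) (hli w') (J.contMDiffOn_apply (hli w))
      (J.contMDiffOn_apply (hli w')) _ (Set.mem_univ _)
  · intro h U u v hU hu hv _ _ x hx
    obtain ⟨w, hw⟩ := exists_leftInvariantSection_eq (u x)
    obtain ⟨w', hw'⟩ := exists_leftInvariantSection_eq (v x)
    have h1 := TensorialAt.pointwise₂
      (fun τ hτ ↦ tensorialAt_nijenhuis_courantBracket_left hJ hτ)
      (fun σ hσ ↦ tensorialAt_nijenhuis_courantBracket_right hJ hσ)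
      (mdifferentiableAt_of_contMDiffOn hU hu hx) (hd w x)
      (mdifferentiableAt_of_contMDiffOn hU hv hx) (hd w' x) hw.symm hw'.symm
    refine h1.trans ((hJl.nijenhuis_eq ⟨x, 0⟩ w w').trans ?_)
    exact h ⟨x, 0⟩ _ _ _ isOpen_univ (Set.mem_univ _) (hli w) (hli w')

end LieGroupIntegrability

end

theorem corollary3p3
    {V : Type*} [NormedAddCommGroup V] [NormedSpace ℝ V] [FiniteDimensional ℝ V]
    {M : Type*} [TopologicalSpace M] [T2Space M] [ChartedSpace V M] [IsManifold 𝓘(ℝ, V) ∞ M]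
    {W : Type*} [NormedAddCommGroup W] [NormedSpace ℝ W] [FiniteDimensional ℝ W]
    {G : Type*} [TopologicalSpace G] [T2Space G] [ChartedSpace W G] [Group G]
    [LieGroup 𝓘(ℝ, W) ∞ G] :
    (∀ (J : GeneralizedComplexStructure 𝓘(ℝ, V) M)
        (D : CovariantDerivative 𝓘(ℝ, V) V (TangentSpace 𝓘(ℝ, V) : M → Type _))
        (E : ∀ x : M, Submodule ℂ (CxTangent 𝓘(ℝ, V) x))
        (α : ∀ x : M, E x →ₗ[ℂ] E x →ₗ[ℂ] ℂ),
      J.IsSkewSymmetric →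
      D.ContMDiffCovariantDerivative ∞ →
      IsComplexSubbundle 𝓘(ℝ, V) V E →
      (∀ x, (J.holomorphicBundle x : Set (Complexification (GTangentSpace 𝓘(ℝ, V) x))) =
        holomorphicSpace (E x) (α x)) →
      IsInvolutive 𝓘(ℝ, V) E →
      PreservesSections D E →
      CurvatureVanishesOn D E →
      TorsionRelation D E α →
      (IsIntegrableAlmostComplex (𝓘(ℝ, V).prod 𝓘(ℝ, V →L[ℝ] ℝ)) (cotangentAlmostComplex J D) ↔
        J.IsCourantIntegrable)) ∧
    (∀ J : GeneralizedComplexStructure 𝓘(ℝ, W) G,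
      J.IsSkewSymmetric →
      J.IsLeftInvariant →
      (J.IsCourantIntegrable ↔
        IsIntegrableAlmostComplex (𝓘(ℝ, W).prod 𝓘(ℝ, W →L[ℝ] ℝ))
          (cotangentAlmostComplex J lieBracketConnection))) := by
  refine ⟨fun J D E α hJ hD hE hL hinv hDE hR hT ↦ ?_, fun J hJ hJl ↦ ?_⟩
  · exact isIntegrableAlmostComplex_cotangent_iff_isCourantIntegrable hJ hD.preservesSmooth hE hL
      hinv hDE hR hT
  · exact isCourantIntegrable_iff_of_isLeftInvariant hJ hJl
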